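/- Let $k$ be a field of characteristic $0$, $S$ a commutative $k$-algebra, and let $da$ ($a\in S$) denote Kähler differentials over $k$; forms live in $\bigwedge_S\Omega_{S/k}$. For an invertible square matrix $A$ over $S$ put $\omega_A^{r}=\operatorname{tr}\big((A^{-1}dA)^{r}\big)$. Let $n>1$, $m=n-1$. **Notation.** For $\nu\subset\{1,\dots,n\}^2$ with $|\nu|=2n-1$, ordered as $(i_1,j_1),\dots,(i_{2n-1},j_{2n-1})$, let $M_\nu$ be the $(2n-1)\times 2n$ matrix whose $r$-th row has $-1$ in column $i_r$, $1$ in column $n+j_r$, and $0$ elsewhere, and put $$\omega_\nu(A)=(-1)^{\binom n2}\det(M_\nu^{\emptyset,1})\;da_{i_1j_1}\wedge\dots\wedge da_{i_{2n-1}j_{2n-1}},$$ where $M_\nu^{\emptyset,1}$ is $M_\nu$ without its first column (this is independent of the ordering). For even $m$, let $\mathcal D_m^k$ be the set of unordered $k$-tuples $\{\{I_1,J_1\},\dots,\{I_k,J_k\}\}$ of unordered pairs of non-empty sets with $|I_i|=|J_i|$ such that $\{1,\dots,m\}$ is the disjoint union of all $I_i$ and $J_i$. For $\mathcal E=\{(s_1,t_1),\dots,(s_m,t_m)\}$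 and $I=\{i_1<\dots<i_p\}$ let $\mathcal E_I=(s_{i_1},t_{i_1},\dots,s_{i_p},t_{i_p})$. For a tuple $L=(l_1,\dots,l_p)$ let $\sigma(L)=(-1)^{l_1+\dots+l_p}\operatorname{sgn}\pi_L$, where $\pi_L$ is the permutation that puts $L$ into increasing order, and $\sigma(L)=0$ if $L$ has repeated entries. Let $A^{L,L'}$ be $A$ without the rows in $L$ and the columns in $L'$. For symmetric $A$ put $$Q_k(A,\mathcal E)=\sum_{\{\{I_1,J_1\},\dots,\{I_k,J_k\}\}\in\mathcal D_m^k}\ \prod_{i=1}^k\sigma(\mathcal E_{I_i})\,\sigma(\mathcal E_{J_i})\det A^{\mathcal E_{I_i},\mathcal E_{J_i}},$$ $$L(A)=(2n-1)\sum_{\substack{\mathcal E\subseteq\{(i,j):1\le i<j\le n\}\\|\mathcal E|=m}}\ \sum_{k=1}^{m/2}(-2)^k\,k!\,\frac{Q_k(A,\mathcal E)}{\det(A)^{k+1}}\;\omega_{\mathrm{diag}_n\cup\mathcal E}(A),\qquad \mathrm{diag}_n=\{(1,1),\dots,(n,n)\}.$$ **(1)** Let $A=(a_{ij})$ be a symmetric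 invertible $n\times n$ matrix over $S$. If $n$ is odd, then $$\omega_A^{2n-1}=L(A)+(\text{terms of degree}<n\text{ in }da_{11},\dots,da_{nn}).$$ If $n$ is even, all terms of $\omega_A^{2n-1}$ have degree $<n$ in $da_{11},\dots,da_{nn}$. Here the terms of degree $<n$ are the elements of the $S$-span of the products of $2n-1$ differentials $da_{ij}$ of which fewer than $n$ are diagonal. **(2)** Let $G$ be a finite connected (multi)graph with $2n$ edges and $h_G=\operatorname{rank}H_1(G;\mathbb Z)=n$. Orient its edges. For a $\mathbb Z$-basis $c=(c_1,\dots,c_n)$ of $H_1(G;\mathbb Z)\subset\mathbb Z^{E(G)}$ and $x\in S^{E(G)}$, the graph Laplacian $\Lambda_c(x)$ has entries $\sum_e c_i(e)c_j(e)x_e$, and $\Psi_G(x)=\det\Lambda_c(x)$, which does not depend on $c$. Let $\Psi_G(x)$ be a unit and let $\omega_G^{2n-1}=\omega^{2n-1}_{\Lambda_b(x)}$, for any basis $b$ of $H_1(G;\mathbb Z)$. If $n$ is odd, let $T$ be a spanning tree, $e_0\in T$ an edge for which $x_{e_0}$ is a unit, and $c$ a basis of $H_1(G;\mathbb Z)$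 each member of which meets the complement of $T$ in a single edge. Let $y=x/x_{e_0}$ be the coordinates of $x$ in the affine chart in which the variable of $e_0$ is $1$ (so $y=x$ if $x_{e_0}=1$), and let $\Lambda_G(T)=\Lambda_c(y)$. Then $\omega_G^{2n-1}=L(\Lambda_G(T))$, that is, $$\omega_G^{2n-1}=(2n-1)\sum_{\mathcal E}\sum_{k=1}^{m/2}(-2)^k\,k!\,\frac{Q_k(\Lambda_G(T),\mathcal E)}{\Psi_G(y)^{k+1}}\;\omega_{\mathrm{diag}_n\cup\mathcal E}(\Lambda_G(T)).$$ If $n$ is even, then $\omega_G^{2n-1}=0$. -/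

import Mathlib

open scoped KaehlerDifferential

universe u v

noncomputable section

namespace CanonicalForm

/-! ### Algebraic differential forms and the forms `tr ((A⁻¹ dA) ^ r)` -/

/-- The algebra of (algebraic) differential forms of `S` over `k`: the exterior algebra over `S` of
the module of Kähler differentials. Its multiplication is the wedge product. -/
abbrev Forms (k S : Type*) [CommRing k] [CommRing S] [Algebra k S] : Type _ :=
  ExteriorAlgebra S (Ω[S⁄k])

section Forms

variable (k : Type*) {S : Type*} [CommRing k] [CommRing S] [Algebra k S]

/-- The one-form `da`. -/
def d (a : S) : Forms k S :=
  ExteriorAlgebra.ι S (KaehlerDifferential.D k S a)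

/-- The matrix of one-forms `dA`. -/
def dMat {ι : Type*} (A : Matrix ι ι S) : Matrix ι ι (Forms k S) :=
  A.map (d k)

/-- The form `ω_A^r = tr ((A⁻¹ dA) ^ r)`. -/
def invForm {ι : Type*} [Fintype ι] [DecidableEq ι] (A : Matrix ι ι S) (r : ℕ) : Forms k S :=
  Matrix.trace ((A⁻¹.map (algebraMap S (Forms k S)) * dMat k A) ^ r)

/-- The forms of degree `2n-1` in the differentials of the entries of `A` all of whose terms have
degree `< n` in the diagonal differentials `da₁₁, …, daₙₙ`. -/
def lowerDiagTerms {n : ℕ} (A : Matrix (Fin n) (Fin n) S) : Submodule S (Forms k S) :=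
  Submodule.span S
    {θ | ∃ ν : Fin (2 * n - 1) → Fin n × Fin n,
      (Finset.univ.filter fun r => (ν r).1 = (ν r).2).card < n ∧
      θ = (List.ofFn fun r => d k (A (ν r).1 (ν r).2)).prod}

end Forms

/-! ### Types and the forms `ω_ν` -/

/-- A finite set of pairs, listed in lexicographic order. -/
def lexEnum {n m : ℕ} (ν : Finset (Fin n × Fin n)) (h : ν.card = m) (r : Fin m) :
    Fin n × Fin n :=
  ofLex ((ν.map toLex.toEmbedding).orderEmbOfFin ((Finset.card_map _).trans h) r)

/-- The matrix `M_ν` of a sequence of `2n-1` pairs: row `(i, j)` has `-1` in column `i`, `1` in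
column `n + j` and `0` elsewhere. The `2n` columns are indexed by `Fin (2 * n - 1 + 1)`, counted
from `0`. -/
def incMatrix {n : ℕ} (ν : Fin (2 * n - 1) → Fin n × Fin n) :
    Matrix (Fin (2 * n - 1)) (Fin (2 * n - 1 + 1)) ℤ :=
  Matrix.of fun r c =>
    if (c : ℕ) = ((ν r).1 : ℕ) then -1 else if (c : ℕ) = n + ((ν r).2 : ℕ) then 1 else 0

/-- The form `ω_ν = (-1) ^ (n choose 2) det (M_ν^{∅,1}) ω_{i₁j₁} ∧ … ∧ ω_{i_{2n-1}j_{2n-1}}` of a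
type `ν` (a set of `2n-1` pairs) and a matrix `Υ` of one-forms, where `M_ν^{∅,1}` is `M_ν` without
its first column. The pairs are taken in lexicographic order; any other order, and the deletion of
the column number `c` with the sign `(-1) ^ (n choose 2 + c - 1)`, give the same form. -/
def omegaType {n : ℕ} {R : Type*} [Ring R] (Υ : Matrix (Fin n) (Fin n) R)
    (ν : Finset (Fin n × Fin n)) (h : ν.card = 2 * n - 1) : R :=
  (((-1) ^ n.choose 2 *
      ((incMatrix (lexEnum ν h)).submatrix id (Fin.succAbove 0)).det : ℤ) : R) *
    (List.ofFn fun r => Υ (lexEnum ν h r).1 (lexEnum ν h r).2).prod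

/-- The diagonal `{(1,1), …, (n,n)}`. -/
def diagPairs (n : ℕ) : Finset (Fin n × Fin n) :=
  Finset.univ.filter fun q => q.1 = q.2

/-- The index set of the sum: sets `ℰ` of `n-1` pairs `(i, j)` with `i < j`. -/
abbrev OffDiag (n : ℕ) : Type :=
  {ℰ : Finset (Fin n × Fin n) // (∀ q ∈ ℰ, q.1 < q.2) ∧ ℰ.card = n - 1}

theorem card_diag_union {n : ℕ} (ℰ : OffDiag n) :
    (diagPairs n ∪ ℰ.1).card = 2 * n - 1 := by
  have h1 : (diagPairs n).card = n := by
    have : diagPairs n = Finset.univ.image fun i : Fin n => (i, i) := by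
      ext ⟨a, b⟩
      simp [diagPairs]
    rw [this, Finset.card_image_of_injective _ (fun a b h => (Prod.ext_iff.1 h).1),
      Finset.card_univ, Fintype.card_fin]
  have h2 : Disjoint (diagPairs n) ℰ.1 := by
    rw [Finset.disjoint_left]
    intro q hq hq'
    have := ℰ.2.1 q hq'
    simp only [diagPairs, Finset.mem_filter, Finset.mem_univ, true_and] at hq
    exact absurd hq this.ne
  rw [Finset.card_union_of_disjoint h2, h1, ℰ.2.2]
  omega

/-! ### The polynomials `Q_k` -/

/-- The set `𝒟_m^k` of unordered `k`-tuples of unordered pairs `{I, J}` of non-empty sets of equal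
size, such that all these sets together are a decomposition of `{1, …, m}` into a disjoint union. -/
def pairings (m k : ℕ) : Finset (Finset (Sym2 (Finset (Fin m)))) := by
  classical
  exact Finset.univ.filter fun P =>
    P.card = k ∧
    (∀ p ∈ P, ∃ I J : Finset (Fin m),
      p = s(I, J) ∧ I.Nonempty ∧ J.Nonempty ∧ I.card = J.card ∧ Disjoint I J) ∧
    (∀ a : Fin m, ∃! p : Sym2 (Finset (Fin m)), p ∈ P ∧ ∃ I ∈ p, a ∈ I)

/-- The tuple `ℰ_I = (s_{i₁}, t_{i₁}, …, s_{i_r}, t_{i_r})` for `I = {i₁ < … < i_r}` and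
`ℰ_i = (s_i, t_i)`. -/
def tupleOf {n m : ℕ} (ℰ : Fin m → Fin n × Fin n) (I : Finset (Fin m)) : List (Fin n) :=
  (I.sort (· ≤ ·)).flatMap fun i => [(ℰ i).1, (ℰ i).2]

/-- The sign `σ(I) = (-1) ^ (i₁ + … + i_r) sgn π_I`, where `π_I` puts the tuple `I` into increasing
order (the indices are counted from `1`); it is `0` if `I` has repeated entries. -/
def sigmaSign {n : ℕ} (l : List (Fin n)) : ℤ :=
  if l.Nodup then
    (-1) ^ (l.map fun i => (i : ℕ) + 1).sum * (Equiv.Perm.sign (Tuple.sort l.get) : ℤ)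
  else 0

section Q

variable {n : ℕ} {S : Type*} [CommRing S]

/-- `det A^{I,J}`, where `A^{I,J}` is obtained from `A` by deleting the rows in `I` and the columns
in `J`. (The value is `0` if the resulting matrix is not square.) -/
def delDet (A : Matrix (Fin n) (Fin n) S) (I J : Finset (Fin n)) : S :=
  if h : Jᶜ.card = Iᶜ.card then
    (A.submatrix (Iᶜ.orderEmbOfFin rfl) (Jᶜ.orderEmbOfFin h)).det
  else 0

theorem delDet_comm {A : Matrix (Fin n) (Fin n) S} (hA : A.IsSymm) (I J : Finset (Fin n)) :
    delDet A I J = delDet A J I := by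
  have key : ∀ (a b : ℕ) (hI : Iᶜ.card = a) (hI' : Iᶜ.card = b) (hJ : Jᶜ.card = a)
      (hJ' : Jᶜ.card = b),
      (A.submatrix (Iᶜ.orderEmbOfFin hI) (Jᶜ.orderEmbOfFin hJ)).det =
        (A.submatrix (Jᶜ.orderEmbOfFin hJ') (Iᶜ.orderEmbOfFin hI')).det := by
    intro a b hI hI' hJ hJ'
    obtain rfl : a = b := hI.symm.trans hI'
    rw [← Matrix.det_transpose, Matrix.transpose_submatrix, hA.eq]
  unfold delDet
  by_cases h : Jᶜ.card = Iᶜ.card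
  · rw [dif_pos h, dif_pos h.symm]
    exact key _ _ rfl h.symm h rfl
  · rw [dif_neg h, dif_neg fun h' => h h'.symm]

/-- The factor `σ(ℰ_I) σ(ℰ_J) det A^{ℰ_I,ℰ_J}` of an unordered pair `{I, J}`, for symmetric `A`. -/
def pairTerm (A : Matrix (Fin n) (Fin n) S) (hA : A.IsSymm) {m : ℕ} (ℰ : Fin m → Fin n × Fin n) :
    Sym2 (Finset (Fin m)) → S :=
  Sym2.lift ⟨fun I J =>
      (sigmaSign (tupleOf ℰ I) : S) * (sigmaSign (tupleOf ℰ J) : S) *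
        delDet A (tupleOf ℰ I).toFinset (tupleOf ℰ J).toFinset,
    fun I J => by
      dsimp only
      rw [delDet_comm hA (tupleOf ℰ I).toFinset]
      ring⟩

/-- `Q_k(A, ℰ) = ∑_{{{I₁,J₁},…,{I_k,J_k}} ∈ 𝒟_m^k} ∏ᵢ σ(ℰ_{Iᵢ}) σ(ℰ_{Jᵢ}) det A^{ℰ_{Iᵢ},ℰ_{Jᵢ}}`. -/
def Q (A : Matrix (Fin n) (Fin n) S) (hA : A.IsSymm) {m : ℕ} (ℰ : Fin m → Fin n × Fin n)
    (k : ℕ) : S :=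
  ∑ P ∈ pairings m k, ∏ p ∈ P, pairTerm A hA ℰ p

/-- `(2n-1) ∑_ℰ ∑_{k=1}^{(n-1)/2} (-2)^k k! Q_k(A, ℰ) / δ^{k+1} ω_{diag ∪ ℰ}(dA)`. Here `δ` is the
determinant that stands in the denominators. -/
def leadingTerms (k : Type*) [CommRing k] [Algebra k S] (A : Matrix (Fin n) (Fin n) S)
    (hA : A.IsSymm) (δ : S) : Forms k S :=
  (2 * (n : S) - 1) • ∑ ℰ : OffDiag n, ∑ j ∈ Finset.Icc 1 ((n - 1) / 2),
    ((-2) ^ j * (j.factorial : S) * Q A hA (lexEnum ℰ.1 ℰ.2.2) j * Ring.inverse δ ^ (j + 1)) •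
      omegaType (dMat k A) (diagPairs n ∪ ℰ.1) (card_diag_union ℰ)

end Q

/-! ### Graphs and graph Laplacians -/

section Graph

variable {V E : Type*}

/-- Any two vertices are joined by a path, and there is a vertex. -/
def IsConnected (G : Graph V E) : Prop :=
  G.vertexSet.Nonempty ∧ ∀ u ∈ G.vertexSet, ∀ v ∈ G.vertexSet, Relation.ReflTransGen G.Adj u v

/-- An orientation of every edge of a multigraph. -/
structure Orientation (G : Graph V E) where
  /-- the initial vertex -/
  tail : G.edgeSet → V
  /-- the final vertex -/
  head : G.edgeSet → V
  isLink : ∀ e : G.edgeSet, G.IsLink e (tail e) (head e)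

variable {G : Graph V E} [Fintype G.edgeSet]

open scoped Classical in
/-- The boundary map from edge chains to vertex chains, `e ↦ head e - tail e`. -/
def boundary (o : Orientation G) : (G.edgeSet → ℤ) →ₗ[ℤ] (V → ℤ) :=
  ∑ e : G.edgeSet, (LinearMap.proj e).smulRight
    (Pi.single (o.head e) (1 : ℤ) - Pi.single (o.tail e) (1 : ℤ) : V → ℤ)

/-- `H₁(G; ℤ)`, as the group of closed edge chains. -/
abbrev H1 (o : Orientation G) : Submodule ℤ (G.edgeSet → ℤ) :=
  LinearMap.ker (boundary o)

/-- The number `h_G` of independent cycles. -/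
def loopNumber (o : Orientation G) : ℕ :=
  Module.finrank ℤ (H1 o)

/-- `T` is the edge set of a spanning tree: it connects all vertices and carries no cycle. -/
def IsSpanningTree (o : Orientation G) (T : Set G.edgeSet) : Prop :=
  IsConnected (G.restrict ((↑) '' T)) ∧ ∀ c ∈ H1 o, (∀ e, e ∉ T → c e = 0) → c = 0

/-- A basis of `H₁(G; ℤ)`, each member of which meets the complement of `T` in a single edge. -/
def IsTreeBasis {n : ℕ} {o : Orientation G} (T : Set G.edgeSet)
    (c : Module.Basis (Fin n) ℤ (H1 o)) : Prop :=
  ∀ i, ∃! e : G.edgeSet, e ∉ T ∧ (c i : G.edgeSet → ℤ) e ≠ 0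

/-- The graph Laplacian in the basis `c` of `H₁(G; ℤ)`, at the values `x` of the edge variables:
the `(i, j)` entry is `⟨cᵢ, cⱼ⟩`, where `⟨e, e'⟩ = δ_{e,e'} x_e`. -/
def laplacian {n : ℕ} {o : Orientation G} {S : Type*} [CommRing S]
    (c : Module.Basis (Fin n) ℤ (H1 o)) (x : G.edgeSet → S) : Matrix (Fin n) (Fin n) S :=
  Matrix.of fun i j => ∑ e : G.edgeSet,
    ((c i : G.edgeSet → ℤ) e : S) * ((c j : G.edgeSet → ℤ) e : S) * x e

theorem laplacian_isSymm {n : ℕ} {o : Orientation G} {S : Type*} [CommRing S]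
    (c : Module.Basis (Fin n) ℤ (H1 o)) (x : G.edgeSet → S) : (laplacian c x).IsSymm := by
  ext i j
  simp only [laplacian, Matrix.transpose_apply, Matrix.of_apply]
  exact Finset.sum_congr rfl fun e _ => by ring

/-- The value at `x` of the graph polynomial `Ψ_G = det Λ_G`. It does not depend on the basis. -/
def graphPoly {n : ℕ} {o : Orientation G} {S : Type*} [CommRing S]
    (c : Module.Basis (Fin n) ℤ (H1 o)) (x : G.edgeSet → S) : S :=
  (laplacian c x).det

end Graph

end CanonicalForm

end

noncomputable section

namespace CanonicalForm

/-! ### Nilpotency of matrices with vanishing power traces -/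

section PowerTraces

variable {m R : Type*} [Fintype m] [DecidableEq m] [CommRing R]

open Polynomial in
/-- Jacobi's formula for the derivative of a determinant. -/
theorem derivative_det (N : Matrix m m R[X]) :
    derivative N.det = (N.adjugate * N.map derivative).trace := by
  have h (i : m) : ∑ σ : Equiv.Perm m, (Equiv.Perm.sign σ : ℤ) •
      ((∏ j ∈ Finset.univ.erase i, N (σ j) j) * derivative (N (σ i) i)) =
      (N.adjugate * N.map derivative) i i := by
    have h1 : (N.adjugate * N.map derivative) i i =
        (N.updateCol i fun k => derivative (N k i)).det := by
      rw [← Matrix.cramer_apply, Matrix.cramer_eq_adjugate_mulVec]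
      simp [Matrix.mul_apply, Matrix.mulVec, dotProduct]
    rw [h1, Matrix.det_apply]
    refine Finset.sum_congr rfl fun σ _ => ?_
    rw [← Finset.prod_erase_mul _ _ (Finset.mem_univ i)]
    congr 2
    · refine Finset.prod_congr rfl fun j hj => ?_
      rw [Matrix.updateCol_ne (Finset.ne_of_mem_erase hj)]
    · simp
  rw [Matrix.det_apply, Polynomial.derivative_sum, Matrix.trace]
  simp only [Matrix.diag_apply, ← h]
  rw [Finset.sum_comm]
  refine Finset.sum_congr rfl fun σ _ => ?_
  rw [← Finset.smul_sum, Units.smul_def, Polynomial.derivative_smul,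
    Polynomial.derivative_prod_finset]

open Polynomial in
/-- A matrix all of whose powers have trace zero is nilpotent. -/
theorem pow_card_eq_zero_of_trace_pow (hC : ∀ n : ℕ, n ≠ 0 → IsUnit (n : R)) (M : Matrix m m R)
    (hM : ∀ j : ℕ, j ≠ 0 → (M ^ j).trace = 0) : M ^ Fintype.card m = 0 := by
  nontriviality R
  set p := M.charpoly with hp
  set N := M.charmatrix.adjugate with hN
  set a : ℕ → R[X] := fun j => (N * (M ^ j).map C).trace with ha
  have hNc : N * M.charmatrix = p • (1 : Matrix m m R[X]) := Matrix.adjugate_mul _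
  have hmap (j : ℕ) : (M ^ j).map (Polynomial.C : R →+* R[X]) = (M.map Polynomial.C) ^ j :=
    map_pow (RingHom.mapMatrix (Polynomial.C : R →+* R[X])) M j
  -- This is `N (X - M) = p` multiplied by `M ^ j`, after taking traces.
  have hrec (j : ℕ) : X * a j = p * Polynomial.C (M ^ j).trace + a (j + 1) := by
    have h1 : (X : R[X]) • N = p • 1 + N * M.map Polynomial.C := by
      rw [← hNc, Matrix.charmatrix, Matrix.mul_sub, RingHom.mapMatrix_apply, sub_add_cancel]
      simp [← Matrix.smul_one_eq_diagonal]
    have h2 : ((X : R[X]) • N * (M ^ j).map Polynomial.C).trace = X * a j := by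
      rw [Matrix.smul_mul, Matrix.trace_smul, smul_eq_mul]
    rw [← h2, h1, Matrix.add_mul, Matrix.trace_add, Matrix.smul_mul, Matrix.trace_smul, one_mul,
      smul_eq_mul, Matrix.mul_assoc, hmap j, ← pow_succ', ← hmap, ← hmap]
    congr 2
    simp [Matrix.trace, map_sum]
  have ha1 (j : ℕ) : a (j + 1) = X ^ j * a 1 := by
    induction j with
    | zero => simp
    | succ j ih =>
      have := hrec (j + 1)
      rw [hM (j + 1) (by omega), map_zero, mul_zero, zero_add] at this
      rw [← this, ih, pow_succ']
      ring
  -- The Cayley-Hamilton relation times `M` gives `Σ p_i a_(i+1) = 0`, and `a_(i+1) = X ^ i a_1`.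
  have hpa : p * a 1 = 0 := by
    have h0 : ∑ i ∈ Finset.range (p.natDegree + 1), Polynomial.C (p.coeff i) * a (i + 1) = 0 := by
      have h1 : ∑ i ∈ Finset.range (p.natDegree + 1), p.coeff i • M ^ (i + 1) = 0 := by
        have := Matrix.aeval_self_charpoly M
        rw [Polynomial.aeval_eq_sum_range] at this
        simp only [pow_succ, ← Matrix.smul_mul, ← Finset.sum_mul]
        rw [← hp] at this
        rw [this, zero_mul]
      have h2 := congrArg (fun Z : Matrix m m R => (N * Z.map Polynomial.C).trace) h1
      simp only [Matrix.map_zero _ (Polynomial.C_0), Matrix.mul_zero, Matrix.trace_zero] at h2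
      rw [← h2]
      have h3 : (∑ i ∈ Finset.range (p.natDegree + 1), p.coeff i • M ^ (i + 1)).map
          (Polynomial.C : R →+* R[X]) = ∑ i ∈ Finset.range (p.natDegree + 1),
          Polynomial.C (p.coeff i) • (M ^ (i + 1)).map Polynomial.C := by
        ext1 i j
        simp [Matrix.sum_apply, map_sum]
      rw [h3, Matrix.mul_sum, Matrix.trace_sum]
      refine Finset.sum_congr rfl fun i _ => ?_
      rw [Matrix.mul_smul, Matrix.trace_smul, smul_eq_mul]
    rw [← h0]
    conv_lhs => rw [p.as_sum_range_C_mul_X_pow, Finset.sum_mul]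
    refine Finset.sum_congr rfl fun i _ => ?_
    rw [ha1 i, mul_assoc]
  have ha10 : a 1 = 0 := (M.charpoly_monic.mul_right_eq_zero_iff).1 hpa
  -- Here `a 0 = p'` by Jacobi's formula and `a 1 = 0` because `p` is monic. Comparing coefficients
  -- in `X p' = (card m) p` leaves only the leading one, as non-zero integers are units.
  have hder : X * derivative p = Polynomial.C (Fintype.card m : R) * p := by
    have h1 : derivative p = a 0 := by
      rw [hp, Matrix.charpoly, derivative_det, ha]
      congr 1
      simp only [pow_zero]
      congr 1
      ext1 i j
      by_cases h : i = j
      · subst h; simp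
      · simp [h]
    rw [h1, hrec 0, ha10, pow_zero, Matrix.trace_one, add_zero, mul_comm]
  have hdeg : p.natDegree = Fintype.card m := M.charpoly_natDegree_eq_dim
  have hcoeff (i : ℕ) (hi : i < Fintype.card m) : p.coeff i = 0 := by
    have h1 := congrArg (fun q : R[X] => q.coeff i) hder
    have h2 : (X * derivative p).coeff i = p.coeff i * i := by
      cases i with
      | zero => simp
      | succ i => rw [coeff_X_mul, coeff_derivative]; push_cast; ring
    simp only [h2, coeff_C_mul] at h1
    have h3 : ((Fintype.card m - i : ℕ) : R) * p.coeff i = 0 := by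
      rw [Nat.cast_sub hi.le, sub_mul, ← h1]; ring
    exact ((hC _ (by omega)).mul_right_eq_zero).1 h3
  have hpX : p = X ^ Fintype.card m := by
    ext i
    rw [coeff_X_pow]
    split_ifs with h
    · rw [h, ← hdeg]; exact M.charpoly_monic.coeff_natDegree
    · rcases lt_or_gt_of_ne h with h' | h'
      · exact hcoeff i h'
      · exact coeff_eq_zero_of_natDegree_lt (hdeg ▸ h')
  have := Matrix.aeval_self_charpoly M
  rwa [← hp, hpX, map_pow, aeval_X] at this

end PowerTraces

/-! ### Odd matrices -/

/-- A ring homomorphism `φ : S → Λ` with central image, together with a group `V` of odd elements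
of `Λ`: they square to zero, products of two of them are central, and `V` is stable under `S`. -/
structure OddSetting {S Λ : Type*} [CommRing S] [Ring Λ] (φ : S →+* Λ) (V : AddSubgroup Λ) :
    Prop where
  natUnit : ∀ n : ℕ, n ≠ 0 → IsUnit (n : S)
  central : ∀ s x, Commute (φ s) x
  smul_mem : ∀ s, ∀ v ∈ V, φ s * v ∈ V
  sq : ∀ v ∈ V, v * v = 0
  comm : ∀ v ∈ V, ∀ w ∈ V, ∀ x, Commute (v * w) x

namespace OddSetting

variable {S Λ : Type*} [CommRing S] [Ring Λ] {φ : S →+* Λ} {V : AddSubgroup Λ}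

theorem anticomm (h : OddSetting φ V) {v w : Λ} (hv : v ∈ V) (hw : w ∈ V) : v * w = -(w * v) := by
  have h1 := h.sq _ (V.add_mem hv hw)
  rw [add_mul, mul_add, mul_add, h.sq v hv, h.sq w hw, zero_add, add_zero] at h1
  exact eq_neg_of_add_eq_zero_left h1

theorem natUnit' (h : OddSetting φ V) {n : ℕ} (hn : n ≠ 0) : IsUnit (n : Λ) := by
  simpa using (h.natUnit n hn).map φ

theorem eq_zero_of_two (h : OddSetting φ V) {x : Λ} (hx : x = -x) : x = 0 := by
  have h2 : ((2 : ℕ) : Λ) * x = 0 := by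
    push_cast
    rw [two_mul]
    nth_rewrite 1 [hx]
    simp
  exact ((h.natUnit' two_ne_zero).mul_right_eq_zero).1 h2

variable {m : Type*} [Fintype m] [DecidableEq m]

/-- The square of an odd matrix has central entries. -/
theorem exists_center (h : OddSetting φ V) {X : Matrix m m Λ} (hX : ∀ i j, X i j ∈ V) :
    ∃ M : Matrix m m (Subring.center Λ), X ^ 2 = M.map (Subring.center Λ).subtype := by
  refine ⟨Matrix.of fun i j => ⟨(X ^ 2) i j, ?_⟩, by ext1 i j; rfl⟩
  rw [pow_two, Matrix.mul_apply]
  refine Subring.sum_mem _ fun k _ => ?_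
  rw [Subring.mem_center_iff]
  exact fun g => (h.comm _ (hX i k) _ (hX k j) g).eq.symm

/-- The trace form of the Amitsur-Levitzki theorem. -/
theorem pow_two_card_eq_zero (h : OddSetting φ V) {X : Matrix m m Λ} (hX : ∀ i j, X i j ∈ V) :
    X ^ (2 * Fintype.card m) = 0 := by
  obtain ⟨M, hM⟩ := h.exists_center hX
  have hpow (j : ℕ) : X ^ (2 * j) = (M ^ j).map (Subring.center Λ).subtype := by
    rw [pow_mul, hM]
    exact (map_pow (RingHom.mapMatrix (Subring.center Λ).subtype) M j).symm
  have hc (x : Subring.center Λ) (y : Λ) : (x : Λ) * y = y * x :=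
    (Subring.mem_center_iff.1 x.2 y).symm
  -- Moving one odd factor around the trace of an even power changes the sign, so the trace equals
  -- its own negative.
  have htr (j : ℕ) (hj : j ≠ 0) : (M ^ j).trace = 0 := by
    obtain ⟨j, rfl⟩ := Nat.exists_eq_succ_of_ne_zero hj
    apply Subtype.val_injective
    have h1 : (((M ^ (j + 1)).trace : Subring.center Λ) : Λ) = (X ^ (2 * (j + 1))).trace := by
      rw [hpow]; simp [Matrix.trace]
    rw [Nat.succ_eq_add_one, h1]
    have h2 : X ^ (2 * (j + 1)) = (M ^ j).map (Subring.center Λ).subtype * (X * X) := by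
      rw [mul_add, pow_add, hpow, mul_one, pow_two]
    have h3 : X ^ (2 * (j + 1)) = X * ((M ^ j).map (Subring.center Λ).subtype * X) := by
      rw [show 2 * (j + 1) = 1 + (2 * j + 1) by ring, pow_add, pow_add, hpow, pow_one]
    refine h.eq_zero_of_two ?_
    nth_rewrite 1 [h3]
    rw [h2]
    simp only [Matrix.trace, Matrix.diag_apply, Matrix.mul_apply, Finset.mul_sum]
    rw [← Finset.sum_neg_distrib]
    simp only [← Finset.sum_neg_distrib]
    refine Finset.sum_comm.trans (Finset.sum_congr rfl fun i _ => ?_)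
    refine Finset.sum_comm.trans (Finset.sum_congr rfl fun j _ => ?_)
    refine Finset.sum_congr rfl fun k _ => ?_
    simp only [Matrix.map_apply, Subring.subtype_apply]
    rw [← mul_assoc, ← hc, mul_assoc, h.anticomm (hX _ _) (hX _ _), mul_neg]
  have hC (n : ℕ) (hn : n ≠ 0) : IsUnit (n : Subring.center Λ) := by
    obtain ⟨u, hu⟩ := h.natUnit n hn
    refine IsUnit.of_mul_eq_one ⟨φ ↑u⁻¹, ?_⟩ ?_
    · rw [Subring.mem_center_iff]; exact fun g => (h.central _ g).eq.symm
    · apply Subtype.val_injective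
      have : (n : Λ) = φ u := by rw [hu]; simp
      simp only [Subring.coe_mul, Subring.coe_natCast, Subring.coe_one]
      rw [this, ← map_mul]; simp
  rw [hpow, pow_card_eq_zero_of_trace_pow hC M htr]
  ext1 i j; simp

theorem pow_eq_zero (h : OddSetting φ V) {X : Matrix m m Λ} (hX : ∀ i j, X i j ∈ V) {r : ℕ}
    (hr : 2 * Fintype.card m ≤ r) : X ^ r = 0 := by
  rw [← Nat.add_sub_cancel' hr, pow_add, h.pow_two_card_eq_zero hX, zero_mul]

end OddSetting

/-! ### Scalar matrices times an odd element -/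

section Tens

variable {S Λ : Type*} [CommRing S] [Ring Λ] {V : AddSubgroup Λ}

/-- The matrix `M`, with entries mapped to `Λ` and multiplied by `x`. -/
def tens (φ : S →+* Λ) {m n : Type*} (M : Matrix m n S) (x : Λ) : Matrix m n Λ :=
  M.map fun s => φ s * x

variable {φ : S →+* Λ} {l m n : Type*}

theorem tens_apply (M : Matrix m n S) (x : Λ) (i : m) (j : n) : tens φ M x i j = φ (M i j) * x :=
  rfl

theorem map_eq_tens (M : Matrix m n S) : M.map φ = tens φ M 1 := by
  ext1; simp [tens]

theorem tens_add (M N : Matrix m n S) (x : Λ) : tens φ (M + N) x = tens φ M x + tens φ N x := by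
  ext1; simp [tens, add_mul]

theorem tens_sub (M N : Matrix m n S) (x : Λ) : tens φ (M - N) x = tens φ M x - tens φ N x := by
  ext1; simp [tens, sub_mul]

theorem tens_neg (M : Matrix m n S) (x : Λ) : tens φ (-M) x = -tens φ M x := by
  ext1; simp [tens]

theorem tens_neg_right (M : Matrix m n S) (x : Λ) : tens φ M (-x) = -tens φ M x := by
  ext1; simp [tens]

theorem tens_zero_right (M : Matrix m n S) : tens φ M (0 : Λ) = 0 := by
  ext1; simp [tens]

theorem tens_zero_left (x : Λ) : tens φ (0 : Matrix m n S) x = 0 := by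
  ext1; simp [tens]

theorem tens_smul (s : S) (M : Matrix m n S) (x : Λ) : tens φ (s • M) x = tens φ M (φ s * x) := by
  ext1 i j; simp only [tens, Matrix.map_apply, Matrix.smul_apply, smul_eq_mul]
  rw [mul_comm, map_mul, mul_assoc]

theorem tens_mul [Fintype m] (h : OddSetting φ V) (M : Matrix l m S) (N : Matrix m n S)
    (x y : Λ) : tens φ M x * tens φ N y = tens φ (M * N) (x * y) := by
  ext1 i j
  simp only [tens, Matrix.mul_apply, Matrix.map_apply, map_sum, map_mul, Finset.sum_mul]
  refine Finset.sum_congr rfl fun k _ => ?_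
  rw [mul_assoc, ← mul_assoc x, ← (h.central _ x).eq, mul_assoc, mul_assoc]

theorem trace_tens_mul_comm [Fintype m] [Fintype n] (h : OddSetting φ V) (P : Matrix m n S)
    (Q : Matrix n m Λ) : (tens φ P 1 * Q).trace = (Q * tens φ P 1).trace := by
  simp only [Matrix.trace, Matrix.diag_apply, Matrix.mul_apply, tens_apply, mul_one]
  refine Finset.sum_comm.trans (Finset.sum_congr rfl fun i _ => Finset.sum_congr rfl fun j _ => ?_)
  exact (h.central _ _).eq

theorem pow_mul_swap {R : Type*} [Ring R] [Fintype m] [DecidableEq m]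
    (P Q : Matrix m m R) (r : ℕ) :
    (P * Q) ^ (r + 1) = P * (Q * P) ^ r * Q := by
  induction r with
  | zero => simp
  | succ r ih => rw [pow_succ, ih, pow_succ]; simp only [mul_assoc]

theorem trace_pow_swap [Fintype m] [DecidableEq m] (h : OddSetting φ V) (P : Matrix m m S)
    (Q : Matrix m m Λ) (r : ℕ) : ((tens φ P 1 * Q) ^ r).trace = ((Q * tens φ P 1) ^ r).trace := by
  cases r with
  | zero => simp
  | succ r =>
    rw [pow_mul_swap, mul_assoc, trace_tens_mul_comm h, pow_succ, mul_assoc]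

end Tens

/-! ### Powers of a bordered odd matrix -/

section Bordered

variable {Λ : Type*} [Ring Λ] {m : Type*} [Fintype m] [DecidableEq m]

/-- The hypotheses kill the words with three of the border blocks `p`, `q`, `t`, and also `t * t`. A
word that survives visits the border index at most once in a row of the core, which leaves these
four short expressions. In the application the border blocks are linear in two odd letters. -/
theorem fromBlocks_pow (a : Matrix m m Λ) (p : Matrix m Unit Λ) (q : Matrix Unit m Λ)
    (t : Matrix Unit Unit Λ) (htt : t * t = 0) (hptq : p * t * q = 0)
    (h1 : ∀ j, p * q * a ^ j * p = 0) (h2 : ∀ j, q * a ^ j * p * q = 0)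
    (h3 : ∀ j, q * a ^ j * p * t = 0) (h4 : ∀ j, t * q * a ^ j * p = 0) (r : ℕ) :
    Matrix.fromBlocks a p q t ^ (r + 2) =
      Matrix.fromBlocks
        (a ^ (r + 2) + ∑ i ∈ Finset.range (r + 1), a ^ (r - i) * (p * q) * a ^ i)
        (a ^ (r + 1) * p + a ^ r * p * t) (q * a ^ (r + 1) + t * q * a ^ r) (q * a ^ r * p) := by
  induction r with
  | zero =>
    rw [zero_add, pow_two, Matrix.fromBlocks_multiply]
    simp [htt, pow_two]
  | succ r ih =>
    rw [pow_succ, ih, Matrix.fromBlocks_multiply]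
    congr 1
    · rw [Finset.sum_range_succ' _ (r + 1), add_mul, Finset.sum_mul, Matrix.add_mul, Matrix.mul_assoc (a ^ r) p t,
        Matrix.mul_assoc (a ^ r) (p * t) q, hptq]
      simp only [Matrix.mul_zero, add_zero, Nat.sub_zero, pow_zero, mul_one, ← pow_succ]
      rw [add_assoc]
      congr 1
      rw [← Matrix.mul_assoc (a ^ (r + 1)) p q]
      congr 1
      refine Finset.sum_congr rfl fun i hi => ?_
      rw [mul_assoc _ (a ^ i) a, ← pow_succ]
      congr 3
      omega
    · have hz (i : ℕ) : a ^ (r - i) * (p * q) * a ^ i * p = 0 := by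
        rw [Matrix.mul_assoc, Matrix.mul_assoc, ← Matrix.mul_assoc (p * q), h1, Matrix.mul_zero]
      rw [Matrix.add_mul, Matrix.sum_mul]
      simp only [hz, Finset.sum_const_zero, add_zero]
      rw [Matrix.add_mul, Matrix.mul_assoc (a ^ r * p), htt, Matrix.mul_zero, add_zero]
    · rw [Matrix.add_mul, h2, add_zero, Matrix.mul_assoc, ← pow_succ, Matrix.mul_assoc, ← pow_succ]
    · rw [h3, add_zero, Matrix.add_mul, h4, add_zero]

end Bordered

/-! ### Traces of bordered matrices with two odd letters. -/

namespace OddSetting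

variable {S Λ : Type*} [CommRing S] [Ring Λ] {φ : S →+* Λ} {V : AddSubgroup Λ}

section TwoLetters

variable (h : OddSetting φ V) {o e : Λ} (ho : o ∈ V) (he : e ∈ V)
include h ho he

theorem pair_mul_left : o * e * o = 0 := by
  rw [h.anticomm ho he, neg_mul, mul_assoc, h.sq _ ho, mul_zero, neg_zero]

omit ho in
theorem pair_mul_right : o * e * e = 0 := by rw [mul_assoc, h.sq _ he, mul_zero]

variable {k l m n : Type*} [Fintype l] [Fintype m]

/-- The squares of `o` and `e` vanish, and `e * o = -(o * e)` produces the minus sign. -/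
theorem two_mul (P P' : Matrix k m S) (Q Q' : Matrix m n S) :
    (tens φ P o + tens φ P' e) * (tens φ Q o + tens φ Q' e) =
      tens φ (P * Q' - P' * Q) (o * e) := by
  rw [Matrix.add_mul, Matrix.mul_add, Matrix.mul_add, tens_mul h, tens_mul h, tens_mul h,
    tens_mul h, h.sq _ ho, h.sq _ he, tens_zero_right, tens_zero_right, h.anticomm he ho,
    tens_neg_right, tens_sub, zero_add, add_zero, sub_eq_add_neg]

theorem pair_mul_lin (s s' : S) : o * e * (φ s * o + φ s' * e) = 0 := by
  rw [mul_add, ← mul_assoc, ← mul_assoc, (h.comm _ ho _ he _).eq, (h.comm _ ho _ he _).eq,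
    mul_assoc _ _ o, mul_assoc _ _ e, h.pair_mul_left ho he, h.pair_mul_right he]
  simp

/-- Two of the linear factors combine to a multiple of the central element `o * e`, which can be
moved past `M` and annihilates the third. -/
theorem three_mul_left (P P' : Matrix k l S) (Q Q' : Matrix l m S) (M : Matrix m n Λ)
    {n' : Type*} [Fintype n] (R R' : Matrix n n' S) :
    (tens φ P o + tens φ P' e) * (tens φ Q o + tens φ Q' e) * M *
      (tens φ R o + tens φ R' e) = 0 := by
  rw [h.two_mul ho he]
  ext1 i j
  rw [Matrix.mul_assoc, Matrix.mul_apply]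
  refine Finset.sum_eq_zero fun x _ => ?_
  rw [tens_apply, mul_assoc, Matrix.mul_apply, Finset.mul_sum]
  rw [Finset.sum_eq_zero, mul_zero]
  intro y _
  have hc := h.comm _ ho _ he (M x y)
  rw [← mul_assoc, hc.eq, mul_assoc, Matrix.add_apply, tens_apply, tens_apply,
    h.pair_mul_lin ho he, mul_zero]

theorem three_mul_right (P P' : Matrix k l S) (M : Matrix l m Λ)
    {n' : Type*} [Fintype n] (Q Q' : Matrix m n S) (R R' : Matrix n n' S) :
    (tens φ P o + tens φ P' e) * M * (tens φ Q o + tens φ Q' e) *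
      (tens φ R o + tens φ R' e) = 0 := by
  rw [Matrix.mul_assoc, h.two_mul ho he]
  ext1 i j
  rw [Matrix.mul_assoc, Matrix.mul_apply]
  refine Finset.sum_eq_zero fun x _ => ?_
  rw [Matrix.mul_apply, Finset.mul_sum]
  refine Finset.sum_eq_zero fun y _ => ?_
  have hx : (tens φ P o + tens φ P' e) i x * (o * e) = 0 := by
    rw [← (h.comm _ ho _ he _).eq, Matrix.add_apply, tens_apply, tens_apply,
      h.pair_mul_lin ho he]
  rw [tens_apply, ← mul_assoc (M x y), ← (h.central _ (M x y)).eq,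
    mul_assoc (φ _), ← (h.comm _ ho _ he _).eq, ← mul_assoc (φ _), (h.central _ (o * e)).eq,
    mul_assoc, ← mul_assoc, hx, zero_mul]

end TwoLetters

variable {m : Type*} [Fintype m] [DecidableEq m]

/-- The square of an odd matrix has entries in the center. This and the next lemma make up for the
missing cyclicity of the trace over a non-commutative ring. -/
theorem even_pow_central (h : OddSetting φ V) {a : Matrix m m Λ} (ha : ∀ i j, a i j ∈ V)
    {r : ℕ} (hr : Even r) (i j : m) (x : Λ) : Commute ((a ^ r) i j) x := by
  obtain ⟨M, hM⟩ := h.exists_center ha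
  obtain ⟨s, rfl⟩ := hr
  rw [← _root_.two_mul, pow_mul, hM]
  have : (M.map (Subring.center Λ).subtype) ^ s = (M ^ s).map (Subring.center Λ).subtype :=
    (map_pow (RingHom.mapMatrix (Subring.center Λ).subtype) M s).symm
  rw [this]
  exact (Subring.mem_center_iff.1 ((M ^ s) i j).2 x).symm

theorem odd_pow_eq (h : OddSetting φ V) {a : Matrix m m Λ} (ha : ∀ i j, a i j ∈ V)
    {r : ℕ} (hr : Odd r) (i j : m) {v : Λ} (hv : v ∈ V) (x : Λ) :
    Commute ((a ^ r) i j * v) x := by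
  obtain ⟨s, rfl⟩ := hr
  rw [pow_succ, Matrix.mul_apply, Finset.sum_mul]
  refine Commute.sum_left _ _ _ fun k _ => ?_
  rw [mul_assoc]
  exact (h.even_pow_central ha (even_two_mul s) i k x).mul_left (h.comm _ (ha _ _) _ hv x)

omit [DecidableEq m] in
theorem trace_mul_comm_of_central {n : Type*} [Fintype n] (P : Matrix m n Λ) (Q : Matrix n m Λ)
    (hP : ∀ i j x, Commute (P i j) x) : (P * Q).trace = (Q * P).trace := by
  simp only [Matrix.trace, Matrix.diag_apply, Matrix.mul_apply]
  refine Finset.sum_comm.trans (Finset.sum_congr rfl fun i _ => Finset.sum_congr rfl fun j _ => ?_)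
  exact (hP _ _ _).eq

omit [DecidableEq m] in
theorem trace_fromBlocks_add (A : Matrix m m Λ) (B : Matrix m Unit Λ) (C : Matrix Unit m Λ)
    (D : Matrix Unit Unit Λ) : (Matrix.fromBlocks A B C D).trace = A.trace + D.trace := by
  simp [Matrix.trace]

/-- The trace of an odd power of a bordered matrix with two odd letters on the border. -/
theorem trace_fromBlocks_pow (h : OddSetting φ V) {o e : Λ} (ho : o ∈ V) (he : e ∈ V)
    {a : Matrix m m Λ} (ha : ∀ i j, a i j ∈ V) (P P' : Matrix m Unit S) (Q Q' : Matrix Unit m S)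
    (T : Matrix Unit Unit S) {r : ℕ} (hr : Odd r) :
    (Matrix.fromBlocks a (tens φ P o + tens φ P' e) (tens φ Q o + tens φ Q' e)
        (tens φ T e) ^ (r + 2)).trace =
      (a ^ (r + 2)).trace + ((r + 2 : ℕ) : Λ) * (tens φ (P * Q' - P' * Q) (o * e) * a ^ r).trace := by
  have hT : tens φ T e = tens φ (0 : Matrix Unit Unit S) o + tens φ T e := by
    rw [tens_zero_left, zero_add]
  set p := tens φ P o + tens φ P' e with hp
  set q := tens φ Q o + tens φ Q' e with hq
  have hpq : p * q = tens φ (P * Q' - P' * Q) (o * e) := h.two_mul ho he P P' Q Q'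
  rw [fromBlocks_pow]
  rotate_left
  · rw [tens_mul h, h.sq _ he, tens_zero_right]
  · have := h.three_mul_right ho he P P' (1 : Matrix Unit Unit Λ) 0 T Q Q'
    rwa [Matrix.mul_one, ← hT] at this
  · exact fun j => h.three_mul_left ho he P P' Q Q' (a ^ j) P P'
  · exact fun j => h.three_mul_right ho he Q Q' (a ^ j) P P' Q Q'
  · intro j
    rw [hT]
    exact h.three_mul_right ho he Q Q' (a ^ j) P P' 0 T
  · intro j
    rw [hT]
    exact h.three_mul_left ho he 0 T Q Q' (a ^ j) P P'
  rw [trace_fromBlocks_add, Matrix.trace_add, Matrix.trace_sum, add_assoc]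
  congr 1
  have hZ (i j : m) (x : Λ) : Commute ((p * q) i j) x := by
    rw [hpq, tens_apply]
    exact (h.central _ x).mul_left (h.comm _ ho _ he x)
  -- As `r` is odd, one of `i` and `r - i` is even, and an even power can be moved around
  -- cyclically.
  have h1 (i : ℕ) (hi : i ∈ Finset.range (r + 1)) :
      (a ^ (r - i) * (p * q) * a ^ i).trace = (p * q * a ^ r).trace := by
    have hi' : i ≤ r := by simpa [Nat.lt_succ_iff] using hi
    rcases Nat.even_or_odd i with hev | hodd
    · rw [← trace_mul_comm_of_central (a ^ i) _ (h.even_pow_central ha hev), ← mul_assoc,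
        ← pow_add, Nat.add_sub_cancel' hi', ← trace_mul_comm_of_central (p * q) _ hZ]
    · have hev : Even (r - i) := Nat.Odd.sub_odd hr hodd
      rw [mul_assoc, trace_mul_comm_of_central (a ^ (r - i)) _ (h.even_pow_central ha hev),
        mul_assoc, ← pow_add, Nat.add_sub_cancel' hi']
  rw [Finset.sum_congr rfl h1, Finset.sum_const, Finset.card_range, hpq]
  -- The entries of `a ^ r * p` are central, being sums of products of an odd number of entries of
  -- `a` with one more odd element. The corner thus adds one more equal term to the `r + 1` terms of
  -- the upper left block.
  have h2 : (q * a ^ r * p).trace = (p * q * a ^ r).trace := by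
    have hc (i : Unit) (j : m) (x : Λ) : Commute ((a ^ r * p) j i) x := by
      rw [Matrix.mul_apply]
      refine Commute.sum_left _ _ _ fun k _ => h.odd_pow_eq ha hr _ _ ?_ _
      rw [hp, Matrix.add_apply]
      exact V.add_mem (h.smul_mem _ _ ho) (h.smul_mem _ _ he)
    rw [Matrix.mul_assoc, ← trace_mul_comm_of_central (a ^ r * p) q fun i j => hc j i,
      Matrix.mul_assoc, ← trace_mul_comm_of_central (p * q) _ hZ]
  rw [h2, hpq]
  rw [nsmul_eq_mul]
  push_cast
  rw [← add_one_mul]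
  congr 1
  rw [add_assoc, one_add_one_eq_two]

/-- Next to the factor `o * e`, any further `o` or `e` gives zero, so the parts of `a` that contain
these letters can be dropped. -/
theorem tens_pair_mul_pow (h : OddSetting φ V) {o e : Λ} (ho : o ∈ V) (he : e ∈ V)
    {n a : Matrix m m Λ} (Y Y' : Matrix m m S) (ha : a = n + (tens φ Y o + tens φ Y' e))
    (Z : Matrix m m S) (r : ℕ) : tens φ Z (o * e) * a ^ r = tens φ Z (o * e) * n ^ r := by
  have key (M : Matrix m m Λ) : tens φ Z (o * e) * (M * a) = tens φ Z (o * e) * (M * n) := by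
    ext1 i j
    simp only [Matrix.mul_apply, tens_apply, Finset.mul_sum]
    refine Finset.sum_congr rfl fun x _ => Finset.sum_congr rfl fun y _ => ?_
    rw [mul_assoc (φ _), mul_assoc (φ _), ← mul_assoc (o * e), ← mul_assoc (o * e),
      (h.comm _ ho _ he _).eq, mul_assoc (M x y), mul_assoc (M x y), ha, Matrix.add_apply, mul_add, Matrix.add_apply,
      tens_apply, tens_apply, h.pair_mul_lin ho he, add_zero]
  have key' (s t : ℕ) : tens φ Z (o * e) * (n ^ s * a ^ t) = tens φ Z (o * e) * n ^ (s + t) := by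
    induction t generalizing s with
    | zero => simp
    | succ t ih =>
      rw [pow_succ', ← mul_assoc (n ^ s), ← mul_assoc (tens φ Z _) (n ^ s * a), key, mul_assoc,
        ← pow_succ, ih, add_right_comm, add_assoc]
  simpa using key' 0 r

/-- The inverse of a bordered matrix. -/
theorem inv_fromBlocks_smul_one (A' : Matrix m m S) (b : Matrix m Unit S) (c : Matrix Unit m S)
    (d d' : S) (hd : d * d' = 1) (hA : IsUnit (A' - d' • (b * c)).det) :
    (Matrix.fromBlocks A' b c (d • 1))⁻¹ =
      Matrix.fromBlocks 1 0 (-(d' • c)) (1 : Matrix Unit Unit S) *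
        (Matrix.fromBlocks (A' - d' • (b * c))⁻¹ 0 0 (d' • 1) *
          Matrix.fromBlocks 1 (-(d' • b)) 0 1) := by
  apply Matrix.inv_eq_right_inv
  have h1 : Matrix.fromBlocks A' b c (d • 1) *
      Matrix.fromBlocks 1 0 (-(d' • c)) (1 : Matrix Unit Unit S) =
      Matrix.fromBlocks (A' - d' • (b * c)) b 0 (d • 1) := by
    rw [Matrix.fromBlocks_multiply]
    congr 1
    · simp [sub_eq_add_neg]
    · simp
    · simp [smul_smul, mul_comm d' d, hd]
    · simp
  have h2 : Matrix.fromBlocks (A' - d' • (b * c)) b 0 (d • 1) *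
      Matrix.fromBlocks (A' - d' • (b * c))⁻¹ 0 0 (d' • 1) =
      Matrix.fromBlocks 1 (d' • b) 0 (1 : Matrix Unit Unit S) := by
    rw [Matrix.fromBlocks_multiply]
    congr 1
    · simp [Matrix.mul_nonsing_inv _ hA]
    · simp
    · simp
    · simp [smul_smul, mul_comm d' d, hd]
  rw [← mul_assoc, ← mul_assoc, h1, h2, Matrix.fromBlocks_multiply, ← Matrix.fromBlocks_one]
  congr 1 <;> simp

/-- The odd trace form of a matrix of one-forms with two letters in its last row and column. -/
theorem trace_bordered (h : OddSetting φ V) {o e : Λ} (ho : o ∈ V) (he : e ∈ V)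
    (A' : Matrix m m S) (b : Matrix m Unit S) (c : Matrix Unit m S) (d d' : S) (hd : d * d' = 1)
    (hA : IsUnit (A' - d' • (b * c)).det) (N : Matrix m m Λ) (hN : ∀ i j, N i j ∈ V)
    (u : Matrix m Unit S) (w : Matrix Unit m S) (hm : 0 < Fintype.card m) :
    ((tens φ (Matrix.fromBlocks A' b c (d • 1))⁻¹ 1 *
        Matrix.fromBlocks N (tens φ u o) (tens φ w o) (tens φ 1 e)) ^
        (2 * Fintype.card m + 1)).trace =
      -((2 * Fintype.card m + 1 : ℕ) : Λ) * (o * e * φ (d' * d')) *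
        (tens φ ((A' - d' • (b * c))⁻¹ * (u * c - b * w)) 1 *
          (tens φ (A' - d' • (b * c))⁻¹ 1 * N) ^ (2 * Fintype.card m - 1)).trace := by
  rw [inv_fromBlocks_smul_one A' b c d d' hd hA]
  set B := (A' - d' • (b * c))⁻¹ with hB
  have hφ (M K : Matrix (m ⊕ Unit) (m ⊕ Unit) S) : tens φ (M * K) 1 = tens φ M 1 * tens φ K 1 := by
    rw [tens_mul h, mul_one]
  have hfb (M₁ : Matrix m m S) (M₂ : Matrix m Unit S) (M₃ : Matrix Unit m S)
      (M₄ : Matrix Unit Unit S) : tens φ (Matrix.fromBlocks M₁ M₂ M₃ M₄) (1 : Λ) =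
      Matrix.fromBlocks (tens φ M₁ 1) (tens φ M₂ 1) (tens φ M₃ 1) (tens φ M₄ 1) := by
    rw [← map_eq_tens, Matrix.fromBlocks_map]; simp only [map_eq_tens]
  have h1m : tens φ (1 : Matrix m m S) (1 : Λ) = 1 := by
    rw [← map_eq_tens]; exact Matrix.map_one _ (map_zero φ) (map_one φ)
  have h1u : tens φ (1 : Matrix Unit Unit S) (1 : Λ) = 1 := by
    rw [← map_eq_tens]; exact Matrix.map_one _ (map_zero φ) (map_one φ)
  -- The lower triangular factor of the inverse is moved cyclically to the right end. This makes
  -- every border block linear in `o` and `e`, with only `e` in the corner.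
  have hY : tens φ (Matrix.fromBlocks B 0 0 (d' • 1) * Matrix.fromBlocks 1 (-(d' • b)) 0 1) 1 *
      Matrix.fromBlocks N (tens φ u o) (tens φ w o) (tens φ 1 e) *
      tens φ (Matrix.fromBlocks 1 0 (-(d' • c)) (1 : Matrix Unit Unit S)) 1 =
      Matrix.fromBlocks
        (tens φ B 1 * N + (tens φ (-(d' • (B * (b * w) + B * (u * c)))) o +
          tens φ ((d' * d') • (B * (b * c))) e))
        (tens φ (B * u) o + tens φ (-(d' • (B * b))) e)
        (tens φ (d' • w) o + tens φ (-((d' * d') • c)) e) (tens φ (d' • 1) e) := by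
    rw [hφ]
    simp only [hfb, Matrix.fromBlocks_multiply, tens_zero_left, Matrix.zero_mul, Matrix.mul_zero,
      add_zero, zero_add, h1m, h1u, Matrix.one_mul, Matrix.mul_one, tens_mul h, one_mul, mul_one,
      Matrix.mul_add, Matrix.add_mul, ← Matrix.mul_assoc, Matrix.mul_neg, Matrix.neg_mul,
      Matrix.smul_mul, Matrix.mul_smul, smul_neg, neg_neg, smul_smul, tens_add, tens_neg, smul_add,
      neg_add]
    congr 1
    · abel
    · simp
    · simp
  have hnV (i j : m) : (tens φ B 1 * N) i j ∈ V := by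
    rw [Matrix.mul_apply]
    refine V.sum_mem fun k _ => ?_
    rw [tens_apply, mul_one]
    exact h.smul_mem _ _ (hN _ _)
  obtain ⟨r, hr⟩ : ∃ r, Fintype.card m = r + 1 := ⟨_, (Nat.succ_pred_eq_of_pos hm).symm⟩
  have hr1 : 2 * Fintype.card m + 1 = 2 * r + 1 + 2 := by omega
  have hr2 : 2 * Fintype.card m - 1 = 2 * r + 1 := by omega
  set a := tens φ B 1 * N + (tens φ (-(d' • (B * (b * w) + B * (u * c)))) o +
          tens φ ((d' * d') • (B * (b * c))) e) with ha
  have haV (i j : m) : a i j ∈ V := by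
    rw [ha, Matrix.add_apply, Matrix.add_apply, tens_apply, tens_apply]
    exact V.add_mem (hnV i j) (V.add_mem (h.smul_mem _ _ ho) (h.smul_mem _ _ he))
  -- The pure power of the upper left block has exponent above twice its size and vanishes by
  -- Amitsur-Levitzki. In the remaining term, which carries `o * e`, that block may be replaced by
  -- its part `B N`.
  rw [hφ, mul_assoc (tens φ _ 1), trace_pow_swap h, hY, hr1, hr2,
    h.trace_fromBlocks_pow ho he haV _ _ _ _ _ ⟨r, rfl⟩, h.pow_eq_zero haV (by omega),
    Matrix.trace_zero, zero_add, h.tens_pair_mul_pow ho he _ _ ha]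
  have hZ : B * u * -((d' * d') • c) - -(d' • (B * b)) * (d' • w) =
      (d' * d') • -(B * (u * c - b * w)) := by
    simp only [Matrix.mul_neg, Matrix.neg_mul, Matrix.mul_smul, Matrix.smul_mul, smul_smul,
      Matrix.mul_sub, Matrix.mul_assoc, smul_neg, smul_sub]
    abel
  have hcen : ∀ x, Commute (φ (d' * d') * (o * e)) x := fun x =>
    (h.central _ x).mul_left (h.comm _ ho _ he x)
  have htr (M : Matrix m m S) (K : Matrix m m Λ) :
      (tens φ M (φ (d' * d') * (o * e)) * K).trace =
        φ (d' * d') * (o * e) * (tens φ M 1 * K).trace := by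
    simp only [Matrix.trace, Matrix.diag_apply, Matrix.mul_apply, tens_apply, Finset.mul_sum]
    refine Finset.sum_congr rfl fun i _ => Finset.sum_congr rfl fun j _ => ?_
    rw [← (hcen _).eq, mul_one, mul_assoc]
  rw [hZ, tens_smul, htr, tens_neg, Matrix.neg_mul, Matrix.trace_neg,
    (h.central (d' * d') (o * e)).eq]
  simp only [mul_neg, neg_mul, mul_assoc]

end OddSetting

/-! ### Dual numbers and first-order perturbations of matrices. -/

open TrivSqZeroExt in
/-- The map of dual numbers induced by a ring homomorphism. -/
def dualMap {R T : Type*} [Ring R] [Ring T] (f : R →+* T) : DualNumber R →+* DualNumber T where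
  toFun x := inl (f x.fst) + inr (f x.snd)
  map_one' := by ext <;> simp
  map_mul' x y := by ext <;> simp
  map_zero' := by ext <;> simp
  map_add' x y := by ext <;> simp

@[simp] theorem fst_dualMap {R T : Type*} [Ring R] [Ring T] (f : R →+* T) (x : DualNumber R) :
    (dualMap f x).fst = f x.fst := by simp [dualMap]

@[simp] theorem snd_dualMap {R T : Type*} [Ring R] [Ring T] (f : R →+* T) (x : DualNumber R) :
    (dualMap f x).snd = f x.snd := by simp [dualMap]

/-- The first component of a dual number. -/
def dualFst (R : Type*) [Ring R] : DualNumber R →+* R where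
  toFun x := x.fst
  map_one' := by simp
  map_mul' x y := by simp
  map_zero' := by simp
  map_add' x y := by simp

@[simp] theorem dualFst_apply {R : Type*} [Ring R] (x : DualNumber R) : dualFst R x = x.fst := rfl

open TrivSqZeroExt in
/-- The exchange of the two infinitesimals. -/
def dualSwap (R : Type*) [CommRing R] : DualNumber (DualNumber R) →+* DualNumber (DualNumber R) where
  toFun x := inl (inl x.fst.fst + inr x.snd.fst) + inr (inl x.fst.snd + inr x.snd.snd)
  map_one' := by ext <;> simp
  map_mul' x y := by ext <;> simp; ring
  map_zero' := by ext <;> simp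
  map_add' x y := by ext <;> simp

open TrivSqZeroExt in
/-- Evaluation of a dual number at an element of square zero. -/
def dualEval {R T : Type*} [CommRing R] [CommRing T] (f : R →+* T) (t : T) (ht : t * t = 0) :
    DualNumber R →+* T where
  toFun x := f x.fst + f x.snd * t
  map_one' := by simp
  map_mul' x y := by
    simp only [fst_mul, DualNumber.snd_mul, map_mul, map_add]
    linear_combination (-f x.snd * f y.snd) * ht
  map_zero' := by simp
  map_add' x y := by simp; ring

section Pert

variable {m n : Type*} {S : Type*} [CommRing S]

/-- The matrix `A + ε H` over the dual numbers. -/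
def pert (A H : Matrix m n S) : Matrix m n (DualNumber S) :=
  Matrix.of fun i j => TrivSqZeroExt.inl (A i j) + TrivSqZeroExt.inr (H i j)

@[simp] theorem fst_pert (A H : Matrix m n S) (i j) : (pert A H i j).fst = A i j := by
  simp [pert]

@[simp] theorem snd_pert (A H : Matrix m n S) (i j) : (pert A H i j).snd = H i j := by
  simp [pert]

variable [Fintype n] [DecidableEq n]

theorem map_dualFst_pert (A H : Matrix m n S) : (pert A H).map (dualFst S) = A := by
  ext1; simp

theorem isUnit_det_pert {A H : Matrix n n S} (hA : IsUnit A.det) : IsUnit (pert A H).det := by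
  rw [TrivSqZeroExt.isUnit_iff_isUnit_fst]
  have : (pert A H).det.fst = A.det := by
    have h := (dualFst S).map_det (pert A H)
    rw [RingHom.mapMatrix_apply, map_dualFst_pert] at h
    exact h
  rwa [this]

theorem map_pert {T : Type*} [CommRing T] (f : S →+* T) (A H : Matrix m n S) :
    (pert A H).map (dualMap f) = pert (A.map f) (H.map f) := by
  ext <;> simp

end Pert

/-! ### Coefficients of the inverse determinant in variables of square zero. -/

section EdgeCoeff

variable {ι : Type*} [Fintype ι] [DecidableEq ι]

/-- The skew-symmetric elementary matrix `E_pq - E_qp`. -/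
def skew (S : Type*) [CommRing S] (p q : ι) : Matrix ι ι S :=
  Matrix.single p q 1 - Matrix.single q p 1

theorem map_skew {S T : Type*} [CommRing S] [CommRing T] (f : S →+* T) (p q : ι) :
    (skew S p q).map f = skew T p q := by
  ext i j
  simp only [skew, Matrix.map_apply, Matrix.sub_apply, Matrix.single_apply, map_sub]
  congr 1 <;> split_ifs <;> simp

/-- The coefficient of `t₁ ⋯ t_m` in `1 / det (A + t₁ T₁ + ⋯ + t_m T_m)`, where `T_k` is the
skew-symmetric elementary matrix of the `k`-th pair in a list. -/
def edgeCoeff : List (ι × ι) → ∀ {S : Type u} [CommRing S], Matrix ι ι S → S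
  | [], _, _, A => Ring.inverse A.det
  | p :: l, S, _, A => (edgeCoeff l (pert A (skew S p.1 p.2))).snd

theorem ringInverse_map {S : Type*} {T : Type*} [CommRing S] [CommRing T] (f : S →+* T) {s : S}
    (hs : IsUnit s) : Ring.inverse (f s) = f (Ring.inverse s) := by
  obtain ⟨u, rfl⟩ := hs
  rw [Ring.inverse_unit, show f u = (Units.map f.toMonoidHom u : Tˣ) from rfl, Ring.inverse_unit]
  rfl

/-- Naturality in the ring serves three ends: evaluation at an element of square zero, exchange of
two infinitesimals, and the passage from matrices near the identity to all invertible ones. -/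
theorem edgeCoeff_map (l : List (ι × ι)) {S : Type u} {T : Type v} [CommRing S] [CommRing T]
    (f : S →+* T) {A : Matrix ι ι S} (hA : IsUnit A.det) :
    edgeCoeff l (A.map f) = f (edgeCoeff l A) := by
  induction l generalizing S T with
  | nil =>
    rw [edgeCoeff, edgeCoeff, ← ringInverse_map f hA, f.map_det]
    rfl
  | cons p l ih =>
    rw [edgeCoeff, edgeCoeff, ← map_skew f, ← map_pert, ih _ (isUnit_det_pert hA), snd_dualMap]

theorem fst_edgeCoeff_pert (l : List (ι × ι)) {S : Type u} [CommRing S] {A : Matrix ι ι S}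
    (hA : IsUnit A.det) (H : Matrix ι ι S) : (edgeCoeff l (pert A H)).fst = edgeCoeff l A := by
  have := edgeCoeff_map l (dualFst S) (isUnit_det_pert (H := H) hA)
  rw [map_dualFst_pert] at this
  exact this.symm

/-- A transposition of neighbours is the automorphism of the iterated dual numbers that exchanges
the two infinitesimals; naturality does the rest. -/
theorem edgeCoeff_perm {l l' : List (ι × ι)} (h : l.Perm l') {S : Type u} [CommRing S]
    {A : Matrix ι ι S} (hA : IsUnit A.det) : edgeCoeff l A = edgeCoeff l' A := by
  induction h generalizing S with
  | nil => rfl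
  | cons x _ ih => rw [edgeCoeff, edgeCoeff, ih (isUnit_det_pert hA)]
  | swap x y l =>
    simp only [edgeCoeff]
    have h1 : pert (pert A (skew S x.1 x.2)) (skew (DualNumber S) y.1 y.2) =
        (pert (pert A (skew S y.1 y.2)) (skew (DualNumber S) x.1 x.2)).map (dualSwap S) := by
      have h0 (p : ι × ι) : skew (DualNumber S) p.1 p.2 =
          (skew S p.1 p.2).map (TrivSqZeroExt.inlHom S S) := (map_skew _ _ _).symm
      ext i j <;> simp [dualSwap, h0]
    rw [h1, edgeCoeff_map (T := DualNumber (DualNumber S)) l (dualSwap S) (isUnit_det_pert (isUnit_det_pert hA))]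
    simp [dualSwap]
  | trans _ _ ih1 ih2 => exact (ih1 hA).trans (ih2 hA)

/-- The expansion of `1 / det (A + t₁ T₁ + ⋯ + t_m T_m)` in variables of square zero. -/
theorem inverse_det_add_eq_sum {S : Type u} {T : Type v} [CommRing S] [CommRing T] (f : S →+* T)
    {A : Matrix ι ι S} (hA : IsUnit A.det) (l : List ((ι × ι) × T)) (hl : ∀ x ∈ l, x.2 * x.2 = 0) :
    Ring.inverse (A.map f + (l.map fun x => x.2 • skew T x.1.1 x.1.2).sum).det =
      ((l.sublists').map fun s =>
        f (edgeCoeff (s.map Prod.fst) A) * (s.map Prod.snd).prod).sum := by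
  induction l generalizing S with
  | nil =>
    simp only [List.map_nil, List.sum_nil, add_zero, List.sublists'_nil, List.map_cons,
      List.prod_nil, mul_one, edgeCoeff, List.sum_singleton]
    rw [← ringInverse_map f hA, f.map_det]
    rfl
  | cons x l ih =>
    have hx := hl x (by simp)
    -- The leading summand is absorbed into a perturbation over the dual numbers, evaluated at `ε ↦
    -- x.2`.
    have h1 : A.map f + ((x :: l).map fun x => x.2 • skew T x.1.1 x.1.2).sum =
        (pert A (skew S x.1.1 x.1.2)).map (dualEval f x.2 hx) +
          (l.map fun x => x.2 • skew T x.1.1 x.1.2).sum := by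
      rw [List.map_cons, List.sum_cons, ← add_assoc]
      congr 1
      rw [← map_skew f]
      ext i j
      simp [dualEval, mul_comm]
    rw [h1, ih _ (isUnit_det_pert hA) fun y hy => hl y (by simp [hy]), List.sublists'_cons,
      List.map_append, List.sum_append, List.map_map, ← List.sum_map_add]
    congr 1
    refine List.map_congr_left fun s _ => ?_
    simp only [dualEval, RingHom.coe_mk, MonoidHom.coe_mk, OneHom.coe_mk, Function.comp_apply,
      List.map_cons, List.prod_cons, edgeCoeff, fst_edgeCoeff_pert _ hA]
    ring

end EdgeCoeff

/-! ### Schur complements and perturbations. -/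

section Schur

variable {m : Type*} [Fintype m] [DecidableEq m]

theorem det_fromBlocks_smul_one {S : Type*} [CommRing S] (A' : Matrix m m S) (b : Matrix m Unit S)
    (c : Matrix Unit m S) (d d' : S) (hd : d * d' = 1) :
    (Matrix.fromBlocks A' b c (d • 1)).det = d * (A' - d' • (b * c)).det := by
  let _ : Invertible (d • (1 : Matrix Unit Unit S)) :=
    ⟨d' • 1, by simp [smul_smul, hd], by simp [smul_smul, mul_comm d' d, hd]⟩
  rw [Matrix.det_fromBlocks₂₂]
  have : ⅟(d • (1 : Matrix Unit Unit S)) = d' • 1 := rfl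
  rw [this]
  simp

/-- Pairs of indices of a block, as pairs of indices of the bordered matrix. -/
def inlPair (p : m × m) : (m ⊕ Unit) × (m ⊕ Unit) := (Sum.inl p.1, Sum.inl p.2)

theorem skew_inl (S : Type*) [CommRing S] (p q : m) :
    skew S (Sum.inl p : m ⊕ Unit) (Sum.inl q) = Matrix.fromBlocks (skew S p q) 0 0 0 := by
  ext i j
  rcases i with i | i <;> rcases j with j | j <;> simp [skew, Matrix.single_apply]

theorem pert_fromBlocks {S : Type*} [CommRing S] (A' H' : Matrix m m S) (b β : Matrix m Unit S)
    (c γ : Matrix Unit m S) (d : S) :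
    pert (Matrix.fromBlocks A' b c (d • 1)) (Matrix.fromBlocks H' β γ 0) =
      Matrix.fromBlocks (pert A' H') (pert b β) (pert c γ)
        ((TrivSqZeroExt.inl d : DualNumber S) • 1) := by
  ext i j <;> rcases i with i | i <;> rcases j with j | j <;> simp

/-- The product rule for `b * c`, with the pivot kept fixed. A skew perturbation between the border
and the block thereby becomes a perturbation of the Schur complement alone. -/
theorem pert_schur {S : Type*} [CommRing S] (A' H' : Matrix m m S) (b β : Matrix m Unit S)
    (c γ : Matrix Unit m S) (d' : S) :
    pert A' H' - (TrivSqZeroExt.inl d' : DualNumber S) • (pert b β * pert c γ) =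
      pert (A' - d' • (b * c)) (H' - d' • (b * γ + β * c)) := by
  ext i j <;> simp [Matrix.mul_apply]
  ring

/-- Edges inside the block perturb neither border nor pivot, so the determinant remains the pivot
times a Schur complement perturbed by the same skew matrices. -/
theorem edgeCoeff_fromBlocks (l : List (m × m)) {S : Type u} [CommRing S] (A' : Matrix m m S)
    (b : Matrix m Unit S) (c : Matrix Unit m S) (d d' : S) (hd : d * d' = 1)
    (hA : IsUnit (A' - d' • (b * c)).det) :
    edgeCoeff (l.map inlPair) (Matrix.fromBlocks A' b c (d • 1)) =
      d' * edgeCoeff l (A' - d' • (b * c)) := by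
  induction l generalizing S with
  | nil =>
    simp only [List.map_nil, edgeCoeff]
    rw [det_fromBlocks_smul_one _ _ _ _ _ hd]
    obtain ⟨u, hu⟩ := hA
    have : d * (A' - d' • (b * c)).det = (((⟨d, d', hd, by rw [mul_comm, hd]⟩ : Sˣ) * u : Sˣ) : S) := by
      simp [hu]
    rw [this, ← hu, Ring.inverse_unit, Ring.inverse_unit, mul_inv, Units.val_mul]
    rfl
  | cons p l ih =>
    have hd' : (TrivSqZeroExt.inl d : DualNumber S) * TrivSqZeroExt.inl d' = 1 := by
      rw [← TrivSqZeroExt.inl_mul, hd, TrivSqZeroExt.inl_one]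
    have hs : pert A' (skew S p.1 p.2) - (TrivSqZeroExt.inl d' : DualNumber S) •
        (pert b 0 * pert c 0) = pert (A' - d' • (b * c)) (skew S p.1 p.2) := by
      rw [pert_schur]; simp
    rw [List.map_cons, edgeCoeff, edgeCoeff, inlPair, skew_inl, pert_fromBlocks,
      ih _ _ _ _ _ hd', hs]
    · simp
    · rw [hs]; exact isUnit_det_pert hA

end Schur

/-! ### The coefficient of all diagonal forms, for matrices close to the identity -/

section Defs

variable {ι Λ : Type*} [DecidableEq ι] [Ring Λ]

/-- The symmetric matrix whose entries are given by a list of pairs of indices with an element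
of `Λ`. -/
def edgeSum (l : List ((ι × ι) × Λ)) : Matrix ι ι Λ :=
  (l.map fun x => Matrix.single x.1.1 x.1.2 x.2 + Matrix.single x.1.2 x.1.1 x.2).sum

theorem edgeSum_cons (x : (ι × ι) × Λ) (l : List ((ι × ι) × Λ)) : edgeSum (x :: l) =
    Matrix.single x.1.1 x.1.2 x.2 + Matrix.single x.1.2 x.1.1 x.2 + edgeSum l := by
  simp [edgeSum]

/-- The symmetric matrix with diagonal entries `e` and off-diagonal entries given by a list of
pairs of indices with an element of `Λ`. -/
def edgeMat (e : ι → Λ) (l : List ((ι × ι) × Λ)) : Matrix ι ι Λ :=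
  Matrix.diagonal e + edgeSum l

/-- The signed sum of the elements attached to the edges at the vertex `i`. -/
def bdry (l : List ((ι × ι) × Λ)) (i : ι) : Λ :=
  (l.map fun x => (if x.1.1 = i then x.2 else 0) - (if x.1.2 = i then x.2 else 0)).sum

/-- The product of `e r` and all `bdry l i * e i`, where `i` runs through a list. -/
def treeForm (e : ι → Λ) (l : List ((ι × ι) × Λ)) (r : ι) (vs : List ι) : Λ :=
  e r * (vs.map fun i => bdry l i * e i).prod

end Defs

/-! ### Odd matrices over the dual numbers and derivatives of traces. -/

namespace OddSetting

section Dual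

variable {S Λ : Type*} [CommRing S] [Ring Λ] {φ : S →+* Λ} {V : AddSubgroup Λ}

/-- The odd elements of the dual numbers. -/
def dualOdd (V : AddSubgroup Λ) : AddSubgroup (DualNumber Λ) where
  carrier := {x | x.fst ∈ V ∧ x.snd ∈ V}
  add_mem' := fun hx hy => ⟨V.add_mem hx.1 hy.1, V.add_mem hx.2 hy.2⟩
  zero_mem' := ⟨V.zero_mem, V.zero_mem⟩
  neg_mem' := fun hx => ⟨V.neg_mem hx.1, V.neg_mem hx.2⟩

/-- The infinitesimal is even, so it commutes with everything and the axioms persist. The trace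
formula over the dual numbers, from the induction hypothesis, can therefore be differentiated. -/
theorem dual (h : OddSetting φ V) : OddSetting (dualMap φ) (dualOdd V) where
  natUnit n hn := by
    rw [TrivSqZeroExt.isUnit_iff_isUnit_fst]
    simpa using h.natUnit n hn
  central s x := by
    refine TrivSqZeroExt.ext ?_ ?_
    · simp [(h.central _ _).eq]
    · rw [DualNumber.snd_mul, DualNumber.snd_mul, fst_dualMap, snd_dualMap, (h.central _ _).eq,
        (h.central _ x.fst).eq, add_comm]
  smul_mem s v hv := by
    refine ⟨?_, ?_⟩
    · simpa using h.smul_mem s.fst _ hv.1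
    · rw [DualNumber.snd_mul, fst_dualMap, snd_dualMap]
      exact V.add_mem (h.smul_mem _ _ hv.2) (h.smul_mem _ _ hv.1)
  sq v hv := by
    refine TrivSqZeroExt.ext ?_ ?_
    · simpa using h.sq _ hv.1
    · rw [DualNumber.snd_mul, h.anticomm hv.1 hv.2, neg_add_cancel]; rfl
  comm v hv w hw x := by
    refine TrivSqZeroExt.ext ?_ ?_
    · simpa using (h.comm _ hv.1 _ hw.1 x.fst).eq
    · have h1 := (h.comm _ hv.1 _ hw.1 x.snd).eq
      have h2 := (h.comm _ hv.1 _ hw.2 x.fst).eq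
      have h3 := (h.comm _ hv.2 _ hw.1 x.fst).eq
      rw [DualNumber.snd_mul, DualNumber.snd_mul, DualNumber.snd_mul, TrivSqZeroExt.fst_mul,
        DualNumber.snd_mul, add_mul, mul_add, h1, h2, h3]
      abel

variable {m : Type*} [Fintype m] [DecidableEq m]

/-- The derivative of a power is a sum over the position of the differentiated factor. Since `r` is
even, the powers on both sides have the same parity, and in either case cyclic rotation introduces
no sign. -/
theorem snd_trace_pow (h : OddSetting φ V) (Z : Matrix m m (DualNumber Λ))
    (hZ : ∀ i j, Z i j ∈ dualOdd V) {r : ℕ} (hr : Even r) :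
    (Z ^ (r + 1)).trace.snd =
      ((r + 1 : ℕ) : Λ) *
        (Z.map TrivSqZeroExt.snd * Z.map TrivSqZeroExt.fst ^ r).trace := by
  set a := Z.map TrivSqZeroExt.fst with ha
  set b := Z.map TrivSqZeroExt.snd with hb
  have haV (i j) : a i j ∈ V := (hZ i j).1
  have hbV (i j) : b i j ∈ V := (hZ i j).2
  have hfst (s : ℕ) : (Z ^ s).map TrivSqZeroExt.fst = a ^ s :=
    map_pow (RingHom.mapMatrix (dualFst Λ)) Z s
  have hsnd (s : ℕ) : (Z ^ (s + 1)).map TrivSqZeroExt.snd =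
      ∑ i ∈ Finset.range (s + 1), a ^ i * b * a ^ (s - i) := by
    induction s with
    | zero => simp [hb]
    | succ s ih =>
      have h1 : (Z ^ (s + 1 + 1)).map TrivSqZeroExt.snd =
          (Z ^ (s + 1)).map TrivSqZeroExt.fst * b + (Z ^ (s + 1)).map TrivSqZeroExt.snd * a := by
        rw [pow_succ]
        ext i j
        simp only [Matrix.map_apply, Matrix.mul_apply, Matrix.add_apply, TrivSqZeroExt.snd_sum,
          DualNumber.snd_mul, Finset.sum_add_distrib]
        rfl
      rw [h1, hfst, ih, Finset.sum_range_succ _ (s + 1), add_comm, Finset.sum_mul]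
      congr 1
      · refine Finset.sum_congr rfl fun i hi => ?_
        rw [mul_assoc _ (a ^ (s - i)) a, ← pow_succ]
        congr 2
        have := Finset.mem_range.1 hi
        omega
      · simp
  have htr : (Z ^ (r + 1)).trace.snd = ((Z ^ (r + 1)).map TrivSqZeroExt.snd).trace := by
    simp [Matrix.trace, TrivSqZeroExt.snd_sum]
  have hterm (i : ℕ) (hi : i ∈ Finset.range (r + 1)) :
      (a ^ i * b * a ^ (r - i)).trace = (b * a ^ r).trace := by
    have hi' : i ≤ r := by simpa [Nat.lt_succ_iff] using hi
    rcases Nat.even_or_odd i with hev | hodd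
    · rw [mul_assoc, trace_mul_comm_of_central (a ^ i) _ (h.even_pow_central haV hev), mul_assoc,
        ← pow_add, Nat.sub_add_cancel hi']
    · rw [trace_mul_comm_of_central (a ^ i * b), ← mul_assoc, ← pow_add, Nat.sub_add_cancel hi',
        trace_mul_comm_of_central (a ^ r) _ (h.even_pow_central haV hr)]
      intro j k x
      rw [Matrix.mul_apply]
      exact Commute.sum_left _ _ _ fun y _ => h.odd_pow_eq haV hodd _ _ (hbV _ _) _
  rw [htr, hsnd, Matrix.trace_sum, Finset.sum_congr rfl hterm, Finset.sum_const,
    Finset.card_range, nsmul_eq_mul]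

end Dual

end OddSetting

section Inverse

variable {m : Type*} [Fintype m] [DecidableEq m] {S : Type*} [CommRing S]

theorem pert_mul (A H B K : Matrix m m S) : pert A H * pert B K = pert (A * B) (A * K + H * B) := by
  ext i j
  · simp [Matrix.mul_apply, TrivSqZeroExt.fst_sum]
  · simp only [Matrix.mul_apply, TrivSqZeroExt.snd_sum, DualNumber.snd_mul, fst_pert, snd_pert,
      Matrix.add_apply, Finset.sum_add_distrib]

theorem inv_pert {A : Matrix m m S} (hA : IsUnit A.det) (H : Matrix m m S) :
    (pert A H)⁻¹ = pert A⁻¹ (-(A⁻¹ * H * A⁻¹)) := by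
  apply Matrix.inv_eq_right_inv
  rw [pert_mul, Matrix.mul_nonsing_inv _ hA, mul_neg, ← mul_assoc, ← mul_assoc,
    Matrix.mul_nonsing_inv _ hA, one_mul, neg_add_cancel]
  ext i j <;> by_cases hij : i = j <;> simp [hij, Matrix.one_apply]

/-- Modulo `J` the matrix is the identity, so its determinant lies in `1 + J`. -/
theorem isUnit_det_of_sub_one_mem {J : Ideal S} (hJ : ∀ x ∈ J, IsUnit (1 + x)) {A : Matrix m m S}
    (hA : ∀ i j, A i j - (1 : Matrix m m S) i j ∈ J) : IsUnit A.det := by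
  have h1 : A.map (Ideal.Quotient.mk J) = 1 := by
    have : A.map (Ideal.Quotient.mk J) = (1 : Matrix m m S).map (Ideal.Quotient.mk J) := by
      ext i j
      exact (Ideal.Quotient.mk_eq_mk_iff_sub_mem _ _).2 (hA i j)
    rw [this]
    exact Matrix.map_one _ (map_zero _) (map_one _)
  have h2 : A.det - 1 ∈ J := by
    rw [← Ideal.Quotient.mk_eq_mk_iff_sub_mem, map_one, RingHom.map_det, RingHom.mapMatrix_apply,
      h1, Matrix.det_one]
  simpa using hJ _ h2

end Inverse

section Letters

variable {ι Λ : Type*} [DecidableEq ι] [Ring Λ]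

theorem edgeMat_mem {V : AddSubgroup Λ} {e : ι → Λ} {l : List ((ι × ι) × Λ)} (he : ∀ i, e i ∈ V)
    (hl : ∀ x ∈ l, x.2 ∈ V) (i j : ι) : edgeMat e l i j ∈ V := by
  rw [edgeMat, Matrix.add_apply]
  refine V.add_mem ?_ ?_
  · rw [Matrix.diagonal_apply]; split_ifs
    · exact he i
    · exact V.zero_mem
  · induction l with
    | nil => exact V.zero_mem
    | cons x l ih =>
      rw [edgeSum_cons, Matrix.add_apply]
      refine V.add_mem ?_ (ih fun y hy => hl y (by simp [hy]))
      have hx := hl x (by simp)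
      rw [Matrix.add_apply, Matrix.single_apply, Matrix.single_apply]
      refine V.add_mem ?_ ?_ <;> split_ifs <;> first | exact hx | exact V.zero_mem

theorem bdry_mem {V : AddSubgroup Λ} {l : List ((ι × ι) × Λ)}
    (hl : ∀ x ∈ l, x.2 ∈ V) (i : ι) : bdry l i ∈ V := by
  refine AddSubgroup.list_sum_mem _ fun y hy => ?_
  obtain ⟨x, hx, rfl⟩ := List.mem_map.1 hy
  have hx := hl x hx
  refine V.sub_mem ?_ ?_ <;> split_ifs <;> first | exact hx | exact V.zero_mem

/-- The odd list, as a list of dual numbers. -/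
def inlEdges (l : List ((ι × ι) × Λ)) : List ((ι × ι) × DualNumber Λ) :=
  l.map fun x => (x.1, TrivSqZeroExt.inl x.2)

theorem map_fst_inlEdges (l : List ((ι × ι) × Λ)) :
    (inlEdges l).map Prod.fst = l.map Prod.fst := by
  simp [inlEdges, Function.comp_def]

theorem edgeMat_inl (e : ι → Λ) (l : List ((ι × ι) × Λ)) :
    edgeMat (fun i => (TrivSqZeroExt.inl (e i) : DualNumber Λ)) (inlEdges l) =
      (edgeMat e l).map TrivSqZeroExt.inl := by
  have h : edgeSum (inlEdges l) = (edgeSum l).map (TrivSqZeroExt.inl : Λ → DualNumber Λ) := by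
    induction l with
    | nil => ext <;> simp [inlEdges, edgeSum]
    | cons x l ih =>
      rw [inlEdges, List.map_cons, ← inlEdges, edgeSum_cons, edgeSum_cons, ih]
      ext i j <;> simp only [Matrix.add_apply, Matrix.map_apply, Matrix.single_apply] <;>
        split_ifs <;> simp
  rw [edgeMat, h, edgeMat]
  ext i j <;> by_cases hij : i = j <;> simp [hij]

theorem treeForm_inl (e : ι → Λ) (l : List ((ι × ι) × Λ)) (r : ι) (vs : List ι) :
    treeForm (fun i => (TrivSqZeroExt.inl (e i) : DualNumber Λ)) (inlEdges l) r vs =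
      TrivSqZeroExt.inl (treeForm e l r vs) := by
  have hb (i : ι) : bdry (inlEdges l) i = TrivSqZeroExt.inl (bdry l i) := by
    induction l with
    | nil => simp [bdry, inlEdges]
    | cons x l ih =>
      simp only [bdry, inlEdges, List.map_cons, List.sum_cons] at ih ⊢
      rw [ih, TrivSqZeroExt.inl_add]
      congr 1
      split_ifs <;> simp
  rw [treeForm, treeForm, TrivSqZeroExt.inl_mul]
  congr 1
  induction vs with
  | nil => simp
  | cons i vs ih =>
    rw [List.map_cons, List.prod_cons, ih, List.map_cons, List.prod_cons, hb,
      TrivSqZeroExt.inl_mul, TrivSqZeroExt.inl_mul]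

end Letters

/-- The trace of the odd power of `A⁻¹ Υ` is given by the edge coefficient of `A` and the tree form
of the letters in `Υ`. -/
def TraceFormula {ι : Type*} [Fintype ι] [DecidableEq ι] {S : Type u} {Λ : Type v} [CommRing S]
    [Ring Λ] (φ : S →+* Λ) (A : Matrix ι ι S) (e : ι → Λ) (l : List ((ι × ι) × Λ)) (r : ι)
    (vs : List ι) : Prop :=
  ((tens φ A⁻¹ 1 * edgeMat e l) ^ (2 * l.length + 1)).trace =
    ((2 * l.length + 1 : ℕ) : Λ) * φ (edgeCoeff (l.map Prod.fst) A) * treeForm e l r vs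

/-! ### Removal of an isolated vertex or of a leaf. -/

section Blocks

variable {κ : Type*} [Fintype κ] [DecidableEq κ] {S : Type u} {Λ : Type v} [CommRing S] [Ring Λ]
  {φ : S →+* Λ} {V : AddSubgroup Λ}

/-- Edges of a block, as edges of the bordered matrix. -/
def inlList (l : List ((κ × κ) × Λ)) : List (((κ ⊕ Unit) × (κ ⊕ Unit)) × Λ) :=
  l.map fun x => (inlPair x.1, x.2)

theorem map_fst_inlList (l : List ((κ × κ) × Λ)) :
    (inlList l).map Prod.fst = (l.map Prod.fst).map inlPair := by
  simp [inlList, Function.comp_def]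

theorem edgeMat_inlList (φ : S →+* Λ) (e : κ ⊕ Unit → Λ) (l : List ((κ × κ) × Λ)) :
    edgeMat e (inlList l) =
      Matrix.fromBlocks (edgeMat (e ∘ Sum.inl) l) 0 0 (tens φ 1 (e (Sum.inr ()))) := by
  have h : edgeSum (inlList l) = Matrix.fromBlocks (edgeSum l) 0 0 0 := by
    induction l with
    | nil => ext i j; rcases i with i | i <;> rcases j with j | j <;> simp [inlList, edgeSum]
    | cons x l ih =>
      rw [inlList, List.map_cons, ← inlList, edgeSum_cons, edgeSum_cons, ih]
      ext i j
      rcases i with i | i <;> rcases j with j | j <;> simp [inlPair, Matrix.single_apply]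
  rw [edgeMat, h, edgeMat]
  ext i j
  rcases i with i | i <;> rcases j with j | j <;>
    simp [tens, Matrix.diagonal_apply, Sum.inl.injEq]

theorem bdry_inlList_inr (l : List ((κ × κ) × Λ)) : bdry (inlList l) (Sum.inr ()) = 0 := by
  induction l with
  | nil => simp [bdry, inlList]
  | cons x l ih =>
    simp only [bdry, inlList, List.map_cons, List.sum_cons] at ih ⊢
    rw [ih]; simp [inlPair]

theorem bdry_inlList_inl (l : List ((κ × κ) × Λ)) (i : κ) :
    bdry (inlList l) (Sum.inl i) = bdry l i := by
  induction l with
  | nil => simp [bdry, inlList]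
  | cons x l ih =>
    simp only [bdry, inlList, List.map_cons, List.sum_cons] at ih ⊢
    rw [ih]; simp [inlPair]

/-- Once `o * e` has been extracted, the contribution of `o` to the boundary at the neighbour of the
leaf is invisible. The remaining factors are those of the graph without the leaf. -/
theorem OddSetting.pair_mul_prod (h : OddSetting φ V) {o e : Λ} (ho : o ∈ V) (he : e ∈ V)
    (vs : List κ) (f g : κ → Λ) (s : κ → S) :
    o * e * (vs.map fun i => (φ (s i) * o + f i) * g i).prod =
      o * e * (vs.map fun i => f i * g i).prod := by
  induction vs with
  | nil => rfl
  | cons i vs ih =>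
    have h0 : o * e * (φ (s i) * o + f i) = o * e * f i := by
      have := h.pair_mul_lin ho he (s i) 0
      rw [map_zero, zero_mul, add_zero] at this
      rw [mul_add, this, zero_add]
    rw [List.map_cons, List.prod_cons, List.map_cons, List.prod_cons, ← mul_assoc,
      ← mul_assoc (o * e), h0, mul_assoc (o * e), (h.comm _ ho _ he _).eq, mul_assoc, ih,
      ← mul_assoc, ← (h.comm _ ho _ he _).eq, mul_assoc (o * e)]

/-- If the last row of `Υ` has only a diagonal entry then the trace vanishes. -/
theorem OddSetting.trace_isolated (h : OddSetting φ V) (A' : Matrix κ κ S) (b : Matrix κ Unit S)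
    (c : Matrix Unit κ S) (d d' : S) (hd : d * d' = 1) (hA : IsUnit (A' - d' • (b * c)).det)
    {e : κ ⊕ Unit → Λ} (he : ∀ i, e i ∈ V) {l : List ((κ × κ) × Λ)} (hl : ∀ x ∈ l, x.2 ∈ V)
    (hcard : Fintype.card κ = l.length) (hl0 : 0 < l.length) :
    ((tens φ (Matrix.fromBlocks A' b c (d • 1))⁻¹ 1 * edgeMat e (inlList l)) ^
      (2 * l.length + 1)).trace = 0 := by
  have := h.trace_bordered V.zero_mem (he (Sum.inr ())) A' b c d d' hd hA
    (edgeMat (e ∘ Sum.inl) l) (edgeMat_mem (fun i => he _) hl) 0 0 (by omega)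
  rw [tens_zero_left, tens_zero_left, ← edgeMat_inlList φ e l] at this
  rw [← hcard, this]
  simp

/-- The induction step: removal of a leaf. -/
theorem OddSetting.traceFormula_leaf (h : OddSetting φ V) (A' : Matrix κ κ S) (b : Matrix κ Unit S)
    (c : Matrix Unit κ S) (d d' : S) (hd : d * d' = 1) (hA : IsUnit (A' - d' • (b * c)).det)
    {e : κ ⊕ Unit → Λ} (he : ∀ i, e i ∈ V) {l : List ((κ × κ) × Λ)} (hl : ∀ x ∈ l, x.2 ∈ V)
    (hcard : Fintype.card κ = l.length + 1) (p : (κ ⊕ Unit) × (κ ⊕ Unit)) {o : Λ} (ho : o ∈ V)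
    (u : κ) (s : S)
    (hp : (p = (Sum.inl u, Sum.inr ()) ∧ s = 1) ∨ (p = (Sum.inr (), Sum.inl u) ∧ s = -1))
    (r : κ) (vs : List κ)
    (ih : ∀ H : Matrix κ κ S, TraceFormula (dualMap φ) (pert (A' - d' • (b * c)) H)
      (fun i => TrivSqZeroExt.inl (e (Sum.inl i))) (inlEdges l) r vs) :
    TraceFormula φ (Matrix.fromBlocks A' b c (d • 1)) e ((p, o) :: inlList l) (Sum.inl r)
      (Sum.inr () :: vs.map Sum.inl) := by
  set δ : Matrix κ Unit S := Matrix.single u () 1 with hδ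
  set δ' : Matrix Unit κ S := Matrix.single () u 1 with hδ'
  set ev := e (Sum.inr ()) with hev
  have hevV : ev ∈ V := he _
  set A'' := A' - d' • (b * c) with hA''
  set N := edgeMat (e ∘ Sum.inl) l with hN
  have hNV : ∀ i j, N i j ∈ V := edgeMat_mem (fun i => he _) hl
  have hss : s * s = 1 := by rcases hp with ⟨-, rfl⟩ | ⟨-, rfl⟩ <;> simp
  have hmat : edgeMat e ((p, o) :: inlList l) =
      Matrix.fromBlocks N (tens φ δ o) (tens φ δ' o) (tens φ 1 ev) := by
    have h1 : edgeMat e ((p, o) :: inlList l) =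
        Matrix.single p.1 p.2 o + Matrix.single p.2 p.1 o + edgeMat e (inlList l) := by
      rw [edgeMat, edgeMat, edgeSum_cons]; abel
    rw [h1, edgeMat_inlList φ]
    ext i j
    rcases hp with ⟨rfl, -⟩ | ⟨rfl, -⟩ <;> rcases i with i | i <;> rcases j with j | j <;>
      simp [tens, Matrix.single_apply, hδ, hδ', hN, hev]
  have hskew : skew S p.1 p.2 = Matrix.fromBlocks 0 (s • δ) (-(s • δ')) 0 := by
    ext i j
    rcases hp with ⟨rfl, rfl⟩ | ⟨rfl, rfl⟩ <;> rcases i with i | i <;> rcases j with j | j <;>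
      simp [skew, Matrix.single_apply, hδ, hδ', eq_comm]
  -- The common direction of both sides: `trace_bordered` produces `u * c - b * w`, which is `H`,
  -- and the skew perturbation at the edge changes the Schur complement by `-(d' * s) • H`.
  set H : Matrix κ κ S := δ * c - b * δ' with hH
  set H₁ : Matrix κ κ S := -((d' * s) • H) with hH₁
  have hd' : (TrivSqZeroExt.inl d : DualNumber S) * TrivSqZeroExt.inl d' = 1 := by
    rw [← TrivSqZeroExt.inl_mul, hd, TrivSqZeroExt.inl_one]
  have hschur : pert A' 0 - (TrivSqZeroExt.inl d' : DualNumber S) •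
      (pert b (s • δ) * pert c (-(s • δ'))) = pert A'' H₁ := by
    rw [pert_schur, hH₁, hH]
    congr 1
    simp only [Matrix.mul_neg, Matrix.mul_smul, Matrix.smul_mul, zero_sub, smul_add, smul_sub,
      smul_neg, smul_smul]
    abel
  have hcoeff : edgeCoeff (((p, o) :: inlList l).map Prod.fst)
      (Matrix.fromBlocks A' b c (d • 1)) = d' * (edgeCoeff (l.map Prod.fst) (pert A'' H₁)).snd := by
    rw [List.map_cons, edgeCoeff, hskew, pert_fromBlocks, map_fst_inlList,
      edgeCoeff_fromBlocks _ _ _ _ _ _ hd', hschur]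
    · simp
    · rw [hschur]; exact isUnit_det_pert hA
  have htree : treeForm e ((p, o) :: inlList l) (Sum.inl r) (Sum.inr () :: vs.map Sum.inl) =
      -(φ s * (o * ev)) * treeForm (e ∘ Sum.inl) l r vs := by
    have hb (i : κ ⊕ Unit) : bdry ((p, o) :: inlList l) i =
        ((if p.1 = i then o else 0) - (if p.2 = i then o else 0)) + bdry (inlList l) i := by
      simp [bdry]
    have hbv : bdry ((p, o) :: inlList l) (Sum.inr ()) = -(φ s * o) := by
      rw [hb, bdry_inlList_inr]
      rcases hp with ⟨rfl, rfl⟩ | ⟨rfl, rfl⟩ <;> simp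
    have hbi (i : κ) : bdry ((p, o) :: inlList l) (Sum.inl i) =
        φ (if i = u then s else 0) * o + bdry l i := by
      rw [hb, bdry_inlList_inl]
      rcases hp with ⟨rfl, rfl⟩ | ⟨rfl, rfl⟩ <;> by_cases hi : u = i <;>
        simp [hi, eq_comm]
    rw [treeForm, List.map_cons, List.prod_cons, hbv, List.map_map]
    have h2 := h.pair_mul_prod ho hevV vs (bdry l) (e ∘ Sum.inl) fun i => if i = u then s else 0
    have h3 : (vs.map ((fun i => bdry ((p, o) :: inlList l) i * e i) ∘ Sum.inl)) =
        vs.map fun i => (φ (if i = u then s else 0) * o + bdry l i) * (e ∘ Sum.inl) i := by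
      refine List.map_congr_left fun i _ => ?_
      rw [Function.comp_apply, hbi]; rfl
    rw [h3, ← hev, treeForm, neg_mul, mul_assoc (φ s), neg_mul, mul_assoc (φ s) (o * ev), h2,
      mul_neg, neg_mul, mul_assoc (φ s)]
    congr 1
    rw [← mul_assoc, ← (h.central s _).eq, mul_assoc]
    congr 1
    rw [← mul_assoc, ← (h.comm _ ho _ hevV (e (Sum.inl r))).eq, mul_assoc (o * ev)]
    rfl
  have hdual := h.dual
  -- The infinitesimal part of the induction hypothesis is the derivative of the smaller trace in
  -- the direction `H₁`.
  have ih1 := congrArg TrivSqZeroExt.snd (ih H₁)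
  have hmap : (tens (dualMap φ) (pert A'' H₁)⁻¹ 1 *
      edgeMat (fun i => (TrivSqZeroExt.inl (e (Sum.inl i)) : DualNumber Λ)) (inlEdges l)) =
      tens (dualMap φ) (pert A''⁻¹ (-(A''⁻¹ * H₁ * A''⁻¹))) 1 *
        N.map TrivSqZeroExt.inl := by
    rw [inv_pert hA, edgeMat_inl]; rfl
  set Z := tens (dualMap φ) (pert A''⁻¹ (-(A''⁻¹ * H₁ * A''⁻¹))) 1 *
        N.map (TrivSqZeroExt.inl : Λ → DualNumber Λ) with hZ
  have hZfst : Z.map TrivSqZeroExt.fst = tens φ A''⁻¹ 1 * N := by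
    ext i j
    simp [hZ, Matrix.mul_apply, TrivSqZeroExt.fst_sum, tens]
  have hZsnd : Z.map TrivSqZeroExt.snd = -(tens φ (A''⁻¹ * H₁) 1 * (tens φ A''⁻¹ 1 * N)) := by
    rw [← Matrix.mul_assoc, tens_mul h, mul_one, ← Matrix.neg_mul, ← tens_neg]
    ext i j
    simp [hZ, Matrix.mul_apply, TrivSqZeroExt.snd_sum, DualNumber.snd_mul, tens]
  have hZV (i j) : Z i j ∈ OddSetting.dualOdd V := by
    rw [hZ, Matrix.mul_apply]
    refine AddSubgroup.sum_mem _ fun k _ => ?_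
    rw [tens_apply, mul_one]
    refine hdual.smul_mem _ _ ⟨hNV k j, ?_⟩
    simp [V.zero_mem]
  have hlen : (inlEdges l).length = l.length := by simp [inlEdges]
  rw [hmap, hlen, h.snd_trace_pow Z hZV (even_two_mul _), hZfst, hZsnd, neg_mul, Matrix.mul_assoc,
    ← pow_succ', Matrix.trace_neg] at ih1
  have aux (K X Y : Λ) (hXY : K * -X = K * Y) : K * X = K * -Y := by
    rw [mul_neg, ← hXY, mul_neg, neg_neg]
  have ih2 : ((2 * l.length + 1 : ℕ) : Λ) *
      (tens φ (A''⁻¹ * H₁) 1 * (tens φ A''⁻¹ 1 * N) ^ (2 * l.length + 1)).trace =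
      ((2 * l.length + 1 : ℕ) : Λ) * -(φ (edgeCoeff (l.map Prod.fst) (pert A'' H₁)).snd *
        treeForm (e ∘ Sum.inl) l r vs) := by
    refine aux _ _ _ (ih1.trans ?_)
    rw [map_fst_inlEdges, treeForm_inl, mul_assoc]
    simp only [DualNumber.snd_mul, TrivSqZeroExt.fst_natCast, TrivSqZeroExt.snd_natCast, zero_mul,
      add_zero, TrivSqZeroExt.snd_inl, mul_zero, TrivSqZeroExt.fst_inl, snd_dualMap, zero_add]
    rfl
  -- Differentiating the trace gave the factor `2 * l.length + 1`, which also stands in the formula;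
  -- it is cancelled, and the new factor comes from `trace_bordered`.
  have ih3 := (h.natUnit' (n := 2 * l.length + 1) (by omega)).mul_left_cancel ih2
  rw [TraceFormula, hmat, hcoeff, htree]
  have hmain := h.trace_bordered ho hevV A' b c d d' hd hA N hNV δ δ' (by omega)
  have hlen' : (((p, o) :: inlList l)).length = Fintype.card κ := by simp [inlList, hcard]
  have hlen'' : 2 * Fintype.card κ - 1 = 2 * l.length + 1 := by omega
  rw [hlen', hmain, ← hA'', ← hH, hlen'']
  have hHt : (tens φ (A''⁻¹ * H₁) 1 * (tens φ A''⁻¹ 1 * N) ^ (2 * l.length + 1)).trace =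
      -(φ (d' * s) * (tens φ (A''⁻¹ * H) 1 *
        (tens φ A''⁻¹ 1 * N) ^ (2 * l.length + 1)).trace) := by
    rw [hH₁, Matrix.mul_neg, Matrix.mul_smul, tens_neg, tens_smul, Matrix.neg_mul,
      Matrix.trace_neg]
    congr 1
    simp only [Matrix.trace, Matrix.diag_apply, Matrix.mul_apply, tens_apply, Finset.mul_sum]
    refine Finset.sum_congr rfl fun i _ => Finset.sum_congr rfl fun j _ => ?_
    rw [mul_one, mul_one, ← mul_assoc, (h.central (d' * s) _).eq]
  rw [hHt, neg_inj] at ih3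
  set t := (tens φ (A''⁻¹ * H) 1 * (tens φ A''⁻¹ 1 * N) ^ (2 * l.length + 1)).trace with ht
  set F := treeForm (e ∘ Sum.inl) l r vs with hF
  set q := (edgeCoeff (l.map Prod.fst) (pert A'' H₁)).snd with hq
  -- One factor `d'` comes from the pivot in the inverse determinant, the other from the perturbed
  -- Schur complement; the orientation sign `s` is its own inverse.
  have h5 : φ (d' * d') * t = φ s * φ d' * (φ q * F) := by
    rw [← ih3, ← mul_assoc, ← map_mul, ← map_mul]
    congr 2
    linear_combination -d' * d' * hss
  have c0 := h.comm _ ho _ hevV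
  rw [neg_mul, neg_mul, mul_assoc ((_ : ℕ) : Λ), mul_assoc (o * ev), h5, neg_mul, mul_neg,
    mul_assoc ((_ : ℕ) : Λ), map_mul, (c0 _).eq, mul_assoc (φ s) (o * ev), (c0 F).eq]
  simp only [mul_assoc]
  rw [← mul_assoc (φ q) (φ s), ← (h.central s (φ q)).eq, mul_assoc, ← mul_assoc (φ d') (φ s),
    ← (h.central s (φ d')).eq, mul_assoc]

end Blocks

/-! ### Relabelling of vertices and reordering of edges. -/

section Reindex

variable {α β : Type*} [Fintype α] [DecidableEq α] [Fintype β] [DecidableEq β] {S : Type u}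
  {Λ : Type v} [CommRing S] [Ring Λ] {φ : S →+* Λ} {V : AddSubgroup Λ}

/-- The image of a list of edges under a map of the vertices. -/
def mapEdges (f : α → β) (l : List ((α × α) × Λ)) : List ((β × β) × Λ) :=
  l.map fun x => (Prod.map f f x.1, x.2)

theorem edgeMat_mapEdges (σ : α ≃ β) (e : β → Λ) (l : List ((α × α) × Λ)) :
    (edgeMat e (mapEdges σ l)).submatrix σ σ = edgeMat (e ∘ σ) l := by
  have h : (edgeSum (mapEdges σ l)).submatrix σ σ = edgeSum l := by
    induction l with
    | nil => ext; simp [edgeSum, mapEdges]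
    | cons x l ih =>
      rw [mapEdges, List.map_cons, ← mapEdges, edgeSum_cons, edgeSum_cons, ← ih]
      ext i j
      simp [Matrix.single_apply]
  rw [edgeMat, edgeMat, ← h]
  ext i j
  simp [Matrix.diagonal_apply]

theorem edgeCoeff_mapEdges (σ : α ≃ β) (l : List (α × α)) (A : Matrix β β S) :
    edgeCoeff (l.map (Prod.map σ σ)) A = edgeCoeff l (A.submatrix σ σ) := by
  induction l generalizing S with
  | nil => simp [edgeCoeff]
  | cons x l ih =>
    rw [List.map_cons, edgeCoeff, edgeCoeff, ih]
    congr 2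
    ext i j <;> simp [skew, Matrix.single_apply]

theorem bdry_mapEdges (σ : α ≃ β) (l : List ((α × α) × Λ)) (i : α) :
    bdry (mapEdges σ l) (σ i) = bdry l i := by
  simp [bdry, mapEdges, Function.comp_def]

theorem trace_submatrix_pow (σ : α ≃ β) (A : Matrix β β S) (M : Matrix β β Λ) (r : ℕ) :
    ((tens φ (A.submatrix σ σ)⁻¹ 1 * M.submatrix σ σ) ^ r).trace =
      ((tens φ A⁻¹ 1 * M) ^ r).trace := by
  have h1 : tens φ (A.submatrix σ σ)⁻¹ 1 * M.submatrix σ σ =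
      (tens φ A⁻¹ (1 : Λ) * M).submatrix σ σ := by
    rw [Matrix.inv_submatrix_equiv, ← Matrix.submatrix_mul_equiv _ _ _ σ]
    rfl
  have h2 (s : ℕ) (X : Matrix β β Λ) : (X.submatrix σ σ) ^ s = (X ^ s).submatrix σ σ := by
    induction s with
    | zero => simp
    | succ s ih => rw [pow_succ, pow_succ, ih, Matrix.submatrix_mul_equiv]
  rw [h1, h2]
  exact Equiv.sum_comp σ fun i => ((tens φ A⁻¹ 1 * M) ^ r) i i

theorem traceFormula_mapEdges (σ : α ≃ β) {A : Matrix β β S} {e : β → Λ}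
    {l : List ((α × α) × Λ)} {r : α} {vs : List α}
    (h : TraceFormula φ (A.submatrix σ σ) (e ∘ σ) l r vs) :
    TraceFormula φ A e (mapEdges σ l) (σ r) (vs.map σ) := by
  rw [TraceFormula] at h ⊢
  have h1 : (mapEdges σ l).map Prod.fst = (l.map Prod.fst).map (Prod.map σ σ) := by
    simp [mapEdges]
  have h2 : treeForm e (mapEdges σ l) (σ r) (vs.map σ) = treeForm (e ∘ σ) l r vs := by
    rw [treeForm, treeForm, List.map_map]
    congr 2
    refine List.map_congr_left fun i _ => ?_
    simp [bdry_mapEdges]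
  have h3 : (mapEdges σ l).length = l.length := by simp [mapEdges]
  rw [← trace_submatrix_pow σ, edgeMat_mapEdges, h1, h2, edgeCoeff_mapEdges, h3, h]

theorem bdry_perm {l l' : List ((α × α) × Λ)} (hl : l.Perm l') (i : α) : bdry l i = bdry l' i :=
  (hl.map _).sum_eq

theorem OddSetting.pair_prod_perm (h : OddSetting φ V) {f g : α → Λ} (hf : ∀ i, f i ∈ V)
    (hg : ∀ i, g i ∈ V) {vs vs' : List α} (hvs : vs.Perm vs') :
    (vs.map fun i => f i * g i).prod = (vs'.map fun i => f i * g i).prod := by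
  refine (hvs.map _).prod_eq' ?_
  rw [List.pairwise_map]
  exact List.pairwise_of_forall fun i j => h.comm _ (hf i) _ (hg i) _

theorem OddSetting.traceFormula_perm (h : OddSetting φ V) {A : Matrix α α S} (hA : IsUnit A.det)
    {e : α → Λ} (he : ∀ i, e i ∈ V) {l l' : List ((α × α) × Λ)} (hl : ∀ x ∈ l, x.2 ∈ V)
    (hll : l.Perm l') {r : α} {vs vs' : List α} (hvs : vs.Perm vs')
    (hT : TraceFormula φ A e l' r vs') : TraceFormula φ A e l r vs := by
  rw [TraceFormula] at hT ⊢
  have h1 : edgeMat e l = edgeMat e l' := by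
    rw [edgeMat, edgeMat, edgeSum, (hll.map _).sum_eq]; rfl
  have h2 : treeForm e l r vs = treeForm e l' r vs' := by
    rw [treeForm, treeForm, h.pair_prod_perm (fun i => bdry_mem hl i) he hvs]
    simp only [bdry_perm hll]
  rw [h1, h2, hll.length_eq, edgeCoeff_perm (hll.map _) hA, hT]

end Reindex

/-! ### Splitting off one vertex. -/

section Vertex

variable {ι : Type*} [Fintype ι] [DecidableEq ι]

/-- The vertices different from `v`, together with `v`. -/
def splitVertex (v : ι) : {i : ι // i ≠ v} ⊕ Unit ≃ ι where
  toFun := Sum.elim (fun i => i.1) fun _ => v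
  invFun i := if h : i = v then Sum.inr () else Sum.inl ⟨i, h⟩
  left_inv := by
    rintro (⟨i, h⟩ | _)
    · exact dif_neg h
    · exact dif_pos rfl
  right_inv i := by by_cases h : i = v <;> simp [h]

@[simp] theorem splitVertex_inl (v : ι) (i : {i : ι // i ≠ v}) : splitVertex v (Sum.inl i) = i :=
  rfl

@[simp] theorem splitVertex_inr (v : ι) (j : Unit) : splitVertex v (Sum.inr j) = v := rfl

theorem exists_mapEdges {Λ : Type*} (v : ι) (l : List ((ι × ι) × Λ))
    (hl : ∀ x ∈ l, x.1.1 ≠ v ∧ x.1.2 ≠ v) :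
    ∃ l₀, l = mapEdges (splitVertex v) (inlList l₀) := by
  induction l with
  | nil => exact ⟨[], rfl⟩
  | cons x l ih =>
    obtain ⟨l₀, rfl⟩ := ih fun y hy => hl y (by simp [hy])
    have hx := hl x (by simp)
    exact ⟨((⟨x.1.1, hx.1⟩, ⟨x.1.2, hx.2⟩), x.2) :: l₀, rfl⟩

/-- The pivot lies in `1 + J`, hence is a unit, and the correction `d' b c` lies in `J` because the
off-diagonal entries of `A` do. Closeness to the identity is thus inherited by the Schur complement,
so the elimination can go on. -/
theorem exists_fromBlocks {S : Type*} [CommRing S] {J : Ideal S} (hJ : ∀ x ∈ J, IsUnit (1 + x))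
    {A : Matrix ι ι S} (hA : ∀ i j, A i j - (1 : Matrix ι ι S) i j ∈ J) (v : ι) :
    ∃ (A' : Matrix {i : ι // i ≠ v} {i : ι // i ≠ v} S) (b : Matrix {i : ι // i ≠ v} Unit S)
      (c : Matrix Unit {i : ι // i ≠ v} S) (d d' : S), d * d' = 1 ∧
      A.submatrix (splitVertex v) (splitVertex v) = Matrix.fromBlocks A' b c (d • 1) ∧
      ∀ i j, (A' - d' • (b * c)) i j - (1 : Matrix _ _ S) i j ∈ J := by
  have hd : IsUnit (A v v) := by simpa using hJ _ (hA v v)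
  obtain ⟨d', hd'⟩ := hd.exists_right_inv
  refine ⟨Matrix.of fun i j => A i j, Matrix.of fun i _ => A i v, Matrix.of fun _ j => A v j,
    A v v, d', hd', ?_, ?_⟩
  · ext i j
    rcases i with i | i <;> rcases j with j | j <;> simp
  · intro i j
    have h1 := hA i j
    have h2 := hA i v
    rw [Matrix.one_apply_ne i.2, sub_zero] at h2
    have h3 : (1 : Matrix {i : ι // i ≠ v} {i : ι // i ≠ v} S) i j = (1 : Matrix ι ι S) i j := by
      simp [Matrix.one_apply, Subtype.ext_iff]
    rw [h3, Matrix.sub_apply, sub_right_comm]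
    refine J.sub_mem h1 ?_
    simp only [Matrix.smul_apply, Matrix.mul_apply, Matrix.of_apply, Finset.univ_unique,
      Finset.sum_singleton, smul_eq_mul]
    exact J.mul_mem_left _ (J.mul_mem_right _ h2)

/-- The handshake lemma: an edge without loop is counted at its two ends. -/
theorem sum_countP {Λ : Type*} (l : List ((ι × ι) × Λ)) (hl : ∀ x ∈ l, x.1.1 ≠ x.1.2) :
    ∑ i, l.countP (fun x => x.1.1 = i ∨ x.1.2 = i) = 2 * l.length := by
  induction l with
  | nil => simp
  | cons x l ih =>
    simp only [List.countP_cons, Finset.sum_add_distrib, List.length_cons]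
    rw [ih fun y hy => hl y (by simp [hy]), mul_add]
    congr 1
    have hx := hl x (by simp)
    simp only [decide_eq_true_eq]
    rw [← Finset.card_filter]
    have : (Finset.univ.filter fun i => x.1.1 = i ∨ x.1.2 = i) = {x.1.1, x.1.2} := by
      ext i; simp [eq_comm]
    rw [this, Finset.card_pair hx]

end Vertex

/-! ### The induction over the edges. -/

namespace OddSetting

variable {ι : Type} [Fintype ι] [DecidableEq ι] {S : Type u}
  {Λ : Type v} [CommRing S] [Ring Λ] {φ : S →+* Λ} {V : AddSubgroup Λ}

theorem trace_eq_zero_of_untouched (h : OddSetting φ V) {J : Ideal S}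
    (hJ : ∀ x ∈ J, IsUnit (1 + x)) {A : Matrix ι ι S}
    (hA : ∀ i j, A i j - (1 : Matrix ι ι S) i j ∈ J) {e : ι → Λ} (he : ∀ i, e i ∈ V)
    {l : List ((ι × ι) × Λ)} (hl : ∀ x ∈ l, x.2 ∈ V) (hcard : Fintype.card ι = l.length + 1)
    (hl0 : 0 < l.length) (v : ι) (hv : ∀ x ∈ l, x.1.1 ≠ v ∧ x.1.2 ≠ v) :
    ((tens φ A⁻¹ 1 * edgeMat e l) ^ (2 * l.length + 1)).trace = 0 := by
  obtain ⟨A', b, c, d, d', hd, hblk, hmem⟩ := exists_fromBlocks hJ hA v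
  obtain ⟨l₀, rfl⟩ := exists_mapEdges v l hv
  have hlen : (mapEdges (splitVertex v) (inlList l₀)).length = l₀.length := by
    simp [mapEdges, inlList]
  rw [hlen] at hcard hl0
  rw [← trace_submatrix_pow (splitVertex v), hblk, edgeMat_mapEdges, hlen]
  refine h.trace_isolated A' b c d d' hd (isUnit_det_of_sub_one_mem hJ hmem) (fun i => he _) ?_ ?_
    hl0
  · intro x hx
    exact hl (Prod.map (splitVertex v) (splitVertex v) (inlPair x.1), x.2)
      (List.mem_map.2 ⟨(inlPair x.1, x.2), List.mem_map.2 ⟨x, hx, rfl⟩, rfl⟩)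
  · have := Fintype.card_congr (splitVertex v)
    rw [Fintype.card_sum, Fintype.card_unit, hcard] at this
    omega

theorem mul_pair_prod_eq_zero (h : OddSetting φ V) {f g : ι → Λ} (hf : ∀ i, f i ∈ V)
    (hg : ∀ i, g i ∈ V) {vs : List ι} {j : ι} (hj : j ∈ vs) (y : Λ) :
    f j * y * (vs.map fun i => f i * g i).prod = 0 := by
  have hcen (us : List ι) (x : Λ) : Commute (us.map fun i => f i * g i).prod x := by
    refine Commute.list_prod_left _ _ fun z hz => ?_
    obtain ⟨i, -, rfl⟩ := List.mem_map.1 hz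
    exact h.comm _ (hf i) _ (hg i) x
  rw [mul_assoc, ← (hcen vs y).eq, ← mul_assoc, h.pair_prod_perm hf hg (List.perm_cons_erase hj),
    List.map_cons, List.prod_cons, ← mul_assoc, ← mul_assoc, h.sq _ (hf j)]
  simp

theorem sum_bdry (l : List ((ι × ι) × Λ)) : ∑ i, bdry l i = 0 := by
  induction l with
  | nil => simp [bdry]
  | cons x l ih =>
    have hb (i : ι) : bdry (x :: l) i =
        ((if x.1.1 = i then x.2 else 0) - (if x.1.2 = i then x.2 else 0)) + bdry l i := by
      simp [bdry]
    simp only [hb, Finset.sum_add_distrib, Finset.sum_sub_distrib, ih]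
    simp

theorem bdry_eq_zero {l : List ((ι × ι) × Λ)} {v : ι} (hv : ∀ x ∈ l, x.1.1 ≠ v ∧ x.1.2 ≠ v) :
    bdry l v = 0 := by
  refine List.sum_eq_zero fun y hy => ?_
  obtain ⟨x, hx, rfl⟩ := List.mem_map.1 hy
  simp [hv x hx]

/-- If `v` is not the root, its own boundary factor is zero. If it is the root, the remaining
boundaries sum to zero, so one of them is a combination of the others, and each odd element squares
to zero. -/
theorem treeForm_eq_zero_of_untouched (h : OddSetting φ V) {e : ι → Λ} (he : ∀ i, e i ∈ V)
    {l : List ((ι × ι) × Λ)} (hl : ∀ x ∈ l, x.2 ∈ V) {r : ι} {vs : List ι}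
    (hnd : (r :: vs).Nodup) (hmem : ∀ i, i ∈ r :: vs) (hvs : vs ≠ []) (v : ι)
    (hv : ∀ x ∈ l, x.1.1 ≠ v ∧ x.1.2 ≠ v) : treeForm e l r vs = 0 := by
  have hb0 := bdry_eq_zero hv
  rcases List.mem_cons.1 (hmem v) with rfl | hvv
  · obtain ⟨w, us, rfl⟩ := List.exists_cons_of_ne_nil hvs
    have hsum : bdry l w = -(us.map (bdry l)).sum := by
      have h1 := sum_bdry l
      have h2 : (Finset.univ : Finset ι) = (v :: w :: us).toFinset := by
        ext i; simpa using hmem i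
      rw [h2, List.sum_toFinset _ hnd, List.map_cons, List.map_cons, List.sum_cons, List.sum_cons,
        hb0, zero_add] at h1
      exact eq_neg_of_add_eq_zero_left h1
    rw [treeForm, List.map_cons, List.prod_cons, hsum, neg_mul, neg_mul, mul_neg, neg_eq_zero]
    have : ∀ ts : List ι, ts ⊆ us →
        (ts.map (bdry l)).sum * e w * (us.map fun i => bdry l i * e i).prod = 0 := by
      intro ts hts
      induction ts with
      | nil => simp
      | cons t ts ih =>
        rw [List.map_cons, List.sum_cons, add_mul, add_mul, ih fun x hx => hts (by simp [hx]),
          h.mul_pair_prod_eq_zero (fun i => bdry_mem hl i) he (hts (by simp)), add_zero]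
    rw [this us (List.Subset.refl _), mul_zero]
  · rw [treeForm, List.prod_eq_zero, mul_zero]
    exact List.mem_map.2 ⟨v, hvv, by rw [hb0, zero_mul]⟩

/-- The trace formula for matrices which are close to the identity. -/
theorem traceFormula_of_near_one (m : ℕ) : ∀ {ι : Type} [Fintype ι] [DecidableEq ι] {S : Type u}
    {Λ : Type v} [CommRing S] [Ring Λ] {φ : S →+* Λ} {V : AddSubgroup Λ}, OddSetting φ V →
    ∀ {J : Ideal S}, (∀ x ∈ J, IsUnit (1 + x)) → ∀ {A : Matrix ι ι S},
    (∀ i j, A i j - (1 : Matrix ι ι S) i j ∈ J) → ∀ {e : ι → Λ}, (∀ i, e i ∈ V) →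
    ∀ {l : List ((ι × ι) × Λ)}, (∀ x ∈ l, x.2 ∈ V) → (∀ x ∈ l, x.1.1 ≠ x.1.2) → l.length = m →
    ∀ {r : ι} {vs : List ι}, (r :: vs).Nodup → (∀ i, i ∈ r :: vs) → vs.length = m →
    TraceFormula φ A e l r vs := by
  induction m with
  | zero =>
    intro ι _ _ S Λ _ _ φ V h J hJ A hA e he l hl hne hlm r vs hnd hmem hvm
    obtain rfl := List.length_eq_zero_iff.1 hlm
    obtain rfl := List.length_eq_zero_iff.1 hvm
    have hr (i : ι) : i = r := by simpa using hmem i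
    have hu : (Finset.univ : Finset ι) = {r} := by ext i; simp [hr i]
    have : Subsingleton ι := ⟨fun i j => (hr i).trans (hr j).symm⟩
    have hinv : A⁻¹ r r = Ring.inverse A.det := by
      rw [Matrix.inv_def, Matrix.smul_apply, Matrix.adjugate_subsingleton]
      simp
    have hdet : A.det = A r r := Matrix.det_eq_elem_of_subsingleton A r
    rw [hdet] at hinv
    simp [TraceFormula, treeForm, edgeCoeff, edgeMat, edgeSum, Matrix.trace, hu, Matrix.mul_apply,
      tens, hinv, hdet]
  | succ m IH =>
    intro ι _ _ S Λ _ _ φ V h J hJ A hA e he l hl hne hlm r vs hnd hmem hvm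
    have hcard : Fintype.card ι = l.length + 1 := by
      have h2 : (Finset.univ : Finset ι) = (r :: vs).toFinset := by
        ext i; simpa using hmem i
      rw [← Finset.card_univ, h2, List.toFinset_card_of_nodup hnd, List.length_cons, hvm, hlm]
    have hvs0 : vs ≠ [] := by rintro rfl; simp at hvm
    have huntouched (v : ι) (hv : ∀ x ∈ l, x.1.1 ≠ v ∧ x.1.2 ≠ v) : TraceFormula φ A e l r vs := by
      rw [TraceFormula, h.trace_eq_zero_of_untouched hJ hA he hl hcard (by omega) v hv,
        h.treeForm_eq_zero_of_untouched he hl hnd hmem hvs0 v hv, mul_zero]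
    have hzero (v : ι) (hv : l.countP (fun x => x.1.1 = v ∨ x.1.2 = v) = 0) :
        TraceFormula φ A e l r vs := by
      refine huntouched v fun x hx => ?_
      rw [List.countP_eq_zero] at hv
      simpa using hv x hx
    by_cases hr : l.countP (fun x => x.1.1 = r ∨ x.1.2 = r) = 0
    · exact hzero r hr
    -- The degrees add up to `2 * l.length`, there are `l.length` vertices besides the root, and the
    -- root has positive degree, so not all of the others can have degree at least two.
    obtain ⟨v, hvr, hv1⟩ : ∃ v, v ≠ r ∧ l.countP (fun x => x.1.1 = v ∨ x.1.2 = v) ≤ 1 := by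
      by_contra! hcon
      have h1 := sum_countP l hne
      rw [← Finset.add_sum_erase _ _ (Finset.mem_univ r)] at h1
      have h2 : ∑ _i ∈ Finset.univ.erase r, 2 ≤
          ∑ i ∈ Finset.univ.erase r, l.countP (fun x => x.1.1 = i ∨ x.1.2 = i) :=
        Finset.sum_le_sum fun i hi => hcon i (Finset.ne_of_mem_erase hi)
      rw [Finset.sum_const, Finset.card_erase_of_mem (Finset.mem_univ r), Finset.card_univ, hcard,
        smul_eq_mul] at h2
      omega
    rcases Nat.eq_zero_or_pos (l.countP (fun x => x.1.1 = v ∨ x.1.2 = v)) with hv0 | hvpos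
    · exact hzero v hv0
    obtain ⟨x, hxl, hxv⟩ := List.countP_pos_iff.1 hvpos
    obtain ⟨l1, l2, rfl⟩ := List.append_of_mem hxl
    have hperm : (l1 ++ x :: l2).Perm (x :: (l1 ++ l2)) := List.perm_middle
    have hrest : ∀ y ∈ l1 ++ l2, y.1.1 ≠ v ∧ y.1.2 ≠ v := by
      rw [hperm.countP_eq, List.countP_cons_of_pos (by simpa using hxv)] at hv1
      have h0 : (l1 ++ l2).countP (fun x => x.1.1 = v ∨ x.1.2 = v) = 0 := by omega
      rw [List.countP_eq_zero] at h0
      exact fun y hy => by simpa using h0 y hy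
    obtain ⟨l₀, hl₀⟩ := exists_mapEdges v (l1 ++ l2) hrest
    have hvvs : v ∈ vs := by
      rcases List.mem_cons.1 (hmem v) with h' | h'
      · exact absurd h' hvr
      · exact h'
    obtain ⟨w1, w2, rfl⟩ := List.append_of_mem hvvs
    have hvperm : (w1 ++ v :: w2).Perm (v :: (w1 ++ w2)) := List.perm_middle
    have hnd' : (v :: (w1 ++ w2)).Nodup := hvperm.nodup_iff.1 (List.nodup_cons.1 hnd).2
    obtain ⟨us, hus⟩ : ∃ us : List {i : ι // i ≠ v}, w1 ++ w2 = us.map fun i => i.1 := by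
      refine ⟨(w1 ++ w2).attachWith _ fun i hi => ?_, by simp⟩
      rintro rfl
      exact (List.nodup_cons.1 hnd').1 hi
    obtain ⟨A', b, c, d, d', hd, hblk, hmemJ⟩ := exists_fromBlocks hJ hA v
    have hlenl : l₀.length = m := by
      have := congrArg List.length hl₀
      simp only [mapEdges, inlList, List.length_map, List.length_append] at this
      simp only [List.length_append, List.length_cons] at hlm
      omega
    have hlenu : us.length = m := by
      have := congrArg List.length hus
      simp only [List.length_map, List.length_append] at this
      simp only [List.length_append, List.length_cons] at hvm
      omega
    have hmem₀ {y : ({i : ι // i ≠ v} × {i : ι // i ≠ v}) × Λ} (hy : y ∈ l₀) :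
        ((y.1.1.1, y.1.2.1), y.2) ∈ l1 ++ x :: l2 := by
      rw [hperm.mem_iff, hl₀]
      exact List.mem_cons_of_mem _
        (List.mem_map.2 ⟨(inlPair y.1, y.2), List.mem_map.2 ⟨y, hy, rfl⟩, rfl⟩)
    have hxne := hne x hxl
    obtain ⟨u, s, p, hxp, hp⟩ : ∃ (u : {i : ι // i ≠ v}) (s : S)
        (p : ({i : ι // i ≠ v} ⊕ Unit) × ({i : ι // i ≠ v} ⊕ Unit)),
        x = (Prod.map (splitVertex v) (splitVertex v) p, x.2) ∧
        ((p = (Sum.inl u, Sum.inr ()) ∧ s = 1) ∨ (p = (Sum.inr (), Sum.inl u) ∧ s = -1)) := by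
      obtain ⟨⟨x1, x2⟩, o⟩ := x
      simp only [decide_eq_true_eq] at hxv hxne
      rcases hxv with rfl | rfl
      · exact ⟨⟨x2, hxne.symm⟩, -1, _, rfl, Or.inr ⟨rfl, rfl⟩⟩
      · exact ⟨⟨x1, hxne⟩, 1, _, rfl, Or.inl ⟨rfl, rfl⟩⟩
    refine h.traceFormula_perm (isUnit_det_of_sub_one_mem hJ hA) he hl hperm hvperm ?_
    have e1 : x :: (l1 ++ l2) = mapEdges (splitVertex v) ((p, x.2) :: inlList l₀) := by
      rw [hl₀]
      conv_lhs => rw [hxp]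
      rfl
    have e2 : v :: (w1 ++ w2) = (Sum.inr () :: us.map Sum.inl).map (splitVertex v) := by
      rw [hus]; simp
    have e3 : r = splitVertex v (Sum.inl ⟨r, hvr.symm⟩) := rfl
    rw [e1, e2, e3]
    refine traceFormula_mapEdges _ ?_
    rw [hblk]
    have hcardκ : Fintype.card {i : ι // i ≠ v} = l₀.length + 1 := by
      have := Fintype.card_congr (splitVertex v)
      rw [Fintype.card_sum, Fintype.card_unit, hcard] at this
      omega
    refine h.traceFormula_leaf A' b c d d' hd (isUnit_det_of_sub_one_mem hJ hmemJ)
      (fun i => he _) (fun y hy => hl _ (hmem₀ hy)) hcardκ p (hl x hxl) u s hp _ _ fun H => ?_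
    -- The Schur complement is perturbed by an arbitrary `H`, so the induction hypothesis is needed
    -- over the dual numbers, where the preimage of `J` still has `1 + x` invertible.
    refine IH h.dual (J := J.comap (dualFst S)) ?_ ?_ ?_ ?_ ?_ ?_ ?_ ?_ hlenu
    · intro z hz
      rw [TrivSqZeroExt.isUnit_iff_isUnit_fst]
      simpa using hJ _ hz
    · intro i j
      rw [Ideal.mem_comap, map_sub]
      have : dualFst S ((1 : Matrix {i : ι // i ≠ v} {i : ι // i ≠ v} (DualNumber S)) i j) =
          (1 : Matrix {i : ι // i ≠ v} {i : ι // i ≠ v} S) i j := by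
        by_cases hij : i = j <;> simp [hij, Matrix.one_apply]
      rw [this, dualFst_apply, fst_pert]
      exact hmemJ i j
    · exact fun i => ⟨he _, V.zero_mem⟩
    · intro y hy
      obtain ⟨z, hz, rfl⟩ := List.mem_map.1 hy
      exact ⟨hl _ (hmem₀ hz), V.zero_mem⟩
    · intro y hy
      obtain ⟨z, hz, rfl⟩ := List.mem_map.1 hy
      exact fun h' => hne _ (hmem₀ hz) (congrArg Subtype.val h')
    · simpa [inlEdges] using hlenl
    · have hndr : (r :: v :: (w1 ++ w2)).Nodup := (hvperm.cons r).nodup_iff.1 hnd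
      have h3 : (r :: (w1 ++ w2)).Nodup := hndr.sublist (by simp)
      rw [hus] at h3
      have : (r :: us.map fun i => i.1) = ((⟨r, hvr.symm⟩ :: us : List {i : ι // i ≠ v}).map
        fun i => i.1) := by simp
      rw [this] at h3
      exact List.Nodup.of_map _ h3
    · intro i
      have h3 := hmem i.1
      rw [(hvperm.cons r).mem_iff, List.mem_cons, List.mem_cons, hus] at h3
      rcases h3 with h3 | h3 | h3
      · exact List.mem_cons.2 (Or.inl (Subtype.ext h3))
      · exact absurd h3 i.2
      · obtain ⟨j, hj, hji⟩ := List.mem_map.1 h3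
        rw [← Subtype.ext hji]
        exact List.mem_cons_of_mem _ hj

end OddSetting

/-! ### Traces of powers in the exterior algebra -/

section StdTrace

variable {ι : Type*} [Fintype ι] [DecidableEq ι] {S : Type*} [CommRing S]

/-- The odd elements of an exterior algebra: the elements of degree one. -/
def exteriorOdd (S M : Type*) [CommRing S] [AddCommGroup M] [Module S M] :
    AddSubgroup (ExteriorAlgebra S M) :=
  (LinearMap.range (ExteriorAlgebra.ι S : M →ₗ[S] _)).toAddSubgroup

theorem ι_mem_exteriorOdd {M : Type*} [AddCommGroup M] [Module S M] (v : M) :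
    ExteriorAlgebra.ι S v ∈ exteriorOdd S M := ⟨v, rfl⟩

theorem oddSetting_exterior {M : Type*} [AddCommGroup M] [Module S M]
    (hS : ∀ n : ℕ, n ≠ 0 → IsUnit (n : S)) :
    OddSetting (algebraMap S (ExteriorAlgebra S M)) (exteriorOdd S M) where
  natUnit := hS
  central s x := Algebra.commutes s x
  smul_mem s v hv := by
    obtain ⟨w, rfl⟩ := hv
    exact ⟨s • w, by rw [map_smul, Algebra.smul_def]⟩
  sq v hv := by
    obtain ⟨w, rfl⟩ := hv
    exact ExteriorAlgebra.ι_sq_zero w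
  comm v hv w hw x := by
    obtain ⟨a, rfl⟩ := hv
    obtain ⟨b, rfl⟩ := hw
    have hac (c d : M) : ExteriorAlgebra.ι S c * ExteriorAlgebra.ι S d =
        -(ExteriorAlgebra.ι S d * ExteriorAlgebra.ι S c) :=
      eq_neg_of_add_eq_zero_left (ExteriorAlgebra.ι_add_mul_swap c d)
    induction x using ExteriorAlgebra.induction with
    | algebraMap r => exact (Algebra.commutes r _).symm
    | ι c =>
      change _ = _
      rw [mul_assoc, hac b c, mul_neg, ← mul_assoc, hac a c, neg_mul, neg_neg, mul_assoc]
    | mul x y hx hy => exact hx.mul_right hy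
    | add x y hx hy => exact hx.add_right hy

theorem OddSetting.sum_tens_pow {Λ : Type*} [Ring Λ] {φ : S →+* Λ} {V : AddSubgroup Λ}
    (h : OddSetting φ V) {α : Type*} [Fintype α] (M : α → Matrix ι ι S) (θ : α → Λ) (r : ℕ) :
    (∑ a, tens φ (M a) (θ a)) ^ r = ∑ f : Fin r → α,
      tens φ (List.ofFn fun i => M (f i)).prod (List.ofFn fun i => θ (f i)).prod := by
  induction r with
  | zero =>
    ext i j
    by_cases hij : i = j <;> simp [tens, hij, Matrix.one_apply]
  | succ r ih =>
    rw [pow_succ', ih, Finset.sum_mul_sum, ← Fintype.sum_prod_type',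
      ← (Fin.consEquiv fun _ => α).sum_comp]
    refine Finset.sum_congr rfl fun x _ => ?_
    simp only [List.ofFn_succ, List.prod_cons, Fin.consEquiv_apply, Fin.cons_zero, Fin.cons_succ]
    rw [tens_mul h]

theorem OddSetting.trace_sum_tens_pow {Λ : Type*} [Ring Λ] {φ : S →+* Λ} {V : AddSubgroup Λ}
    (h : OddSetting φ V) {α : Type*} [Fintype α] (M : α → Matrix ι ι S) (θ : α → Λ) (r : ℕ) :
    ((∑ a, tens φ (M a) (θ a)) ^ r).trace = ∑ f : Fin r → α,
      φ (List.ofFn fun i => M (f i)).prod.trace * (List.ofFn fun i => θ (f i)).prod := by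
  rw [h.sum_tens_pow, Matrix.trace_sum]
  refine Finset.sum_congr rfl fun f _ => ?_
  simp [Matrix.trace, tens, Finset.sum_mul]

/-- The alternating sum of the traces of the products of the given matrices. -/
def stdTrace {r : ℕ} (M : Fin r → Matrix ι ι S) : S :=
  ∑ π : Equiv.Perm (Fin r), ((Equiv.Perm.sign π : ℤ) : S) *
    (List.ofFn fun i => M (π i)).prod.trace

theorem map_stdTrace {T : Type*} [CommRing T] (f : S →+* T) {r : ℕ} (M : Fin r → Matrix ι ι S) :
    f (stdTrace M) = stdTrace fun i => (M i).map f := by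
  have key (g : Fin r → Matrix ι ι S) :
      f (List.ofFn g).prod.trace = (List.ofFn fun i => (g i).map f).prod.trace := by
    have h1 : (List.ofFn fun i => (g i).map f) = (List.ofFn g).map f.mapMatrix := by
      rw [List.map_ofFn]; rfl
    rw [h1, ← map_list_prod]
    simp [Matrix.trace]
  simp only [stdTrace, map_sum, map_mul, map_intCast, key]

/-- Reordering the odd letters gives the sign of the permutation. -/
theorem sum_perm_ιMulti {M : Type*} [AddCommGroup M] [Module S M] {r : ℕ}
    (N : Fin r → Matrix ι ι S) (v : Fin r → M) :
    ∑ π : Equiv.Perm (Fin r), algebraMap S (ExteriorAlgebra S M)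
      (List.ofFn fun i => N (π i)).prod.trace *
        (List.ofFn fun i => ExteriorAlgebra.ι S (v (π i))).prod =
      algebraMap S _ (stdTrace N) * ExteriorAlgebra.ιMulti S r v := by
  rw [stdTrace, map_sum, Finset.sum_mul]
  refine Finset.sum_congr rfl fun π _ => ?_
  have h1 := (ExteriorAlgebra.ιMulti S r).map_perm v π
  rw [ExteriorAlgebra.ιMulti_apply] at h1
  have h2 : (List.ofFn fun i => ExteriorAlgebra.ι S (v (π i))).prod =
      Equiv.Perm.sign π • ExteriorAlgebra.ιMulti S r v := h1
  rw [h2, map_mul, map_intCast, Units.smul_def, zsmul_eq_mul, ← mul_assoc,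
    (Int.cast_commute _ _).eq]

/-- The exponent equals the number of letters, so a word without repetition is a permutation of all
of them. -/
theorem trace_sum_tens_pow_exterior {M : Type*} [AddCommGroup M] [Module S M]
    (hS : ∀ n : ℕ, n ≠ 0 → IsUnit (n : S)) {r : ℕ} (N : Fin r → Matrix ι ι S) (v : Fin r → M) :
    ((∑ a, tens (algebraMap S (ExteriorAlgebra S M)) (N a) (ExteriorAlgebra.ι S (v a))) ^ r).trace =
      algebraMap S _ (stdTrace N) * ExteriorAlgebra.ιMulti S r v := by
  rw [(oddSetting_exterior hS).trace_sum_tens_pow, ← sum_perm_ιMulti]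
  have hinj : Function.Injective fun (π : Equiv.Perm (Fin r)) => (π : Fin r → Fin r) :=
    DFunLike.coe_injective
  rw [← Finset.sum_image (g := fun (π : Equiv.Perm (Fin r)) => (π : Fin r → Fin r))
    (f := fun f : Fin r → Fin r => algebraMap S (ExteriorAlgebra S M)
      (List.ofFn fun i => N (f i)).prod.trace *
        (List.ofFn fun i => ExteriorAlgebra.ι S (v (f i))).prod) (fun a _ b _ hab => hinj hab)]
  symm
  refine Finset.sum_subset (Finset.subset_univ _) fun f _ hf => ?_
  have hf' : ¬ Function.Injective f := fun hi => hf <| Finset.mem_image.2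
    ⟨Equiv.ofBijective f (Finite.injective_iff_bijective.1 hi), Finset.mem_univ _, rfl⟩
  have : (List.ofFn fun i => ExteriorAlgebra.ι S (v (f i))).prod = 0 := by
    have h1 := ExteriorAlgebra.ιMulti_eq_zero_of_not_inj (R := S) (v := v ∘ f)
      fun hi => hf' hi.of_comp
    rwa [ExteriorAlgebra.ιMulti_apply] at h1
  rw [this, mul_zero]

/-- The determinant, extended to a linear functional on the exterior algebra, takes the value `1` on
the product of the standard basis vectors. Coefficients can therefore be compared. -/
theorem eq_zero_of_smul_ιMulti {r : ℕ} {s : S}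
    (hs : algebraMap S _ s * ExteriorAlgebra.ιMulti S r (fun i => Pi.single i (1 : S)) = 0) :
    s = 0 := by
  have h1 := congrArg (ExteriorAlgebra.liftAlternating (R := S) (M := Fin r → S) (N := S)
    (Function.update 0 r Matrix.detRowAlternating)) hs
  rw [← Algebra.smul_def, map_smul, ExteriorAlgebra.liftAlternating_apply_ιMulti,
    Function.update_self, map_zero] at h1
  have h2 : Matrix.detRowAlternating (fun i : Fin r => Pi.single i (1 : S)) = 1 := by
    have : (fun i : Fin r => Pi.single i (1 : S)) = (1 : Matrix (Fin r) (Fin r) S) := by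
      ext i j; simp [Matrix.one_apply, Pi.single_apply, eq_comm]
    rw [this]
    exact Matrix.det_one
  rwa [h2, smul_eq_mul, mul_one] at h1

/-- Both sides are alternating in the rows of `X`, so it suffices to compare them on permutations of
the standard basis. -/
theorem ιMulti_linearCombination {M : Type*} [AddCommGroup M] [Module S M] {r : ℕ} (v : Fin r → M)
    (X : Matrix (Fin r) (Fin r) S) :
    ExteriorAlgebra.ιMulti S r (fun c => ∑ a, X c a • v a) =
      X.det • ExteriorAlgebra.ιMulti S r v := by
  have h : ((ExteriorAlgebra.ιMulti S r).compLinearMap (Fintype.linearCombination S v) :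
      (Fin r → S) [⋀^Fin r]→ₗ[S] ExteriorAlgebra S M) =
      (LinearMap.toSpanSingleton S _ (ExteriorAlgebra.ιMulti S r v)).compAlternatingMap
        Matrix.detRowAlternating := by
    refine Module.Basis.ext_alternating (Pi.basisFun S (Fin r)) fun f hf => ?_
    obtain ⟨π, rfl⟩ : ∃ π : Equiv.Perm (Fin r), f = π :=
      ⟨Equiv.ofBijective f (Finite.injective_iff_bijective.1 hf), rfl⟩
    have h1 (g : (Fin r → S) [⋀^Fin r]→ₗ[S] ExteriorAlgebra S M) :
        g (fun i => Pi.basisFun S (Fin r) (π i)) =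
          Equiv.Perm.sign π • g (fun i => Pi.basisFun S (Fin r) i) :=
      g.map_perm (fun i => Pi.basisFun S (Fin r) i) π
    rw [h1, h1]
    congr 1
    have h2 : Matrix.detRowAlternating (fun i : Fin r => Pi.single i (1 : S)) = 1 := by
      have : (fun i : Fin r => Pi.single i (1 : S)) = (1 : Matrix (Fin r) (Fin r) S) := by
        ext i j; simp [Matrix.one_apply, Pi.single_apply, eq_comm]
      rw [this]
      exact Matrix.det_one
    simp [Fintype.linearCombination_apply, h2, Pi.single_apply]
  have key : ∀ x : Fin r → Fin r → S, ExteriorAlgebra.ιMulti S r (fun c => ∑ a, x c a • v a) =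
      Matrix.detRowAlternating x • ExteriorAlgebra.ιMulti S r v := fun x => by
    have := congrArg (fun g : (Fin r → S) [⋀^Fin r]→ₗ[S] ExteriorAlgebra S M => g x) h
    simpa [Fintype.linearCombination_apply] using this
  exact key X

theorem prod_eq_zero_of_lt {M : Type*} [AddCommGroup M] [Module S M] {m r : ℕ} (hmr : m < r)
    (v : Fin m → M) (x : Fin r → M) (hx : ∀ c, x c ∈ Submodule.span S (Set.range v)) :
    ExteriorAlgebra.ιMulti S r x = 0 := by
  have h : ((ExteriorAlgebra.ιMulti S r).compLinearMap (Fintype.linearCombination S v) :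
      (Fin m → S) [⋀^Fin r]→ₗ[S] ExteriorAlgebra S M) = 0 := by
    refine Module.Basis.ext_alternating (Pi.basisFun S (Fin m)) fun f hf => ?_
    have := Fintype.card_le_of_injective f hf
    simp at this
    omega
  have hx' : ∀ c, ∃ y : Fin m → S, Fintype.linearCombination S v y = x c := fun c => by
    have := hx c
    rwa [← Fintype.range_linearCombination, LinearMap.mem_range] at this
  choose y hy using hx'
  have := congrArg (fun g : (Fin m → S) [⋀^Fin r]→ₗ[S] ExteriorAlgebra S M => g y) h
  simpa [hy] using this

end StdTrace

/-! ### Passing to arbitrary invertible matrices -/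

theorem map_nonsing_inv {ι : Type*} [Fintype ι] [DecidableEq ι] {S T : Type*} [CommRing S]
    [CommRing T] (f : S →+* T) {A : Matrix ι ι S} (hA : IsUnit A.det) :
    (A.map f)⁻¹ = A⁻¹.map f := by
  refine Matrix.inv_eq_right_inv ?_
  rw [← Matrix.map_mul, Matrix.mul_nonsing_inv A hA]
  exact Matrix.map_one _ f.map_zero f.map_one

/-- An identity between natural functions of invertible matrices holds in general if it holds for
matrices which are close to the identity. -/
theorem eq_of_near_one {ι : Type*} [Fintype ι] [DecidableEq ι] {S : Type u} [CommRing S]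
    (hS : ∀ n : ℕ, n ≠ 0 → IsUnit (n : S))
    (F G : ∀ {T : Type u} [CommRing T], Matrix ι ι T → T)
    (hF : ∀ {T T' : Type u} [CommRing T] [CommRing T'] (f : T →+* T') {A : Matrix ι ι T},
      IsUnit A.det → F (A.map f) = f (F A))
    (hG : ∀ {T T' : Type u} [CommRing T] [CommRing T'] (f : T →+* T') {A : Matrix ι ι T},
      IsUnit A.det → G (A.map f) = f (G A))
    (hFG : ∀ {T : Type u} [CommRing T], (∀ n : ℕ, n ≠ 0 → IsUnit (n : T)) → ∀ {J : Ideal T},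
      (∀ x ∈ J, IsUnit (1 + x)) → ∀ {A : Matrix ι ι T},
      (∀ i j, A i j - (1 : Matrix ι ι T) i j ∈ J) → F A = G A)
    {A : Matrix ι ι S} (hA : IsUnit A.det) : F A = G A := by
  -- The line from the identity to `A`: at `X = 1` it gives `A`, while over power series it is close
  -- to the identity modulo `X`. Inverting its determinant gives a ring that maps to both.
  let B : Matrix ι ι (Polynomial S) := 1 + (Polynomial.X : Polynomial S) • (A - 1).map Polynomial.C
  let L := Localization.Away B.det
  have hBL : IsUnit (B.map (algebraMap (Polynomial S) L)).det := by
    have := IsLocalization.Away.algebraMap_isUnit (S := L) B.det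
    rwa [RingHom.map_det] at this
  have hev : B.map (Polynomial.evalRingHom (1 : S)) = A := by
    ext i j
    by_cases hij : i = j <;> simp [B, Matrix.one_apply, hij]
  have hev' : IsUnit (Polynomial.evalRingHom (1 : S) B.det) := by
    rw [RingHom.map_det, RingHom.mapMatrix_apply, hev]
    exact hA
  let ev : L →+* S := IsLocalization.Away.lift B.det hev'
  let c : Polynomial S →+* PowerSeries S := Polynomial.coeToPowerSeries.ringHom
  have hc (i j : ι) : B.map c i j - (1 : Matrix ι ι (PowerSeries S)) i j ∈
      Ideal.span {(PowerSeries.X : PowerSeries S)} := by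
    have : B.map c i j - (1 : Matrix ι ι (PowerSeries S)) i j =
        PowerSeries.X * c (Polynomial.C ((A - 1) i j)) := by
      by_cases hij : i = j <;>
        simp [B, c, Matrix.one_apply, hij, (PowerSeries.commute_X _).eq]
    rw [this]
    exact Ideal.mul_mem_right _ _ (Ideal.mem_span_singleton_self _)
  have hJ : ∀ x ∈ Ideal.span {(PowerSeries.X : PowerSeries S)}, IsUnit (1 + x) := by
    intro x hx
    obtain ⟨y, rfl⟩ := Ideal.mem_span_singleton.1 hx
    rw [PowerSeries.isUnit_iff_constantCoeff]
    simp
  have hdetc : IsUnit (c B.det) := by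
    rw [RingHom.map_det, RingHom.mapMatrix_apply]
    exact isUnit_det_of_sub_one_mem hJ hc
  let ps : L →+* PowerSeries S := IsLocalization.Away.lift B.det hdetc
  -- Polynomials embed into power series, and the denominators are units of the localisation. An
  -- identity over power series thus descends to it and can be evaluated at `X = 1`.
  have hps : Function.Injective ps := by
    rw [injective_iff_map_eq_zero]
    intro x hx
    obtain ⟨⟨p, s⟩, hp⟩ := IsLocalization.surj (Submonoid.powers B.det) x
    have h1 : c p = 0 := by
      have := congrArg ps hp
      rw [map_mul, hx, zero_mul, IsLocalization.Away.lift_eq] at this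
      exact this.symm
    have h2 : p = 0 := Polynomial.coe_injective S (by simpa [c] using h1)
    rw [h2, map_zero] at hp
    exact (IsLocalization.map_units L s).mul_left_eq_zero.1 hp
  have hBev : (B.map (algebraMap (Polynomial S) L)).map ev = A := by
    rw [← hev, Matrix.map_map]
    congr 1
    ext p
    exact IsLocalization.Away.lift_eq B.det hev' p
  have hBps : (B.map (algebraMap (Polynomial S) L)).map ps = B.map c := by
    rw [Matrix.map_map]
    congr 1
    ext1 p
    exact IsLocalization.Away.lift_eq B.det hdetc p
  have hNS (n : ℕ) (hn : n ≠ 0) : IsUnit (n : PowerSeries S) := by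
    simpa using (hS n hn).map (PowerSeries.C (R := S))
  have hFGL : F (B.map (algebraMap (Polynomial S) L)) = G (B.map (algebraMap (Polynomial S) L)) := by
    refine hps ?_
    rw [← hF ps hBL, ← hG ps hBL, hBps]
    exact hFG hNS hJ hc
  have := congrArg ev hFGL
  rwa [← hF ev hBL, ← hG ev hBL, hBev] at this

/-! ### The tree form and the form of a type -/

namespace OddSetting

variable {S Λ : Type*} [CommRing S] [Ring Λ] {φ : S →+* Λ} {V : AddSubgroup Λ}

theorem prod_mul_odd (h : OddSetting φ V) {l : List Λ} (hl : ∀ x ∈ l, x ∈ V) {z : Λ} (hz : z ∈ V) :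
    l.prod * z = (-1) ^ l.length * (z * l.prod) := by
  induction l with
  | nil => simp
  | cons x l ih =>
    rw [List.prod_cons, mul_assoc, ih fun y hy => hl y (by simp [hy]), List.length_cons, pow_succ,
      ← mul_assoc, (Commute.neg_one_right x).pow_right l.length |>.eq, mul_assoc, ← mul_assoc x,
      h.anticomm (hl x (by simp)) hz]
    simp [mul_assoc]

/-- The sign counts the odd elements which each `y` passes on its way to its partner. -/
theorem prod_mul_prod_pair (h : OddSetting φ V) {α : Type*} (l : List α) {x y : α → Λ}
    (hx : ∀ a, x a ∈ V) (hy : ∀ a, y a ∈ V) : (l.map x).prod * (l.map y).prod =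
      (-1) ^ l.length.choose 2 * (l.map fun a => x a * y a).prod := by
  induction l with
  | nil => simp
  | cons a l ih =>
    have hc (k : ℕ) (z : Λ) : Commute z ((-1) ^ k) := (Commute.neg_one_right z).pow_right k
    simp only [List.map_cons, List.prod_cons, List.length_cons]
    rw [mul_assoc, ← mul_assoc (List.map x l).prod, h.prod_mul_odd
      (fun z hz => by obtain ⟨b, -, rfl⟩ := List.mem_map.1 hz; exact hx b) (hy a), List.length_map,
      mul_assoc, mul_assoc, ih, ← mul_assoc (y a), (hc _ (y a)).eq, mul_assoc, ← mul_assoc (x a),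
      (hc _ (x a)).eq, mul_assoc, ← mul_assoc (x a), (hc _ (x a)).eq, mul_assoc, ← mul_assoc,
      ← pow_add, Nat.choose_succ_succ', Nat.choose_one_right, mul_assoc]

theorem prod_mul_prod_succ (h : OddSetting φ V) {m : ℕ} {x : Fin m → Λ} {y : Fin (m + 1) → Λ}
    (hx : ∀ a, x a ∈ V) (hy : ∀ a, y a ∈ V) : (List.ofFn x).prod * (List.ofFn y).prod =
      (-1) ^ (m + 1).choose 2 * (y 0 * (List.ofFn fun i => x i * y i.succ).prod) := by
  have hc (k : ℕ) (z : Λ) : Commute z ((-1) ^ k) := (Commute.neg_one_right z).pow_right k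
  rw [List.ofFn_succ (f := y), List.prod_cons, ← mul_assoc, h.prod_mul_odd
    (fun z hz => by obtain ⟨b, rfl⟩ := List.mem_ofFn.1 hz; exact hx b) (hy 0), List.length_ofFn,
    mul_assoc, mul_assoc]
  have := h.prod_mul_prod_pair (List.finRange m) hx (fun a => hy a.succ)
  rw [← List.ofFn_eq_map, ← List.ofFn_eq_map, ← List.ofFn_eq_map, List.length_finRange] at this
  rw [this, ← mul_assoc (y 0), (hc _ (y 0)).eq, mul_assoc, ← mul_assoc, ← pow_add,
    Nat.choose_succ_succ', Nat.choose_one_right]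

/-- Up to sign, the prefix can be carried past factors already treated, so an equality that holds
only behind the prefix may be used in every position. -/
theorem mul_prod_congr (h : OddSetting φ V) {α : Type*} (l : List α) {x y : α → Λ} {b : List Λ}
    (hb : ∀ z ∈ b, z ∈ V) (hy : ∀ a, y a ∈ V)
    (hxy : ∀ a, b.prod * x a = b.prod * y a) :
    b.prod * (l.map x).prod = b.prod * (l.map y).prod := by
  induction l with
  | nil => rfl
  | cons a l ih =>
    simp only [List.map_cons, List.prod_cons]
    rw [← mul_assoc, ← mul_assoc, hxy, h.prod_mul_odd hb (hy a), mul_assoc, mul_assoc, mul_assoc,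
      mul_assoc, ih]

end OddSetting

theorem lexEnum_injective {n m : ℕ} (ν : Finset (Fin n × Fin n)) (h : ν.card = m) :
    Function.Injective (lexEnum ν h) := fun a b hab =>
  (Finset.orderEmbOfFin _ _).injective (ofLex.injective hab)

theorem range_lexEnum {n m : ℕ} (ν : Finset (Fin n × Fin n)) (h : ν.card = m) :
    Set.range (lexEnum ν h) = ν := by
  have : lexEnum ν h = ofLex ∘ (ν.map toLex.toEmbedding).orderEmbOfFin
    ((Finset.card_map _).trans h) := rfl
  rw [this, Set.range_comp, Finset.range_orderEmbOfFin]
  ext q; simp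

theorem lexEnum_mem {n m : ℕ} (ν : Finset (Fin n × Fin n)) (h : ν.card = m) (r : Fin m) :
    lexEnum ν h r ∈ ν := by
  have : lexEnum ν h r ∈ (ν : Set (Fin n × Fin n)) := by
    rw [← range_lexEnum ν h]; exact ⟨r, rfl⟩
  exact this

theorem image_lexEnum {n m : ℕ} (ν : Finset (Fin n × Fin n)) (h : ν.card = m) :
    Finset.univ.image (lexEnum ν h) = ν := by
  rw [← Finset.coe_inj, Finset.coe_image, Finset.coe_univ, Set.image_univ, range_lexEnum]

theorem sum_lexEnum {N : Type*} [AddCommMonoid N] {n m : ℕ} (ν : Finset (Fin n × Fin n))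
    (h : ν.card = m) (f : Fin n × Fin n → N) : ∑ r, f (lexEnum ν h r) = ∑ q ∈ ν, f q := by
  conv_rhs => rw [← image_lexEnum ν h]
  rw [Finset.sum_image fun _ _ _ _ hab => lexEnum_injective ν h hab]

theorem disjoint_diagPairs {n : ℕ} (ℰ : OffDiag n) : Disjoint (diagPairs n) ℰ.1 := by
  rw [Finset.disjoint_left]
  intro q hq hq'
  have := ℰ.2.1 q hq'
  simp only [diagPairs, Finset.mem_filter, Finset.mem_univ, true_and] at hq
  exact absurd hq this.ne

theorem sum_diagPairs {N : Type*} [AddCommMonoid N] {n : ℕ} (f : Fin n × Fin n → N) :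
    ∑ q ∈ diagPairs n, f q = ∑ i, f (i, i) := by
  have : diagPairs n = Finset.univ.image fun i : Fin n => (i, i) := by
    ext ⟨a, b⟩
    simp [diagPairs]
  rw [this, Finset.sum_image fun _ _ _ _ hab => (Prod.ext_iff.1 hab).1]

/-- The pairs of `ℰ` with the corresponding values of a function. -/
def edgeList {n : ℕ} {Λ : Type*} (ℰ : OffDiag n) (θ : Fin n × Fin n → Λ) :
    List ((Fin n × Fin n) × Λ) :=
  List.ofFn fun k => (lexEnum ℰ.1 ℰ.2.2 k, θ (lexEnum ℰ.1 ℰ.2.2 k))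

theorem length_edgeList {n : ℕ} {Λ : Type*} (ℰ : OffDiag n) (θ : Fin n × Fin n → Λ) :
    (edgeList ℰ θ).length = n - 1 := by
  simp [edgeList]

theorem sum_edgeList {n : ℕ} {Λ N : Type*} [AddCommMonoid N] (ℰ : OffDiag n)
    (θ : Fin n × Fin n → Λ) (f : (Fin n × Fin n) → Λ → N) :
    ((edgeList ℰ θ).map fun x => f x.1 x.2).sum = ∑ q ∈ ℰ.1, f q (θ q) := by
  rw [edgeList, List.map_ofFn, List.sum_ofFn]
  exact sum_lexEnum ℰ.1 ℰ.2.2 fun q => f q (θ q)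

/-- The symmetric elementary matrix of a pair. -/
def letterMat (S : Type*) [CommRing S] {ι : Type*} [DecidableEq ι] (q : ι × ι) : Matrix ι ι S :=
  if q.1 = q.2 then Matrix.single q.1 q.1 1 else
    Matrix.single q.1 q.2 1 + Matrix.single q.2 q.1 1

theorem map_letterMat {S T : Type*} [CommRing S] [CommRing T] (f : S →+* T) {ι : Type*}
    [DecidableEq ι] (q : ι × ι) : (letterMat S q).map f = letterMat T q := by
  ext i j
  simp only [letterMat]
  split_ifs <;> simp [Matrix.single_apply, apply_ite f]

theorem tens_single {S Λ : Type*} [CommRing S] [Ring Λ] (φ : S →+* Λ) {ι : Type*} [DecidableEq ι]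
    (i j : ι) (x : Λ) : tens φ (Matrix.single i j 1) x = Matrix.single i j x := by
  ext a b
  simp only [tens_apply, Matrix.single_apply]
  split_ifs <;> simp

theorem edgeMat_edgeList {S Λ : Type*} [CommRing S] [Ring Λ] (φ : S →+* Λ) {n : ℕ} (ℰ : OffDiag n)
    (θ : Fin n × Fin n → Λ) : edgeMat (fun i => θ (i, i)) (edgeList ℰ θ) =
      ∑ r, tens φ (letterMat S (lexEnum (diagPairs n ∪ ℰ.1) (card_diag_union ℰ) r))
        (θ (lexEnum (diagPairs n ∪ ℰ.1) (card_diag_union ℰ) r)) := by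
  rw [sum_lexEnum _ _ fun q => tens φ (letterMat S q) (θ q),
    Finset.sum_union (disjoint_diagPairs ℰ), edgeMat, edgeSum,
    sum_edgeList ℰ θ fun q x => Matrix.single q.1 q.2 x + Matrix.single q.2 q.1 x]
  congr 1
  · rw [sum_diagPairs fun q => tens φ (letterMat S q) (θ q)]
    simp only [letterMat, if_true, tens_single]
    ext i j
    simp only [Matrix.sum_apply, Matrix.single_apply, Matrix.diagonal_apply]
    by_cases hij : i = j
    · subst hij; simp
    · rw [if_neg hij, Finset.sum_eq_zero]
      intro k _
      rw [if_neg]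
      rintro ⟨rfl, rfl⟩
      exact hij rfl
  · refine Finset.sum_congr rfl fun q hq => ?_
    rw [letterMat, if_neg (ℰ.2.1 q hq).ne, tens_add, tens_single, tens_single]

section OmegaType

variable {S : Type*} [CommRing S] {M : Type*} [AddCommGroup M] [Module S M]

/-- The determinant times the product of the letters is the product of the columns of `M_ν` read as
odd elements: `-R_i` for `i ≠ 0`, followed by all `C_j`, where `R_i` and `C_j` add up the letters in
row `i` and column `j`. Pairing `R_i` with `C_i` allows `R_i` to be replaced by `R_i - C_i`, the
boundary at `i`; behind all these boundaries `C_j` may be replaced by the diagonal letter. The sign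
`(-1) ^ (n choose 2)` undoes the reordering, and the `m` signs of the `-R_i` remain. -/
theorem omegaType_eq_treeForm (hS : ∀ n : ℕ, n ≠ 0 → IsUnit (n : S)) {m : ℕ} (ℰ : OffDiag (m + 1))
    (u : Fin (m + 1) × Fin (m + 1) → M) :
    omegaType (Matrix.of fun i j => ExteriorAlgebra.ι S (u (i, j))) (diagPairs (m + 1) ∪ ℰ.1)
      (card_diag_union ℰ) = (-1) ^ m * treeForm (fun i => ExteriorAlgebra.ι S (u (i, i)))
        (edgeList ℰ fun q => ExteriorAlgebra.ι S (u q)) 0 ((List.finRange m).map Fin.succ) := by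
  have h := oddSetting_exterior (M := M) hS
  set ν := lexEnum (diagPairs (m + 1) ∪ ℰ.1) (card_diag_union ℰ) with hν
  let R (i : Fin (m + 1)) : M := ∑ q ∈ diagPairs (m + 1) ∪ ℰ.1, if q.1 = i then u q else 0
  let C (i : Fin (m + 1)) : M := ∑ q ∈ diagPairs (m + 1) ∪ ℰ.1, if q.2 = i then u q else 0
  have hsplit (f : Fin (m + 1) × Fin (m + 1) → M) : ∑ q ∈ diagPairs (m + 1) ∪ ℰ.1, f q =
      ∑ i, f (i, i) + ∑ q ∈ ℰ.1, f q := by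
    rw [Finset.sum_union (disjoint_diagPairs ℰ), sum_diagPairs]
  have hR (i) : R i = u (i, i) + ∑ q ∈ ℰ.1, if q.1 = i then u q else 0 := by
    simp only [R, hsplit]; simp
  have hC (i) : C i = u (i, i) + ∑ q ∈ ℰ.1, if q.2 = i then u q else 0 := by
    simp only [C, hsplit]; simp
  let w (k : Fin (m + 1 - 1)) : M := u (lexEnum ℰ.1 ℰ.2.2 k)
  have hspan (p : Fin (m + 1) × Fin (m + 1) → Prop) [DecidablePred p] :
      ∑ q ∈ ℰ.1, (if p q then u q else 0) ∈ Submodule.span S (Set.range w) := by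
    refine Submodule.sum_mem _ fun q hq => ?_
    split_ifs
    · have hq' : q ∈ Set.range (lexEnum ℰ.1 ℰ.2.2) := by rw [range_lexEnum]; exact hq
      obtain ⟨k, rfl⟩ := hq'
      exact Submodule.subset_span ⟨k, rfl⟩
    · exact Submodule.zero_mem _
  have hb (i) : bdry (edgeList ℰ fun q => ExteriorAlgebra.ι S (u q)) i =
      ExteriorAlgebra.ι S (R i - C i) := by
    rw [bdry, sum_edgeList ℰ _ fun q x => (if q.1 = i then x else 0) - (if q.2 = i then x else 0),
      hR, hC, add_sub_add_left_eq_sub, ← Finset.sum_sub_distrib, map_sum]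
    refine Finset.sum_congr rfl fun q _ => ?_
    rw [map_sub]
    split_ifs <;> simp
  let D (i : Fin (m + 1)) : M := u (i, i)
  let b (i : Fin m) : M := R i.succ - C i.succ
  let ε : M → ExteriorAlgebra S M := ExteriorAlgebra.ι S
  have hε (x : M) : ε x ∈ exteriorOdd S M := ι_mem_exteriorOdd x
  have hbs (i) : b i ∈ Submodule.span S (Set.range w) := by
    simp only [b, hR, hC, add_sub_add_left_eq_sub]
    exact Submodule.sub_mem _ (hspan fun q => q.1 = i.succ) (hspan fun q => q.2 = i.succ)
  have hbV : ∀ z ∈ List.ofFn fun i => ε (b i), z ∈ exteriorOdd S M := fun z hz => by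
    obtain ⟨i, rfl⟩ := List.mem_ofFn.1 hz; exact hε _
  -- `C i - D i` and the `m` boundaries lie in the span of the `m` off-diagonal letters, so their
  -- product is zero.
  have hkill (i) : (List.ofFn fun i => ε (b i)).prod * ε (C i) =
      (List.ofFn fun i => ε (b i)).prod * ε (D i) := by
    have h1 : ε (C i - D i) * (List.ofFn fun i => ε (b i)).prod = 0 := by
      have := prod_eq_zero_of_lt (S := S) (m := m) (r := m + 1) (by omega) w
        (Fin.cons (C i - D i) b) (fun c => by
          refine Fin.cases ?_ (fun c => ?_) c
          · simp only [Fin.cons_zero, hC, D, add_sub_cancel_left]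
            exact hspan fun q => q.2 = i
          · exact hbs c)
      rw [ExteriorAlgebra.ιMulti_apply, List.ofFn_succ, List.prod_cons] at this
      simp only [Fin.cons_zero, Fin.cons_succ] at this
      exact this
    have h2 := h.prod_mul_odd hbV (hε (C i - D i))
    rw [h1, mul_zero] at h2
    have h3 : ε (C i - D i) = ε (C i) - ε (D i) := map_sub _ _ _
    rw [h3, mul_sub] at h2
    exact sub_eq_zero.1 h2
  have hmain : (List.ofFn fun i : Fin m => ε (-R i.succ)).prod * (List.ofFn fun j => ε (C j)).prod =
      (-1) ^ m * ((-1) ^ (m + 1).choose 2 * (ε (D 0) *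
        (List.ofFn fun i : Fin m => ε (b i) * ε (D i.succ)).prod)) := by
    rw [h.prod_mul_prod_succ (fun i => hε _) (fun i => hε _),
      ← h.prod_mul_prod_succ (x := fun i => ε (b i)) (y := fun i => ε (D i)) (fun i => hε _)
        (fun i => hε _)]
    -- Subtracting `C_i` from `R_i` is free next to `C_i`, whose square is zero.
    have h1 (i : Fin m) : ε (-R i.succ) * ε (C i.succ) = -1 * (ε (b i) * ε (C i.succ)) := by
      have h2 : ε (b i) = ε (R i.succ) - ε (C i.succ) := map_sub _ _ _
      have h3 : ε (-R i.succ) = - ε (R i.succ) := map_neg _ _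
      rw [h2, h3, sub_mul, h.sq _ (hε _)]
      simp
    have h4 (l : List (Fin m)) (f : Fin m → ExteriorAlgebra S M) :
        (l.map fun i => -1 * f i).prod = (-1) ^ l.length * (l.map f).prod := by
      induction l with
      | nil => simp
      | cons a l ih =>
        simp only [List.map_cons, List.prod_cons, ih, List.length_cons, pow_succ]
        rw [mul_assoc, ← mul_assoc (f a), ((Commute.neg_one_right (f a)).pow_right _).eq]
        simp [mul_assoc]
    simp only [h1]
    rw [List.ofFn_eq_map (f := fun i : Fin m => -1 * (ε (b i) * ε (C i.succ))), h4,
      List.length_finRange, ← List.ofFn_eq_map, ← mul_assoc (ε (C 0)),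
      ((Commute.neg_one_right (ε (C 0))).pow_right _).eq, mul_assoc, ← mul_assoc,
      ((Commute.neg_one_right _).pow_right m).eq, mul_assoc,
      ← h.prod_mul_prod_succ (x := fun i => ε (b i)) (y := fun i => ε (C i)) (fun i => hε _)
        (fun i => hε _)]
    congr 1
    have := h.mul_prod_congr (List.finRange (m + 1)) (x := fun i => ε (C i)) (y := fun i => ε (D i))
      hbV (fun i => hε _) hkill
    rwa [← List.ofFn_eq_map, ← List.ofFn_eq_map] at this
  have hprod : ((((incMatrix ν).submatrix id (Fin.succAbove 0)).det : ℤ) : ExteriorAlgebra S M) *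
      (List.ofFn fun r => ε (u (ν r))).prod =
      (List.ofFn fun i : Fin m => ε (-R i.succ)).prod * (List.ofFn fun j => ε (C j)).prod := by
    set X := (((incMatrix ν).submatrix id (Fin.succAbove 0)).map (Int.castRingHom S)).transpose
      with hX
    have h1 := ιMulti_linearCombination (fun r => u (ν r)) X
    have h2 : X.det = (((incMatrix ν).submatrix id (Fin.succAbove 0)).det : ℤ) := by
      rw [hX, Matrix.det_transpose, ← RingHom.mapMatrix_apply, ← RingHom.map_det]
      simp
    rw [h2, Algebra.smul_def, map_intCast, ExteriorAlgebra.ιMulti_apply,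
      ExteriorAlgebra.ιMulti_apply] at h1
    rw [← h1]
    have h3 (c) : ∑ a, X c a • u (ν a) = ∑ q ∈ diagPairs (m + 1) ∪ ℰ.1,
        ((if ((Fin.succAbove 0 c : Fin (2 * (m + 1) - 1 + 1)) : ℕ) = (q.1 : ℕ) then -1 else
          if ((Fin.succAbove 0 c : Fin (2 * (m + 1) - 1 + 1)) : ℕ) = (m + 1) + (q.2 : ℕ) then 1
          else 0 : ℤ) : S) • u q := by
      rw [← sum_lexEnum _ (card_diag_union ℰ)]
      rfl
    -- Without its first column, `M_ν` has `m` columns for the rows `1, …, m` and `m + 1` columns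
    -- for all column indices, counted from `0`.
    have h4 : (List.ofFn fun c => ε (∑ a, X c a • u (ν a))) =
        (List.ofFn fun i : Fin m => ε (-R i.succ)) ++ (List.ofFn fun j => ε (C j)) := by
      have hlen : 2 * (m + 1) - 1 = m + (m + 1) := by omega
      rw [List.ofFn_congr hlen, List.ofFn_add]
      congr 1
      · congr 1
        funext i
        rw [h3]
        simp only [R, ← Finset.sum_neg_distrib]
        congr 1
        refine Finset.sum_congr rfl fun q _ => ?_
        simp only [Fin.zero_succAbove, Fin.val_succ, Fin.val_cast, Fin.val_castAdd, Fin.ext_iff]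
        have := i.2
        have h6 : ¬ ((i : ℕ) + 1 = m + 1 + (q.2 : ℕ)) := by omega
        by_cases h5 : (i : ℕ) + 1 = (q.1 : ℕ)
        · simp [h5]
        · simp [h5, h6, Ne.symm h5]
      · congr 1
        funext i
        rw [h3]
        simp only [C]
        congr 1
        refine Finset.sum_congr rfl fun q _ => ?_
        simp only [Fin.zero_succAbove, Fin.val_succ, Fin.val_cast, Fin.val_natAdd, Fin.ext_iff]
        have := q.1.2
        have h6 : ¬ (m + (i : ℕ) + 1 = (q.1 : ℕ)) := by omega
        by_cases h5 : (q.2 : ℕ) = i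
        · have h7 : m + (i : ℕ) + 1 = m + 1 + (q.2 : ℕ) := by omega
          simp [h5, h6, h7]
          intro h8
          omega
        · have h7 : ¬ (m + (i : ℕ) + 1 = m + 1 + (q.2 : ℕ)) := by omega
          simp [h5, h6, h7]
    change (List.ofFn fun c => ε (∑ a, X c a • u (ν a))).prod = _
    rw [h4, List.prod_append]
  rw [omegaType, Int.cast_mul, Int.cast_pow, Int.cast_neg, Int.cast_one, mul_assoc]
  change _ * (_ * (List.ofFn fun r => ε (u (ν r))).prod) = _
  rw [hprod, hmain, ← mul_assoc, ((Commute.neg_one_left _).pow_left _).pow_right m |>.eq, mul_assoc,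
    ← mul_assoc ((-1) ^ (m + 1).choose 2), ← pow_add, Even.neg_one_pow ⟨_, rfl⟩, one_mul, treeForm,
    List.map_map]
  simp only [Function.comp_def, hb]
  rw [← List.ofFn_eq_map]

/-- The integer coefficient in the form of a type. -/
def typeSign {n : ℕ} (ν : Finset (Fin n × Fin n)) (h : ν.card = 2 * n - 1) : ℤ :=
  (-1) ^ n.choose 2 * ((incMatrix (lexEnum ν h)).submatrix id (Fin.succAbove 0)).det

end OmegaType

/-- The coefficient of the product of all diagonal letters and the letters in `ℰ` in the trace. -/
theorem stdTrace_letters {S : Type u} [CommRing S] (hS : ∀ n : ℕ, n ≠ 0 → IsUnit (n : S)) {m : ℕ}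
    (ℰ : OffDiag (m + 1)) {A : Matrix (Fin (m + 1)) (Fin (m + 1)) S} (hA : IsUnit A.det) :
    (stdTrace fun r => A⁻¹ *
      letterMat S (lexEnum (diagPairs (m + 1) ∪ ℰ.1) (card_diag_union ℰ) r)) =
      ((2 * m + 1 : ℕ) : S) * edgeCoeff (List.ofFn (lexEnum ℰ.1 ℰ.2.2)) A *
        ((-1) ^ m * (typeSign (diagPairs (m + 1) ∪ ℰ.1) (card_diag_union ℰ) : S)) := by
  set ν := lexEnum (diagPairs (m + 1) ∪ ℰ.1) (card_diag_union ℰ) with hν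
  -- Naturality requires a scalar identity, so the trace formula is rephrased by means of `stdTrace`
  -- before being transferred.
  refine eq_of_near_one hS
    (fun {T} _ A => stdTrace fun r => A⁻¹ * letterMat T (ν r))
    (fun {T} _ A => ((2 * m + 1 : ℕ) : T) * edgeCoeff (List.ofFn (lexEnum ℰ.1 ℰ.2.2)) A *
        ((-1) ^ m * (typeSign (diagPairs (m + 1) ∪ ℰ.1) (card_diag_union ℰ) : T))) ?_ ?_ ?_ hA
  · intro T T' _ _ f A hA
    simp only [map_stdTrace, Matrix.map_mul, map_letterMat, map_nonsing_inv f hA]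
  · intro T T' _ _ f A hA
    simp only [edgeCoeff_map _ f hA, map_mul, map_natCast, map_pow, map_neg, map_one, map_intCast]
  · intro T _ hT J hJ A hA
    -- The generic letters: one basis vector for each pair of the type and zero for the others. The
    -- coefficient of the product of all basis vectors is then determined.
    let u (q : Fin (m + 1) × Fin (m + 1)) : Fin (2 * (m + 1) - 1) → T :=
      ∑ a, if ν a = q then Pi.single a 1 else 0
    have hu (a) : u (ν a) = Pi.single a 1 := by
      simp only [u]
      rw [Finset.sum_eq_single a, if_pos rfl]
      · intro b _ hb
        rw [if_neg]
        exact fun hab => hb (lexEnum_injective _ _ hab)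
      · simp
    let φ := algebraMap T (ExteriorAlgebra T (Fin (2 * (m + 1) - 1) → T))
    have h := oddSetting_exterior (M := Fin (2 * (m + 1) - 1) → T) hT
    let θ (q : Fin (m + 1) × Fin (m + 1)) := ExteriorAlgebra.ι T (u q)
    have h1 : TraceFormula φ A (fun i => θ (i, i)) (edgeList ℰ θ) 0
        ((List.finRange m).map Fin.succ) := by
      refine h.traceFormula_of_near_one m hJ hA (fun i => ι_mem_exteriorOdd _) ?_ ?_
        (length_edgeList _ _) ?_ ?_ (by simp)
      · intro x hx
        obtain ⟨k, rfl⟩ := List.mem_ofFn.1 hx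
        exact ι_mem_exteriorOdd _
      · intro x hx
        obtain ⟨k, rfl⟩ := List.mem_ofFn.1 hx
        exact (ℰ.2.1 _ (lexEnum_mem ℰ.1 ℰ.2.2 k)).ne
      · rw [← List.finRange_succ]
        exact List.nodup_finRange _
      · rw [← List.finRange_succ]
        exact List.mem_finRange
    have hlen : 2 * (edgeList ℰ θ).length + 1 = 2 * (m + 1) - 1 := by
      rw [length_edgeList]; omega
    have hfst : (edgeList ℰ θ).map Prod.fst = List.ofFn (lexEnum ℰ.1 ℰ.2.2) := by
      rw [edgeList, List.map_ofFn]; rfl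
    have h2 := omegaType_eq_treeForm hT ℰ u
    have h3 : treeForm (fun i => θ (i, i)) (edgeList ℰ θ) 0 ((List.finRange m).map Fin.succ) =
        φ ((-1) ^ m * (typeSign (diagPairs (m + 1) ∪ ℰ.1) (card_diag_union ℰ) : T)) *
          ExteriorAlgebra.ιMulti T _ (fun i => Pi.single i (1 : T)) := by
      have h4 : omegaType (Matrix.of fun i j => ExteriorAlgebra.ι T (u (i, j)))
          (diagPairs (m + 1) ∪ ℰ.1) (card_diag_union ℰ) =
          φ (typeSign (diagPairs (m + 1) ∪ ℰ.1) (card_diag_union ℰ) : T) *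
          ExteriorAlgebra.ιMulti T _ (fun i => Pi.single i (1 : T)) := by
        rw [omegaType, ExteriorAlgebra.ιMulti_apply, map_intCast]
        simp only [Matrix.of_apply, ← hu]
        rfl
      rw [h4] at h2
      rw [map_mul, map_pow, map_neg, map_one, mul_assoc, h2, ← mul_assoc, ← pow_add,
        Even.neg_one_pow ⟨m, rfl⟩, one_mul]
    rw [TraceFormula, hlen, hfst, edgeMat_edgeList φ, Finset.mul_sum] at h1
    have h5 (r) : tens (algebraMap T (ExteriorAlgebra T (Fin (2 * (m + 1) - 1) → T))) A⁻¹ 1 *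
        tens φ (letterMat T (ν r)) (θ (ν r)) = tens φ (A⁻¹ * letterMat T (ν r)) (θ (ν r)) := by
      rw [tens_mul h, one_mul]
    rw [Finset.sum_congr rfl fun r _ => h5 r] at h1
    rw [trace_sum_tens_pow_exterior hT (fun r => A⁻¹ * letterMat T (ν r)) (fun r => u (ν r)), h3]
      at h1
    simp only [hu] at h1
    refine sub_eq_zero.1 (eq_zero_of_smul_ιMulti (r := 2 * (m + 1) - 1) ?_)
    have h6 : algebraMap T (ExteriorAlgebra T (Fin (2 * (m + 1) - 1) → T))
        (((2 * m + 1 : ℕ) : T) * edgeCoeff (List.ofFn (lexEnum ℰ.1 ℰ.2.2)) A *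
        ((-1) ^ m * (typeSign (diagPairs (m + 1) ∪ ℰ.1) (card_diag_union ℰ) : T))) =
        ((2 * (m + 1) - 1 : ℕ) : ExteriorAlgebra T (Fin (2 * (m + 1) - 1) → T)) *
        φ (edgeCoeff (List.ofFn (lexEnum ℰ.1 ℰ.2.2)) A) *
        φ ((-1) ^ m * (typeSign (diagPairs (m + 1) ∪ ℰ.1) (card_diag_union ℰ) : T)) := by
      rw [map_mul, map_mul, map_natCast]; rfl
    rw [map_sub, sub_mul, h1, h6, mul_assoc (_ * _), sub_self]

/-! ### Complementary minors -/

section Minors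

variable {S : Type*} [CommRing S]

theorem delDet_eq {n N : ℕ} (A : Matrix (Fin n) (Fin n) S) {I J : Finset (Fin n)}
    {f g : Fin N → Fin n} (hf : StrictMono f) (hg : StrictMono g)
    (hI : Finset.univ.image f = Iᶜ) (hJ : Finset.univ.image g = Jᶜ) :
    delDet A I J = (A.submatrix f g).det := by
  have h1 : Iᶜ.card = N := by
    rw [← hI, Finset.card_image_of_injective _ hf.injective, Finset.card_univ, Fintype.card_fin]
  have h2 : Jᶜ.card = Iᶜ.card := by
    rw [h1, ← hJ, Finset.card_image_of_injective _ hg.injective, Finset.card_univ, Fintype.card_fin]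
  subst h1
  have hf' := Finset.orderEmbOfFin_unique (s := Iᶜ) rfl (f := f)
    (fun x => by rw [← hI]; exact Finset.mem_image_of_mem _ (Finset.mem_univ _)) hf
  have hg' := Finset.orderEmbOfFin_unique (s := Jᶜ) h2 (f := g)
    (fun x => by rw [← hJ]; exact Finset.mem_image_of_mem _ (Finset.mem_univ _)) hg
  rw [delDet, dif_pos h2, ← hf', ← hg']

theorem image_univ_eq_compl {n N r : ℕ} {p : Fin (n + 1)} {s : Fin r → Fin n} {w : Fin (r + 1) → Fin (n + 1)}
    (hlast : w (Fin.last r) = p) (hs : ∀ k, p.succAbove (s k) = w k.castSucc) {f : Fin N → Fin n}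
    (hf : Finset.univ.image f = (Finset.univ.image s)ᶜ) :
    Finset.univ.image (p.succAbove ∘ f) = (Finset.univ.image w)ᶜ := by
  ext i
  simp only [Finset.mem_image, Finset.mem_univ, true_and, Function.comp_apply, Finset.mem_compl,
    not_exists]
  constructor
  · rintro ⟨a, rfl⟩ k
    refine Fin.lastCases ?_ (fun k => ?_) k
    · rw [hlast]; exact (Fin.succAbove_ne p _).symm
    · rw [← hs]
      intro h
      have h1 : f a ∈ (Finset.univ.image s)ᶜ := hf ▸ Finset.mem_image_of_mem _ (Finset.mem_univ _)
      rw [Finset.mem_compl] at h1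
      exact h1 (Finset.mem_image.2 ⟨k, Finset.mem_univ _, Fin.succAbove_right_injective h⟩)
  · intro h
    obtain ⟨j, rfl⟩ := Fin.exists_succAbove_eq (x := i) (y := p)
      (fun hi => h (Fin.last r) (hlast.trans hi.symm))
    have h1 : j ∈ (Finset.univ.image s)ᶜ := by
      rw [Finset.mem_compl]
      intro hj
      obtain ⟨k, -, rfl⟩ := Finset.mem_image.1 hj
      exact h k.castSucc (hs k).symm
    rw [← hf] at h1
    obtain ⟨a, -, rfl⟩ := Finset.mem_image.1 h1
    exact ⟨a, rfl⟩

theorem exists_strictMono_compl {n : ℕ} (I : Finset (Fin n)) {N : ℕ} (h : Iᶜ.card = N) :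
    ∃ f : Fin N → Fin n, StrictMono f ∧ Finset.univ.image f = Iᶜ :=
  ⟨Iᶜ.orderEmbOfFin h, (Iᶜ.orderEmbOfFin h).strictMono, by
    rw [← Finset.coe_inj, Finset.coe_image, Finset.coe_univ, Set.image_univ,
      Finset.range_orderEmbOfFin]⟩

/-- The matrix `A` with the rows `v k` replaced by the unit vectors number `v' k`. -/
def replaceRows {n r : ℕ} (A : Matrix (Fin n) (Fin n) S) (v v' : Fin r → Fin n) :
    Matrix (Fin n) (Fin n) S :=
  Matrix.of (Function.extend v (fun k => Pi.single (v' k) 1) fun i j => A i j)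

theorem replaceRows_apply {n r : ℕ} (A : Matrix (Fin n) (Fin n) S) {v : Fin r → Fin n}
    (hv : Function.Injective v) (v' : Fin r → Fin n) (k : Fin r) (j : Fin n) :
    replaceRows A v v' (v k) j = (Pi.single (v' k) 1 : Fin n → S) j :=
  congrFun (hv.extend_apply (fun k => (Pi.single (v' k) 1 : Fin n → S)) (fun i j => A i j) k) j

theorem replaceRows_of_notMem {n r : ℕ} (A : Matrix (Fin n) (Fin n) S) (v v' : Fin r → Fin n)
    {i : Fin n} (hi : ¬ ∃ k, v k = i) (j : Fin n) : replaceRows A v v' i j = A i j :=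
  congrFun (Function.extend_apply' (fun k => (Pi.single (v' k) 1 : Fin n → S))
    (fun i j => A i j) i hi) j

/-- Laplace expansion along the last replaced row. All other selected indices are smaller than the
deleted one, so they keep their numerical values in the smaller matrix and the exponents of the
signs simply add. -/
theorem det_replaceRows {r : ℕ} : ∀ {n : ℕ} (A : Matrix (Fin n) (Fin n) S) {v v' : Fin r → Fin n},
    StrictMono v → StrictMono v' → (replaceRows A v v').det =
      (-1) ^ (∑ k, (v k : ℕ) + ∑ k, (v' k : ℕ)) *
        delDet A (Finset.univ.image v) (Finset.univ.image v') := by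
  induction r with
  | zero =>
    intro n A v v' _ _
    have h1 : replaceRows A v v' = A := by
      ext i j
      exact replaceRows_of_notMem A v v' (fun h => h.choose.elim0) j
    rw [h1, delDet_eq A (f := id) (g := id) strictMono_id strictMono_id (by simp) (by simp)]
    simp
  | succ r ih =>
    intro n A v v' hv hv'
    cases n with
    | zero => exact (v 0).elim0
    | succ n =>
      have hex : ∀ {w : Fin (r + 1) → Fin (n + 1)}, StrictMono w →
          ∃ s : Fin r → Fin n, StrictMono s ∧
            (∀ k, (w (Fin.last r)).succAbove (s k) = w k.castSucc) ∧
            ∀ k, (s k : ℕ) = w k.castSucc := by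
        intro w hw
        have hlt (k : Fin r) : w k.castSucc < w (Fin.last r) := hw (Fin.castSucc_lt_last k)
        have hlt' (k : Fin r) : (w k.castSucc : ℕ) < n :=
          lt_of_lt_of_le (hlt k) (Nat.lt_succ_iff.1 (w (Fin.last r)).2)
        refine ⟨fun k => (w k.castSucc).castLT (hlt' k), ?_, ?_, fun k => rfl⟩
        · intro a b hab
          exact hw (Fin.castSucc_lt_castSucc_iff.2 hab)
        · intro k
          rw [Fin.succAbove_of_castSucc_lt]
          · rfl
          · exact hlt k
      obtain ⟨s, hs, hsv, hsn⟩ := hex hv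
      obtain ⟨s', hs', hsv', hsn'⟩ := hex hv'
      set p := v (Fin.last r) with hp
      set p' := v' (Fin.last r) with hp'
      have hrow (j) : replaceRows A v v' p j = (Pi.single p' 1 : Fin (n + 1) → S) j :=
        replaceRows_apply A hv.injective v' _ j
      have hsub : (replaceRows A v v').submatrix p.succAbove p'.succAbove =
          replaceRows (A.submatrix p.succAbove p'.succAbove) s s' := by
        ext i j
        rw [Matrix.submatrix_apply]
        by_cases hi : ∃ k, s k = i
        · obtain ⟨k, rfl⟩ := hi
          rw [replaceRows_apply _ hs.injective, hsv k, replaceRows_apply _ hv.injective, ← hsv' k]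
          by_cases hj : j = s' k
          · subst hj; simp
          · rw [Pi.single_eq_of_ne hj, Pi.single_eq_of_ne]
            exact fun h => hj (Fin.succAbove_right_injective h)
        · rw [replaceRows_of_notMem _ _ _ hi, replaceRows_of_notMem]
          · rfl
          · rintro ⟨k, hk⟩
            revert hk
            refine Fin.lastCases ?_ (fun k => ?_) k
            · exact fun hk => Fin.succAbove_ne p i hk.symm
            · intro hk
              rw [← hsv k] at hk
              exact hi ⟨k, Fin.succAbove_right_injective hk⟩
      have hcard {w : Fin r → Fin n} (hw : StrictMono w) : (Finset.univ.image w)ᶜ.card = n - r := by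
        rw [Finset.card_compl, Finset.card_image_of_injective _ hw.injective]
        simp
      obtain ⟨f, hf, hfi⟩ := exists_strictMono_compl (Finset.univ.image s) (hcard hs)
      obtain ⟨g, hg, hgi⟩ := exists_strictMono_compl (Finset.univ.image s') (hcard hs')
      have hdel : delDet A (Finset.univ.image v) (Finset.univ.image v') =
          delDet (A.submatrix p.succAbove p'.succAbove) (Finset.univ.image s)
            (Finset.univ.image s') := by
        rw [delDet_eq _ hf hg hfi hgi, delDet_eq A (f := p.succAbove ∘ f) (g := p'.succAbove ∘ g)
          ((Fin.strictMono_succAbove p).comp hf) ((Fin.strictMono_succAbove p').comp hg)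
          (image_univ_eq_compl rfl hsv hfi) (image_univ_eq_compl rfl hsv' hgi),
          Matrix.submatrix_submatrix]
      rw [Matrix.det_succ_row _ p, Finset.sum_eq_single p', hrow, Pi.single_eq_same, mul_one, hsub,
        ih _ hs hs', ← hdel, ← mul_assoc, ← pow_add]
      · congr 2
        rw [Fin.sum_univ_castSucc, Fin.sum_univ_castSucc (f := fun k => (v' k : ℕ))]
        simp only [hsn, hsn']
        rw [← hp, ← hp']
        ring
      · intro j _ hj
        rw [hrow, Pi.single_eq_of_ne hj]
        simp
      · simp

end Minors

/-! ### Sums of elements of square zero -/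

/-- In the multinomial expansion only words with distinct letters survive, and each set of letters
occurs in all its orders. -/
theorem sum_pow_eq_factorial_mul {Z α : Type*} [CommRing Z] [DecidableEq α] (z : α → Z)
    (hz : ∀ a, z a * z a = 0) (s : Finset α) (N : ℕ) :
    (∑ a ∈ s, z a) ^ N = (N.factorial : Z) * ∑ P ∈ s.powersetCard N, ∏ a ∈ P, z a := by
  induction s using Finset.induction_on generalizing N with
  | empty =>
    cases N with
    | zero => simp
    | succ N => rw [Finset.powersetCard_eq_empty.2 (by simp)]; simp
  | insert a s ha ih =>
    cases N with
    | zero => simp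
    | succ N =>
      have hsq (y : Z) : ∀ k : ℕ, (z a + y) ^ (k + 1) = y ^ (k + 1) + ((k + 1 : ℕ) : Z) * z a * y ^ k := by
        intro k
        induction k with
        | zero => simp [add_comm]
        | succ k ihk =>
          rw [pow_succ, ihk]
          push_cast
          linear_combination ((k : Z) + 1) * y ^ k * hz a
      rw [Finset.sum_insert ha, hsq, ih, ih, Finset.powersetCard_succ_insert ha,
        Finset.sum_union, Finset.sum_image, mul_add]
      · congr 1
        have h2 : ∑ P ∈ s.powersetCard N, ∏ b ∈ insert a P, z b =
            z a * ∑ P ∈ s.powersetCard N, ∏ b ∈ P, z b := by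
          rw [Finset.mul_sum]
          refine Finset.sum_congr rfl fun P hP => ?_
          rw [Finset.prod_insert fun h => ha ((Finset.mem_powersetCard.1 hP).1 h)]
        rw [h2, Nat.factorial_succ]
        push_cast
        ring
      · intro P hP Q hQ hPQ
        have hP' : a ∉ P := fun h => ha ((Finset.mem_powersetCard.1 hP).1 h)
        have hQ' : a ∉ Q := fun h => ha ((Finset.mem_powersetCard.1 hQ).1 h)
        rw [← Finset.erase_insert hP', ← Finset.erase_insert hQ', hPQ]
      · rw [Finset.disjoint_left]
        intro P hP hP'
        obtain ⟨Q, -, rfl⟩ := Finset.mem_image.1 hP'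
        exact ha ((Finset.mem_powersetCard.1 hP).1 (Finset.mem_insert_self _ _))

theorem sum_sum_pow_eq {Z α β γ : Type*} [CommRing Z] [Fintype α] [Fintype β] [Fintype γ]
    [DecidableEq α] [DecidableEq β] [DecidableEq γ] (x : α → Z) (y : β → Z) (z : γ → Z)
    (hx : ∀ a, x a * x a = 0) (hy : ∀ a, y a * y a = 0) (hz : ∀ a, z a * z a = 0) (N : ℕ) :
    (∑ a, x a + ∑ a, y a + ∑ a, z a) ^ N = (N.factorial : Z) *
      ∑ I : Finset β, ∑ J : Finset γ, ∑ P : Finset α, if P.card + I.card + J.card = N then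
        (∏ a ∈ P, x a) * (∏ a ∈ I, y a) * ∏ a ∈ J, z a else 0 := by
  have h := sum_pow_eq_factorial_mul (Sum.elim (Sum.elim y z) x)
    (by rintro ((a | a) | a) <;> simp [hx, hy, hz]) Finset.univ N
  have h1 : ∑ a, Sum.elim (Sum.elim y z) x a = ∑ a, x a + ∑ a, y a + ∑ a, z a := by
    rw [Fintype.sum_sum_type, Fintype.sum_sum_type]
    simp only [Sum.elim_inl, Sum.elim_inr]
    ring
  rw [h1] at h
  rw [h]
  congr 1
  rw [Finset.powersetCard_eq_filter, Finset.powerset_univ]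
  rw [Finset.sum_filter, ← Finset.sumEquiv.symm.toEquiv.sum_comp, Fintype.sum_prod_type,
    ← Finset.sumEquiv.symm.toEquiv.sum_comp, Fintype.sum_prod_type]
  refine Finset.sum_congr rfl fun I _ => Finset.sum_congr rfl fun J _ =>
    Finset.sum_congr rfl fun P _ => ?_
  simp only [OrderIso.coe_toEquiv, Finset.sumEquiv_symm_apply, Finset.card_disjSum,
    Finset.prod_disjSum, Sum.elim_inl, Sum.elim_inr]
  have : I.card + J.card + P.card = P.card + I.card + J.card := by ring
  rw [this]
  congr 1
  ring

/-! ### Even elements of an exterior algebra -/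

section Even

variable {T : Type*} [CommRing T] {M : Type*} [AddCommGroup M] [Module T M]

theorem ι_mul_ι_mem_center (v w : M) : ExteriorAlgebra.ι T v * ExteriorAlgebra.ι T w ∈
    Subalgebra.center T (ExteriorAlgebra T M) := by
  rw [Subalgebra.mem_center_iff]
  intro x
  have hac (c d : M) : ExteriorAlgebra.ι T c * ExteriorAlgebra.ι T d =
      -(ExteriorAlgebra.ι T d * ExteriorAlgebra.ι T c) :=
    eq_neg_of_add_eq_zero_left (ExteriorAlgebra.ι_add_mul_swap c d)
  induction x using ExteriorAlgebra.induction with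
  | algebraMap r => exact Algebra.commutes r _
  | ι c => rw [mul_assoc, hac w c, mul_neg, ← mul_assoc, ← mul_assoc, hac v c, neg_mul, neg_neg]
  | mul x y hx hy => rw [mul_assoc, hy, ← mul_assoc, hx, mul_assoc]
  | add x y hx hy => rw [add_mul, mul_add, hx, hy]

/-- The product of two elements of degree one, as an element of the center. -/
def pairing (v w : M) : Subalgebra.center T (ExteriorAlgebra T M) :=
  ⟨ExteriorAlgebra.ι T v * ExteriorAlgebra.ι T w, ι_mul_ι_mem_center v w⟩

theorem coe_pairing (v w : M) : (pairing (T := T) v w : ExteriorAlgebra T M) =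
    ExteriorAlgebra.ι T v * ExteriorAlgebra.ι T w := rfl

theorem pairing_add_left (v v' w : M) :
    pairing (T := T) (v + v') w = pairing v w + pairing v' w := by
  ext; simp [pairing, add_mul]

theorem pairing_add_right (v w w' : M) :
    pairing (T := T) v (w + w') = pairing v w + pairing v w' := by
  ext; simp [pairing, mul_add]

theorem pairing_neg_left (v w : M) : pairing (T := T) (-v) w = -pairing v w := by
  ext; simp [pairing]

theorem pairing_smul_right (s : T) (v w : M) : pairing v (s • w) = s • pairing (T := T) v w := by
  ext; simp [pairing]

theorem pairing_sum_right {α : Type*} (s : Finset α) (v : M) (w : α → M) :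
    pairing (T := T) v (∑ a ∈ s, w a) = ∑ a ∈ s, pairing v (w a) := by
  ext; simp [pairing, Finset.mul_sum]

theorem pairing_swap (v w : M) : pairing (T := T) v w = -pairing w v := by
  ext
  simpa [pairing] using eq_neg_of_add_eq_zero_left (ExteriorAlgebra.ι_add_mul_swap v w)

theorem pairing_self (v : M) : pairing (T := T) v v = 0 := by
  ext; simp [pairing]

theorem pairing_mul_self (v w : M) : pairing (T := T) v w * pairing v w = 0 := by
  ext
  change ExteriorAlgebra.ι T v * ExteriorAlgebra.ι T w *
    (ExteriorAlgebra.ι T v * ExteriorAlgebra.ι T w) = 0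
  have h := Subalgebra.mem_center_iff.1 (ι_mul_ι_mem_center (T := T) v w) (ExteriorAlgebra.ι T v)
  rw [← mul_assoc, ← h, ← mul_assoc, ExteriorAlgebra.ι_sq_zero]
  simp

/-- The product of the elements of degree one which belong to a list. -/
def oddProd {α : Type*} (a : α → M) (l : List α) : ExteriorAlgebra T M :=
  (l.map fun i => ExteriorAlgebra.ι T (a i)).prod

theorem oddProd_ofFn {α : Type*} (a : α → M) {r : ℕ} (w : Fin r → α) :
    oddProd (T := T) a (List.ofFn w) = ExteriorAlgebra.ιMulti T r fun k => a (w k) := by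
  rw [oddProd, List.map_ofFn, ExteriorAlgebra.ιMulti_apply]
  rfl

theorem oddProd_eq_ιMulti {α : Type*} (a : α → M) (l : List α) :
    oddProd (T := T) a l = ExteriorAlgebra.ιMulti T l.length fun k => a (l.get k) := by
  conv_lhs => rw [← List.ofFn_get l]
  rw [oddProd_ofFn]

theorem oddProd_eq_zero {α : Type*} (a : α → M) {l : List α} (hl : ¬ l.Nodup) :
    oddProd (T := T) a l = 0 := by
  rw [oddProd_eq_ιMulti]
  refine ExteriorAlgebra.ιMulti_eq_zero_of_not_inj fun h => hl ?_
  rw [List.nodup_iff_injective_get]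
  exact fun i j hij => h (congrArg a hij)

theorem ι_mul_oddProd_eq_zero {α : Type*} (a : α → M) {l : List α} {i : α} (hi : i ∈ l) :
    ExteriorAlgebra.ι T (a i) * oddProd a l = 0 := by
  have := oddProd_eq_zero (T := T) a (l := i :: l) (by simp [hi])
  simpa [oddProd] using this

/-- The factors of a tuple of pairs. -/
theorem coe_prod_pairing_tupleOf {n m : ℕ} (a : Fin n → M) (ℰ : Fin m → Fin n × Fin n)
    (I : Finset (Fin m)) :
    ((∏ k ∈ I, pairing (T := T) (a (ℰ k).1) (a (ℰ k).2) : Subalgebra.center T _) :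
      ExteriorAlgebra T M) = oddProd a (tupleOf ℰ I) := by
  have h1 : ∏ k ∈ I, pairing (T := T) (a (ℰ k).1) (a (ℰ k).2) =
      ((I.sort (· ≤ ·)).map fun k => pairing (T := T) (a (ℰ k).1) (a (ℰ k).2)).prod := by
    rw [← List.prod_toFinset _ (Finset.sort_nodup _ _), Finset.sort_toFinset]
  rw [h1, oddProd, tupleOf]
  generalize I.sort (· ≤ ·) = l
  induction l with
  | nil => simp
  | cons k l ih =>
    rw [List.map_cons, List.prod_cons, Subalgebra.coe_mul, ih, List.flatMap_cons, List.map_append,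
      List.prod_append]
    simp [coe_pairing]

theorem length_tupleOf {n m : ℕ} (ℰ : Fin m → Fin n × Fin n) (I : Finset (Fin m)) :
    (tupleOf ℰ I).length = 2 * I.card := by
  rw [tupleOf, List.length_flatMap]
  simp [mul_comm]

theorem coe_list_prod_pairing {α : Type*} (a b : α → M) (l : List α) :
    (((l.map fun i => pairing (T := T) (a i) (b i)).prod : Subalgebra.center T _) :
      ExteriorAlgebra T M) =
      (l.map fun i => ExteriorAlgebra.ι T (a i) * ExteriorAlgebra.ι T (b i)).prod := by
  induction l with
  | nil => simp
  | cons i l ih => simp [ih, coe_pairing]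

theorem oddProd_mul_oddProd (hT : ∀ n : ℕ, n ≠ 0 → IsUnit (n : T)) {α : Type*} (a b : α → M)
    (l : List α) : oddProd (T := T) a l * oddProd b l = (-1) ^ l.length.choose 2 *
      (((l.map fun i => pairing (T := T) (a i) (b i)).prod : Subalgebra.center T _) :
        ExteriorAlgebra T M) := by
  rw [coe_list_prod_pairing]
  exact (oddSetting_exterior hT).prod_mul_prod_pair l (fun i => ι_mem_exteriorOdd _)
    (fun i => ι_mem_exteriorOdd _)

/-- Gather all `a i` in front, with a sign independent of the second factors; what follows is an
alternating product of the rows of `A`. -/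
theorem prod_pairing_eq_det (hT : ∀ n : ℕ, n ≠ 0 → IsUnit (n : T)) {n : ℕ}
    (A : Matrix (Fin n) (Fin n) T) (a b : Fin n → M) :
    ∏ i, pairing (T := T) (a i) (∑ j, A i j • b j) = A.det • ∏ i, pairing (a i) (b i) := by
  have h1 (c : Fin n → M) : ((∏ i, pairing (T := T) (a i) (c i) : Subalgebra.center T _) :
      ExteriorAlgebra T M) = (-1) ^ n.choose 2 * (oddProd a (List.finRange n) *
        ExteriorAlgebra.ιMulti T n c) := by
    have h2 := oddProd_mul_oddProd hT a c (List.finRange n)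
    have h3 : oddProd (T := T) c (List.finRange n) = ExteriorAlgebra.ιMulti T n c := by
      rw [oddProd, ExteriorAlgebra.ιMulti_apply, List.ofFn_eq_map]
    rw [h3] at h2
    rw [h2, List.length_finRange, ← mul_assoc, ← pow_add, Even.neg_one_pow ⟨_, rfl⟩, one_mul,
      ← List.prod_ofFn, List.ofFn_eq_map]
  ext
  rw [Subalgebra.coe_smul, h1, h1, ιMulti_linearCombination, mul_smul_comm, mul_smul_comm]

end Even

/-! ### The determinant of the sum of a symmetric matrix and skew-symmetric elementary matrices -/

section DetSkew

variable {T : Type*} [CommRing T] {M : Type*} [AddCommGroup M] [Module T M]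

theorem sigmaSign_of_nodup {n : ℕ} {V : List (Fin n)} (hV : V.Nodup) : sigmaSign V =
    (-1) ^ (V.map fun i : Fin n => (i : ℕ) + 1).sum * (Equiv.Perm.sign (Tuple.sort V.get) : ℤ) := by
  rw [sigmaSign, if_pos hV]
  congr 3
  generalize V = l
  induction l with
  | nil => rfl
  | cons i l ih => exact congrArg (List.cons ((i : ℕ) + 1)) ih

/-- Sorting contributes `sgn π_L`. The factor `(-1) ^ (Σ w + r)`, where `r` accounts for the indices
being counted from `1`, cancels the other sign in `σ`. -/
theorem exists_sorted {n r : ℕ} {V : List (Fin n)} (hV : V.Nodup) (hr : V.length = r) :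
    ∃ w : Fin r → Fin n, StrictMono w ∧ Finset.univ.image w = V.toFinset ∧
      ∀ a : Fin n → M, oddProd (T := T) a V =
        ((sigmaSign V * (-1) ^ (∑ k, (w k : ℕ) + r) : ℤ) : ExteriorAlgebra T M) *
          ExteriorAlgebra.ιMulti T r fun k => a (w k) := by
  subst hr
  set π := Tuple.sort V.get with hπ
  have hinj : Function.Injective V.get := List.nodup_iff_injective_get.1 hV
  refine ⟨V.get ∘ π, (Tuple.monotone_sort V.get).strictMono_of_injective
    (hinj.comp π.injective), ?_, fun a => ?_⟩
  · ext i
    simp only [Finset.mem_image, Finset.mem_univ, true_and, List.mem_toFinset, List.mem_iff_get]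
    exact ⟨fun ⟨k, hk⟩ => ⟨π k, hk⟩, fun ⟨k, hk⟩ => ⟨π.symm k, by simpa using hk⟩⟩
  · have h1 := (ExteriorAlgebra.ιMulti T V.length).map_perm (fun k => a (V.get k)) π
    have h2 : ∑ k, ((V.get ∘ π) k : ℕ) + V.length = (V.map fun i : Fin n => (i : ℕ) + 1).sum := by
      conv_rhs => rw [← List.ofFn_get V]
      rw [List.map_ofFn, List.sum_ofFn]
      simp only [Function.comp_apply, Finset.sum_add_distrib]
      rw [Equiv.sum_comp π (fun k => ((V.get k : Fin n) : ℕ))]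
      simp
    rw [h2, sigmaSign_of_nodup hV, mul_right_comm, ← pow_add, Even.neg_one_pow ⟨_, rfl⟩, one_mul,
      oddProd_eq_ιMulti]
    have h3 : (ExteriorAlgebra.ιMulti T V.length fun k => a ((V.get ∘ π) k)) =
        Equiv.Perm.sign π • ExteriorAlgebra.ιMulti T V.length fun k => a (V.get k) := h1
    rw [h3, Units.smul_def, zsmul_eq_mul, ← mul_assoc, ← Int.cast_mul, ← Units.val_mul,
      Int.units_mul_self]
    simp

/-- The product of an element of degree one and a linear combination of others. -/
abbrev rowPairing {n : ℕ} (A : Matrix (Fin n) (Fin n) T) (a b : Fin n → M) (i : Fin n) :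
    Subalgebra.center T (ExteriorAlgebra T M) :=
  pairing (a i) (∑ j, A i j • b j)

variable {n m : ℕ} (A : Matrix (Fin n) (Fin n) T) (a b : Fin n → M)
  (ℰ : Fin m → Fin n × Fin n) {P : Finset (Fin n)} {I J : Finset (Fin m)}

/-- If the tuple has a repetition or meets `P`, some odd letter `a i` occurs twice. -/
theorem prod_rowPairing_mul_eq_zero
    (h : ¬ ((tupleOf ℰ I).Nodup ∧ Disjoint P (tupleOf ℰ I).toFinset)) :
    (∏ i ∈ P, rowPairing A a b i) * ∏ k ∈ I, pairing (T := T) (a (ℰ k).1) (a (ℰ k).2) = 0 := by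
  by_cases hn : (tupleOf ℰ I).Nodup
  · rw [Finset.disjoint_left] at h
    push Not at h
    obtain ⟨i, hi, hi'⟩ := h hn
    rw [← Finset.mul_prod_erase P _ hi, mul_right_comm]
    have : rowPairing A a b i * ∏ k ∈ I, pairing (T := T) (a (ℰ k).1) (a (ℰ k).2) = 0 := by
      ext
      rw [rowPairing, pairing_swap, Subalgebra.coe_mul, coe_prod_pairing_tupleOf,
        Subalgebra.coe_neg, coe_pairing, neg_mul, mul_assoc,
        ι_mul_oddProd_eq_zero _ (List.mem_toFinset.1 hi')]
      simp
    rw [this, zero_mul]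
  · have : ∏ k ∈ I, pairing (T := T) (a (ℰ k).1) (a (ℰ k).2) = 0 := by
      ext
      rw [coe_prod_pairing_tupleOf, oddProd_eq_zero _ hn]
      rfl
    rw [this, mul_zero]

/-- The product contains `P.card + 2 * J.card` elements of the span of the `n` letters `b`. -/
theorem prod_rowPairing_mul_eq_zero_of_lt (hT : ∀ n : ℕ, n ≠ 0 → IsUnit (n : T))
    (h : n < P.card + 2 * J.card) :
    (∏ i ∈ P, rowPairing A a b i) * ∏ k ∈ J, pairing (T := T) (b (ℰ k).1) (b (ℰ k).2) = 0 := by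
  ext
  have h1 : ∏ i ∈ P, rowPairing A a b i = ((P.sort (· ≤ ·)).map (rowPairing A a b)).prod := by
    rw [← List.prod_toFinset _ (Finset.sort_nodup _ _), Finset.sort_toFinset]
  have h2 := oddProd_mul_oddProd (T := T) hT a (fun i => ∑ j, A i j • b j) (P.sort (· ≤ ·))
  have h3 : oddProd (T := T) (fun i => ∑ j, A i j • b j) (P.sort (· ≤ ·)) *
      oddProd b (tupleOf ℰ J) = 0 := by
    rw [oddProd_eq_ιMulti, oddProd_eq_ιMulti, ExteriorAlgebra.ιMulti_mul_ιMulti]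
    refine prod_eq_zero_of_lt (m := n) (by rw [Finset.length_sort, length_tupleOf]; exact h) b _
      fun c => ?_
    refine Fin.addCases (fun c => ?_) (fun c => ?_) c
    · rw [Fin.append_left]
      exact Submodule.sum_mem _ fun j _ => Submodule.smul_mem _ _ (Submodule.subset_span ⟨j, rfl⟩)
    · rw [Fin.append_right]
      exact Submodule.subset_span ⟨_, rfl⟩
  have h4 : ((((P.sort (· ≤ ·)).map (rowPairing A a b)).prod : Subalgebra.center T _) :
      ExteriorAlgebra T M) =
      (-1) ^ (P.sort (· ≤ ·)).length.choose 2 * (oddProd (T := T) a (P.sort (· ≤ ·)) *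
        oddProd (fun i => ∑ j, A i j • b j) (P.sort (· ≤ ·))) := by
    rw [h2, ← mul_assoc, ← pow_add, Even.neg_one_pow ⟨_, rfl⟩, one_mul]
  rw [Subalgebra.coe_mul, coe_prod_pairing_tupleOf, h1, h4, mul_assoc, mul_assoc, h3]
  simp

theorem neg_one_pow_choose_two (i : ℕ) {R : Type*} [Ring R] :
    (-1 : R) ^ (2 * i).choose 2 = (-1) ^ i := by
  induction i with
  | zero => simp
  | succ i ih =>
    have : (2 * (i + 1)).choose 2 = (2 * i).choose 2 + (2 * (2 * i) + 1) := by
      rw [show 2 * (i + 1) = 2 * i + 1 + 1 by ring, Nat.choose_succ_succ', Nat.choose_one_right,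
        Nat.choose_succ_succ', Nat.choose_one_right]
      ring
    rw [this, pow_add, ih, pow_succ, pow_succ, pow_mul]
    simp

/-- After sorting, the `k`-th letters of both tuples pair up as `a (w k) * b (w' k)`, which acts as
a unit row in the missing place of `A`. The determinant so completed is the signed complementary
minor, whose sign cancels the index sums in `σ`; regrouping `2 * J.card` pairs gives `(-1) ^
J.card`. -/
theorem prod_rowPairing_mul_eq (hT : ∀ n : ℕ, n ≠ 0 → IsUnit (n : T)) (hIJ : I.card = J.card)
    (hI : (tupleOf ℰ I).Nodup) :
    (∏ i ∈ (tupleOf ℰ I).toFinsetᶜ, rowPairing A a b i) *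
      (∏ k ∈ I, pairing (T := T) (a (ℰ k).1) (a (ℰ k).2)) *
      ∏ k ∈ J, pairing (T := T) (b (ℰ k).1) (b (ℰ k).2) =
    ((-1) ^ J.card * ((sigmaSign (tupleOf ℰ I) : T) * (sigmaSign (tupleOf ℰ J) : T) *
      delDet A (tupleOf ℰ I).toFinset (tupleOf ℰ J).toFinset)) • ∏ i, pairing (a i) (b i) := by
  by_cases hJ : (tupleOf ℰ J).Nodup
  swap
  · have : ∏ k ∈ J, pairing (T := T) (b (ℰ k).1) (b (ℰ k).2) = 0 := by
      ext
      rw [coe_prod_pairing_tupleOf, oddProd_eq_zero _ hJ]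
      rfl
    rw [this, mul_zero, sigmaSign, sigmaSign, if_neg hJ]
    simp
  obtain ⟨r, hr⟩ : ∃ r, r = 2 * I.card := ⟨_, rfl⟩
  obtain ⟨w, hw, hwi, hwo⟩ := exists_sorted (T := T) (M := M) hI
    ((length_tupleOf ℰ I).trans hr.symm)
  obtain ⟨w', hw', hwi', hwo'⟩ := exists_sorted (T := T) (M := M) hJ
    (r := r) ((length_tupleOf ℰ J).trans (by rw [hr, hIJ]))
  have hXY : (∏ k ∈ I, pairing (T := T) (a (ℰ k).1) (a (ℰ k).2)) *
      ∏ k ∈ J, pairing (T := T) (b (ℰ k).1) (b (ℰ k).2) =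
      ((-1) ^ J.card * ((sigmaSign (tupleOf ℰ I) : T) * (sigmaSign (tupleOf ℰ J) : T) *
        (-1) ^ (∑ k, (w k : ℕ) + ∑ k, (w' k : ℕ)))) • ∏ k, pairing (a (w k)) (b (w' k)) := by
    have h2 := oddProd_mul_oddProd (T := T) hT (fun k => a (w k)) (fun k => b (w' k))
      (List.finRange r)
    have h3 (c : Fin r → M) : oddProd (T := T) c (List.finRange r) =
        ExteriorAlgebra.ιMulti T r c := by
      rw [oddProd, ExteriorAlgebra.ιMulti_apply, List.ofFn_eq_map]
    rw [h3, h3, List.length_finRange, (congrArg (fun s => (-1 : ExteriorAlgebra T M) ^ s.choose 2) hr).trans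
      (neg_one_pow_choose_two _), ← List.ofFn_eq_map,
      List.prod_ofFn] at h2
    ext
    rw [Subalgebra.coe_mul, coe_prod_pairing_tupleOf, coe_prod_pairing_tupleOf, hwo, hwo',
      Subalgebra.coe_smul, mul_assoc, ← mul_assoc (ExteriorAlgebra.ιMulti T r _),
      ← (Int.cast_commute _ _).eq, mul_assoc, h2, ← mul_assoc, ← mul_assoc, Algebra.smul_def]
    congr 1
    simp only [map_mul, map_pow, map_neg, map_one, map_intCast, Int.cast_mul, Int.cast_pow,
      Int.cast_neg, Int.cast_one]
    have hr1 : (-1 : ExteriorAlgebra T M) ^ r = 1 := Even.neg_one_pow (hr ▸ even_two_mul _)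
    have e1 : (-1 : ExteriorAlgebra T M) ^ (∑ k, (w k : ℕ) + r) = (-1) ^ (∑ k, (w k : ℕ)) := by
      rw [pow_add, hr1, mul_one]
    have e2 : (-1 : ExteriorAlgebra T M) ^ (∑ k, (w' k : ℕ) + r) = (-1) ^ (∑ k, (w' k : ℕ)) := by
      rw [pow_add, hr1, mul_one]
    have hc (k : ℕ) (z : ExteriorAlgebra T M) : (-1) ^ k * z = z * (-1) ^ k :=
      ((Commute.neg_one_left z).pow_left k).eq
    rw [e1, e2, hIJ, ← hc J.card, pow_add, mul_assoc (sigmaSign (tupleOf ℰ I) : ExteriorAlgebra T M),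
      ← mul_assoc ((-1) ^ (∑ k, (w k : ℕ))), hc _ (sigmaSign (tupleOf ℰ J) : ExteriorAlgebra T M)]
    simp only [mul_assoc]
  have hall : (∏ i ∈ (tupleOf ℰ I).toFinsetᶜ, rowPairing A a b i) *
      ∏ k, pairing (a (w k)) (b (w' k)) = ∏ i, rowPairing (replaceRows A w w') a b i := by
    rw [← Finset.prod_compl_mul_prod (tupleOf ℰ I).toFinset]
    congr 1
    · refine Finset.prod_congr rfl fun i hi => ?_
      have hi' : ¬ ∃ k, w k = i := by
        rintro ⟨k, rfl⟩
        rw [Finset.mem_compl, ← hwi] at hi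
        exact hi (Finset.mem_image_of_mem _ (Finset.mem_univ _))
      simp only [rowPairing, replaceRows_of_notMem A w w' hi']
    · rw [← hwi, Finset.prod_image fun _ _ _ _ h => hw.injective h]
      refine Finset.prod_congr rfl fun k _ => ?_
      simp only [rowPairing, replaceRows_apply A hw.injective w']
      simp [Pi.single_apply, ite_smul]
  rw [mul_assoc, hXY, mul_smul_comm, hall, prod_pairing_eq_det hT, det_replaceRows A hw hw', hwi,
    hwi', smul_smul]
  congr 1
  have hsq : ((-1 : T) ^ (∑ k, (w k : ℕ) + ∑ k, (w' k : ℕ))) *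
      (-1) ^ (∑ k, (w k : ℕ) + ∑ k, (w' k : ℕ)) = 1 := by
    rw [← pow_add, Even.neg_one_pow ⟨_, rfl⟩]
  linear_combination ((-1) ^ J.card * ((sigmaSign (tupleOf ℰ I) : T) *
    (sigmaSign (tupleOf ℰ J) : T) * delDet A (tupleOf ℰ I).toFinset (tupleOf ℰ J).toFinset)) * hsq

theorem eq_zero_of_smul_prod_pairing (hT : ∀ n : ℕ, n ≠ 0 → IsUnit (n : T)) {n : ℕ} {s : T}
    (hs : s • ∏ i : Fin n, pairing (T := T) (Pi.single (Fin.castAdd n i) 1 : Fin (n + n) → T)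
      (Pi.single (Fin.natAdd n i) 1) = 0) : s = 0 := by
  have h2 := oddProd_mul_oddProd (T := T) hT
    (fun i : Fin n => (Pi.single (Fin.castAdd n i) 1 : Fin (n + n) → T))
    (fun i : Fin n => Pi.single (Fin.natAdd n i) 1) (List.finRange n)
  have h3 (c : Fin n → Fin (n + n) → T) : oddProd (T := T) c (List.finRange n) =
      (List.ofFn fun i => ExteriorAlgebra.ι T (c i)).prod := by
    rw [oddProd, List.ofFn_eq_map]
  rw [h3, h3, ← List.prod_append, ← List.ofFn_eq_map, List.prod_ofFn] at h2
  refine eq_zero_of_smul_ιMulti (r := n + n) ?_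
  rw [ExteriorAlgebra.ιMulti_apply, List.ofFn_add]
  have h4 := congrArg (Subalgebra.val _) hs
  simp only [map_smul, map_zero, Subalgebra.coe_val] at h4
  rw [← Algebra.smul_def]
  have h5 := h2
  refine (congrArg (fun y => s • y) h5).trans ?_
  rw [← mul_smul_comm, h4, mul_zero]

end DetSkew

/-- The expansion of the determinant of the sum of a symmetric matrix and skew-symmetric elementary
matrices with coefficients of square zero. -/
theorem det_add_sum_skew {T : Type*} [CommRing T] (hT : ∀ n : ℕ, n ≠ 0 → IsUnit (n : T))
    {n m : ℕ} {A : Matrix (Fin n) (Fin n) T} (hA : A.IsSymm) (ℰ : Fin m → Fin n × Fin n)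
    (t : Fin m → T) (ht : ∀ k, t k * t k = 0) :
    (A + ∑ k, t k • skew T (ℰ k).1 (ℰ k).2).det =
      ∑ I : Finset (Fin m), ∑ J : Finset (Fin m), if I.card = J.card then
        (∏ k ∈ I, t k) * (∏ k ∈ J, t k) * ((sigmaSign (tupleOf ℰ I) : T) *
          (sigmaSign (tupleOf ℰ J) : T) *
            delDet A (tupleOf ℰ I).toFinset (tupleOf ℰ J).toFinset) else 0 := by
  obtain ⟨c, hc⟩ := (hT 2 two_ne_zero).exists_left_inv
  have hc' : c * 2 = 1 := by simpa using hc
  -- Two sets of anticommuting letters, and the rotated letters `x = a - b`, `y = (a + b) / 2`, for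
  -- which the product of the `x i * y i` is unchanged.
  let a (i : Fin n) : Fin (n + n) → T := Pi.single (Fin.castAdd n i) 1
  let b (i : Fin n) : Fin (n + n) → T := Pi.single (Fin.natAdd n i) 1
  let x (i : Fin n) := a i - b i
  let y (i : Fin n) := c • (a i + b i)
  set B := A + ∑ k, t k • skew T (ℰ k).1 (ℰ k).2 with hB
  let vol : Subalgebra.center T (ExteriorAlgebra T (Fin (n + n) → T)) :=
    ∏ i, pairing (T := T) (a i) (b i)
  have htwo (z : Subalgebra.center T (ExteriorAlgebra T (Fin (n + n) → T))) :
      c • (z + z) = z := by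
    have hcc : c + c = 1 := by rw [← mul_two]; exact hc'
    rw [smul_add, ← add_smul, hcc, one_smul]
  have hxy (i j) : pairing (T := T) (x i) (y j) = c • (pairing (a i) (a j) + pairing (a i) (b j) -
      pairing (b i) (a j) - pairing (b i) (b j)) := by
    simp only [x, y, pairing_smul_right, sub_eq_add_neg, pairing_add_left, pairing_add_right,
      pairing_neg_left]
    congr 1
    abel
  have hvol : ∏ i, pairing (T := T) (x i) (y i) = vol := by
    refine Finset.prod_congr rfl fun i _ => ?_
    rw [hxy, pairing_self, pairing_self, pairing_swap (b i) (a i), zero_add, sub_neg_eq_add,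
      sub_zero, htwo]
  -- The determinant is the `n`-th power of the bilinear expression of `B` in `x` and `y`, divided
  -- by `n!`.
  have h1 : (∑ i, rowPairing B x y i) ^ n = (n.factorial : Subalgebra.center T _) * (B.det • vol) := by
    rw [sum_pow_eq_factorial_mul _ (fun i => pairing_mul_self _ _)]
    have : Finset.powersetCard n (Finset.univ : Finset (Fin n)) = {Finset.univ} := by
      have := Finset.powersetCard_self (Finset.univ : Finset (Fin n))
      rwa [Finset.card_univ, Fintype.card_fin] at this
    rw [this, Finset.sum_singleton, prod_pairing_eq_det hT, hvol]
  have hA' (i j) : A i j = A j i := congrFun (congrFun hA.eq j) i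
  -- By symmetry of `A` the parts purely in `a` or purely in `b` vanish, and the two mixed parts
  -- agree.
  have hsumA : ∑ i, ∑ j, A i j • pairing (T := T) (x i) (y j) = ∑ i, rowPairing A a b i := by
    have e1 (d : Fin n → Fin (n + n) → T) : ∑ i, ∑ j, A i j • pairing (T := T) (d i) (d j) = 0 := by
      have h0 : ∑ i, ∑ j, A i j • pairing (T := T) (d i) (d j) =
          -∑ i, ∑ j, A i j • pairing (T := T) (d i) (d j) := by
        conv_lhs => rw [Finset.sum_comm]
        rw [← Finset.sum_neg_distrib]
        refine Finset.sum_congr rfl fun i _ => ?_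
        rw [← Finset.sum_neg_distrib]
        refine Finset.sum_congr rfl fun j _ => ?_
        rw [pairing_swap (d j), hA' j i, smul_neg]
      rw [← htwo (∑ i, ∑ j, A i j • pairing (T := T) (d i) (d j))]
      nth_rewrite 1 [h0]
      rw [neg_add_cancel, smul_zero]
    have e2 : ∑ i, ∑ j, A i j • pairing (T := T) (b i) (a j) =
        -∑ i, ∑ j, A i j • pairing (T := T) (a i) (b j) := by
      conv_lhs => rw [Finset.sum_comm]
      rw [← Finset.sum_neg_distrib]
      refine Finset.sum_congr rfl fun i _ => ?_
      rw [← Finset.sum_neg_distrib]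
      refine Finset.sum_congr rfl fun j _ => ?_
      rw [pairing_swap (b j), hA' j i, smul_neg]
    have e3 : ∑ i, ∑ j, A i j • pairing (T := T) (x i) (y j) =
        c • (∑ i, ∑ j, A i j • pairing (T := T) (a i) (a j) +
          ∑ i, ∑ j, A i j • pairing (T := T) (a i) (b j) -
          ∑ i, ∑ j, A i j • pairing (T := T) (b i) (a j) -
          ∑ i, ∑ j, A i j • pairing (T := T) (b i) (b j)) := by
      simp only [hxy, ← Finset.sum_add_distrib, ← Finset.sum_sub_distrib, Finset.smul_sum,
        ← smul_add, ← smul_sub]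
      simp only [smul_smul, mul_comm]
    rw [e3, e1, e1, e2, zero_add, sub_zero, sub_neg_eq_add, htwo]
    simp only [rowPairing, pairing_sum_right, pairing_smul_right]
  -- For a skew matrix it is the other way round: the mixed parts cancel and `t (a_s a_t - b_s b_t)`
  -- remains.
  have hsumB : ∑ i, rowPairing B x y i = ∑ i, rowPairing A a b i +
      ∑ k, t k • pairing (T := T) (a (ℰ k).1) (a (ℰ k).2) +
      ∑ k, (-t k) • pairing (T := T) (b (ℰ k).1) (b (ℰ k).2) := by
    have e1 : ∑ i, rowPairing B x y i = ∑ i, ∑ j, A i j • pairing (T := T) (x i) (y j) +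
        ∑ k, t k • (pairing (T := T) (x (ℰ k).1) (y (ℰ k).2) -
          pairing (T := T) (x (ℰ k).2) (y (ℰ k).1)) := by
      have e2 (k) : ∑ i, ∑ j, (t k • skew T (ℰ k).1 (ℰ k).2) i j • pairing (T := T) (x i) (y j) =
          t k • (pairing (T := T) (x (ℰ k).1) (y (ℰ k).2) -
            pairing (T := T) (x (ℰ k).2) (y (ℰ k).1)) := by
        simp only [skew, Matrix.smul_apply, Matrix.sub_apply, Matrix.single_apply, smul_eq_mul,
          mul_smul, sub_smul, ite_smul, one_smul, zero_smul, ← Finset.smul_sum,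
          Finset.sum_sub_distrib, ite_and, Finset.sum_ite_eq, Finset.mem_univ, if_true,
          Finset.sum_ite_irrel, Finset.sum_const_zero]
      have e0 (i) : rowPairing B x y i = ∑ j, A i j • pairing (T := T) (x i) (y j) +
          ∑ k, ∑ j, (t k • skew T (ℰ k).1 (ℰ k).2) i j • pairing (T := T) (x i) (y j) := by
        rw [rowPairing, pairing_sum_right]
        simp only [pairing_add_right, pairing_smul_right, hB, Matrix.add_apply, add_smul,
          Finset.sum_add_distrib]
        congr 1
        refine Eq.trans ?_ Finset.sum_comm
        refine Finset.sum_congr rfl fun j _ => ?_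
        rw [Matrix.sum_apply, Finset.sum_smul]
      simp only [e0, Finset.sum_add_distrib, ← e2]
      congr 1
      exact Finset.sum_comm
    rw [e1, hsumA, add_assoc, ← Finset.sum_add_distrib]
    congr 1
    refine Finset.sum_congr rfl fun k _ => ?_
    rw [hxy, hxy, pairing_swap (a (ℰ k).2) (a (ℰ k).1), pairing_swap (a (ℰ k).2) (b (ℰ k).1),
      pairing_swap (b (ℰ k).2) (a (ℰ k).1), pairing_swap (b (ℰ k).2) (b (ℰ k).1), ← smul_sub]
    have e4 : ∀ p q r s : Subalgebra.center T (ExteriorAlgebra T (Fin (n + n) → T)),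
        p + q - r - s - (-p + -r - -q - -s) = (p - s) + (p - s) := by
      intro p q r s; abel
    rw [e4, htwo, smul_sub, neg_smul, sub_eq_add_neg]
  rw [hsumB, sum_sum_pow_eq _ _ _ (fun i => pairing_mul_self _ _)
    (fun k => by rw [smul_mul_smul_comm, ht, zero_smul])
    (fun k => by rw [smul_mul_smul_comm, neg_mul_neg, ht, zero_smul])] at h1
  have hfac : IsUnit (n.factorial : Subalgebra.center T (ExteriorAlgebra T (Fin (n + n) → T))) := by
    simpa using (hT n.factorial (Nat.factorial_ne_zero n)).map
      (algebraMap T (Subalgebra.center T (ExteriorAlgebra T (Fin (n + n) → T))))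
  have h2 := hfac.mul_left_cancel h1
  have hterm (I J : Finset (Fin m)) : (∑ P : Finset (Fin n),
      if P.card + I.card + J.card = n then (∏ i ∈ P, rowPairing A a b i) *
        (∏ k ∈ I, t k • pairing (T := T) (a (ℰ k).1) (a (ℰ k).2)) *
        ∏ k ∈ J, (-t k) • pairing (T := T) (b (ℰ k).1) (b (ℰ k).2) else 0) =
      (if I.card = J.card then (∏ k ∈ I, t k) * (∏ k ∈ J, t k) * ((sigmaSign (tupleOf ℰ I) : T) *
          (sigmaSign (tupleOf ℰ J) : T) *
            delDet A (tupleOf ℰ I).toFinset (tupleOf ℰ J).toFinset) else 0) • vol := by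
    have hpull (P : Finset (Fin n)) : (∏ i ∈ P, rowPairing A a b i) *
        (∏ k ∈ I, t k • pairing (T := T) (a (ℰ k).1) (a (ℰ k).2)) *
        (∏ k ∈ J, (-t k) • pairing (T := T) (b (ℰ k).1) (b (ℰ k).2)) =
        ((∏ k ∈ I, t k) * (∏ k ∈ J, t k) * (-1) ^ J.card) • ((∏ i ∈ P, rowPairing A a b i) *
          (∏ k ∈ I, pairing (T := T) (a (ℰ k).1) (a (ℰ k).2)) *
          ∏ k ∈ J, pairing (T := T) (b (ℰ k).1) (b (ℰ k).2)) := by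
      rw [Finset.prod_smul, Finset.prod_smul, Finset.prod_neg, mul_smul_comm, mul_smul_comm,
        smul_mul_assoc, smul_smul]
      congr 1
      ring
    -- Non-vanishing forces `|P| + 2|I| ≤ n` and `|P| + 2|J| ≤ n`. With `|P| + |I| + |J| = n` both
    -- are equalities, so `|I| = |J|` and `P` is the complement of the indices in `I`.
    have hzero (P : Finset (Fin n)) (hP : P.card + I.card + J.card = n)
        (h : ¬ ((tupleOf ℰ I).Nodup ∧ P = (tupleOf ℰ I).toFinsetᶜ ∧ I.card = J.card)) :
        (∏ i ∈ P, rowPairing A a b i) *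
          (∏ k ∈ I, pairing (T := T) (a (ℰ k).1) (a (ℰ k).2)) *
          ∏ k ∈ J, pairing (T := T) (b (ℰ k).1) (b (ℰ k).2) = 0 := by
      by_cases h1 : (tupleOf ℰ I).Nodup ∧ Disjoint P (tupleOf ℰ I).toFinset
      · have hV := List.toFinset_card_of_nodup h1.1
        rw [length_tupleOf] at hV
        have hsub : P ⊆ (tupleOf ℰ I).toFinsetᶜ := fun i hi =>
          Finset.mem_compl.2 fun hi' => (Finset.disjoint_left.1 h1.2) hi hi'
        have hcc := Finset.card_le_card hsub
        have hVn := Finset.card_le_univ (tupleOf ℰ I).toFinset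
        rw [Finset.card_compl, Fintype.card_fin] at hcc
        rw [Fintype.card_fin] at hVn
        rw [mul_right_comm, prod_rowPairing_mul_eq_zero_of_lt A a b ℰ hT, zero_mul]
        by_contra hlt
        refine h ⟨h1.1, Finset.eq_of_subset_of_card_le hsub ?_, by omega⟩
        rw [Finset.card_compl, Fintype.card_fin]
        omega
      · rw [prod_rowPairing_mul_eq_zero A a b ℰ h1, zero_mul]
    simp only [hpull]
    by_cases hIJ : I.card = J.card
    · rw [if_pos hIJ]
      by_cases hV : (tupleOf ℰ I).Nodup
      · have hVc := List.toFinset_card_of_nodup hV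
        rw [length_tupleOf] at hVc
        have hVn := Finset.card_le_univ (tupleOf ℰ I).toFinset
        rw [Fintype.card_fin] at hVn
        rw [Finset.sum_eq_single (tupleOf ℰ I).toFinsetᶜ, if_pos,
          prod_rowPairing_mul_eq A a b ℰ hT hIJ hV, smul_smul]
        · congr 1
          rw [mul_assoc, ← mul_assoc ((-1) ^ J.card) ((-1) ^ J.card), ← pow_add,
            Even.neg_one_pow ⟨_, rfl⟩, one_mul]
        · rw [Finset.card_compl, Fintype.card_fin]
          omega
        · intro P _ hP
          split_ifs with hPc
          · rw [hzero P hPc fun h => hP h.2.1, smul_zero]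
          · rfl
        · simp
      · rw [Finset.sum_eq_zero]
        · rw [sigmaSign, if_neg hV]; simp
        · intro P _
          split_ifs with hPc
          · rw [hzero P hPc fun h => hV h.1, smul_zero]
          · rfl
    · rw [if_neg hIJ, zero_smul, Finset.sum_eq_zero]
      intro P _
      split_ifs with hPc
      · rw [hzero P hPc fun h => hIJ h.2.2, smul_zero]
      · rfl
  simp only [hterm, ← Finset.sum_smul] at h2
  refine sub_eq_zero.1 (eq_zero_of_smul_prod_pairing hT (n := n) ?_)
  rw [sub_smul]
  exact sub_eq_zero.2 h2.symm

/-! ### Variables of square zero -/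

section TopCoeff

variable (S : Type u) [CommRing S] (m : ℕ)

/-- A commutative algebra which contains variables of square zero. -/
abbrev SqZeroAlg : Type u := Subalgebra.center S (ExteriorAlgebra S (Fin (m + m) → S))

/-- The variables of square zero. -/
def sqZeroVar (k : Fin m) : SqZeroAlg S m :=
  pairing (Pi.single (Fin.castAdd m k) 1) (Pi.single (Fin.natAdd m k) 1)

theorem sqZeroVar_mul_self (k : Fin m) : sqZeroVar S m k * sqZeroVar S m k = 0 :=
  pairing_mul_self _ _

/-- The coefficient of the product of all variables. -/
def topCoeff : SqZeroAlg S m →ₗ[S] S :=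
  -- The sign makes the coefficient of the product of all variables equal to `1`: it undoes the
  -- sorting of the pairs into basis order.
  ((-1) ^ m.choose 2 : S) • (ExteriorAlgebra.liftAlternating (R := S) (M := Fin (m + m) → S) (N := S)
    (Function.update 0 (m + m) Matrix.detRowAlternating)) ∘ₗ (Subalgebra.val _).toLinearMap

theorem topCoeff_prod_eq_zero {I : Finset (Fin m)} (hI : I ≠ Finset.univ) :
    topCoeff S m (∏ k ∈ I, sqZeroVar S m k) = 0 := by
  have h1 := coe_prod_pairing_tupleOf (T := S)
    (fun i : Fin (m + m) => (Pi.single i 1 : Fin (m + m) → S))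
    (fun k : Fin m => (Fin.castAdd m k, Fin.natAdd m k)) I
  have hlen : (tupleOf (fun k : Fin m => (Fin.castAdd m k, Fin.natAdd m k)) I).length ≠ m + m := by
    rw [length_tupleOf]
    have := (Finset.card_lt_iff_ne_univ I).2 hI
    rw [Fintype.card_fin] at this
    omega
  have h2 : ((∏ k ∈ I, sqZeroVar S m k : SqZeroAlg S m) : ExteriorAlgebra S (Fin (m + m) → S)) =
      oddProd (fun i : Fin (m + m) => (Pi.single i 1 : Fin (m + m) → S))
        (tupleOf (fun k : Fin m => (Fin.castAdd m k, Fin.natAdd m k)) I) := h1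
  simp only [topCoeff, LinearMap.smul_apply, LinearMap.comp_apply, AlgHom.toLinearMap_apply,
    Subalgebra.coe_val, h2, oddProd_eq_ιMulti, ExteriorAlgebra.liftAlternating_apply_ιMulti,
    Function.update_of_ne hlen]
  simp

variable {S}

theorem topCoeff_prod_univ (hS : ∀ n : ℕ, n ≠ 0 → IsUnit (n : S)) :
    topCoeff S m (∏ k, sqZeroVar S m k) = 1 := by
  have h2 := oddProd_mul_oddProd (T := S) hS
    (fun i : Fin m => (Pi.single (Fin.castAdd m i) 1 : Fin (m + m) → S))
    (fun i : Fin m => Pi.single (Fin.natAdd m i) 1) (List.finRange m)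
  have h3 (c : Fin m → Fin (m + m) → S) : oddProd (T := S) c (List.finRange m) =
      (List.ofFn fun i => ExteriorAlgebra.ι S (c i)).prod := by
    rw [oddProd, List.ofFn_eq_map]
  rw [h3, h3, ← List.prod_append, ← List.ofFn_eq_map, List.prod_ofFn, List.length_finRange] at h2
  have h4 : ((∏ k, sqZeroVar S m k : SqZeroAlg S m) : ExteriorAlgebra S (Fin (m + m) → S)) =
      ((-1) ^ m.choose 2 : S) • ExteriorAlgebra.ιMulti S (m + m) (fun i => Pi.single i (1 : S)) := by
    rw [ExteriorAlgebra.ιMulti_apply, List.ofFn_add]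
    refine Eq.trans ?_ (congrArg (fun z => ((-1) ^ m.choose 2 : S) • z) h2.symm)
    rw [Algebra.smul_def, ← mul_assoc, map_pow, map_neg, map_one, ← pow_add,
      Even.neg_one_pow ⟨_, rfl⟩, one_mul]
    rfl
  have h5 : Matrix.detRowAlternating (fun i : Fin (m + m) => Pi.single i (1 : S)) = 1 := by
    have : (fun i : Fin (m + m) => Pi.single i (1 : S)) = (1 : Matrix (Fin (m + m)) (Fin (m + m)) S) := by
      ext i j; simp [Matrix.one_apply, Pi.single_apply, eq_comm]
    rw [this]
    exact Matrix.det_one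
  simp only [topCoeff, LinearMap.smul_apply, LinearMap.comp_apply, AlgHom.toLinearMap_apply,
    Subalgebra.coe_val, h4, map_smul, ExteriorAlgebra.liftAlternating_apply_ιMulti,
    Function.update_self, h5, smul_eq_mul, mul_one]
  rw [← pow_add, Even.neg_one_pow ⟨_, rfl⟩]

theorem topCoeff_algebraMap_mul (s : S) (z : SqZeroAlg S m) :
    topCoeff S m (algebraMap S _ s * z) = s * topCoeff S m z := by
  rw [← Algebra.smul_def, map_smul, smul_eq_mul]

/-- The edge coefficient, as the coefficient of the product of all variables. -/
theorem edgeCoeff_eq_topCoeff {ι : Type*} [Fintype ι] [DecidableEq ι]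
    (hS : ∀ n : ℕ, n ≠ 0 → IsUnit (n : S)) {A : Matrix ι ι S} (hA : IsUnit A.det)
    (ℰ : Fin m → ι × ι) : edgeCoeff (List.ofFn ℰ) A =
      topCoeff S m (Ring.inverse (A.map (algebraMap S (SqZeroAlg S m)) +
        ∑ k, sqZeroVar S m k • skew (SqZeroAlg S m) (ℰ k).1 (ℰ k).2).det) := by
  have h1 := inverse_det_add_eq_sum (algebraMap S (SqZeroAlg S m)) hA
    ((List.finRange m).map fun k => (ℰ k, sqZeroVar S m k)) (fun x hx => by
      obtain ⟨k, -, rfl⟩ := List.mem_map.1 hx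
      exact sqZeroVar_mul_self S m k)
  have h2 : (((List.finRange m).map fun k => (ℰ k, sqZeroVar S m k)).map fun x =>
      x.2 • skew (SqZeroAlg S m) x.1.1 x.1.2).sum =
      ∑ k, sqZeroVar S m k • skew (SqZeroAlg S m) (ℰ k).1 (ℰ k).2 := by
    rw [List.map_map, ← List.ofFn_eq_map, List.sum_ofFn]
    rfl
  rw [h2] at h1
  -- Among the sublists in the expansion only the full list contains every variable.
  rw [h1, List.sublists'_map, List.map_map, ← List.sum_toFinset _
    (List.nodup_sublists'.2 (List.nodup_finRange m)), map_sum,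
    Finset.sum_eq_single (List.finRange m)]
  · simp only [Function.comp_apply, topCoeff_algebraMap_mul, List.map_map]
    have : ((List.finRange m).map (Prod.snd ∘ fun k => (ℰ k, sqZeroVar S m k))).prod =
        ∏ k, sqZeroVar S m k := by
      rw [← List.ofFn_eq_map, List.prod_ofFn]
      rfl
    rw [this, topCoeff_prod_univ m hS, mul_one, List.ofFn_eq_map]
    rfl
  · intro s hs hne
    rw [List.mem_toFinset, List.mem_sublists'] at hs
    have hnd := (List.nodup_finRange m).sublist hs
    simp only [Function.comp_apply, topCoeff_algebraMap_mul, List.map_map]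
    have h3 : (s.map (Prod.snd ∘ fun k => (ℰ k, sqZeroVar S m k))).prod =
        ∏ k ∈ s.toFinset, sqZeroVar S m k := (List.prod_toFinset _ hnd).symm
    rw [h3, topCoeff_prod_eq_zero, mul_zero]
    intro hu
    refine hne (hs.eq_of_length ?_)
    rw [← List.toFinset_card_of_nodup hnd, hu]
    simp
  · intro h
    exact absurd (List.mem_toFinset.2 (List.mem_sublists'.2 (List.Sublist.refl _))) h

end TopCoeff

/-! ### Unordered pairs of sets of equal size -/

section Pairs

variable {m : ℕ}

open scoped Classical in
/-- The union of the two sets of an unordered pair. -/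
def pairSet (p : Sym2 (Finset (Fin m))) : Finset (Fin m) :=
  Finset.univ.filter fun a => ∃ I ∈ p, a ∈ I

theorem mem_pairSet {p : Sym2 (Finset (Fin m))} {a : Fin m} :
    a ∈ pairSet p ↔ ∃ I ∈ p, a ∈ I := by
  simp [pairSet]

theorem pairSet_mk (I J : Finset (Fin m)) : pairSet s(I, J) = I ∪ J := by
  ext a
  simp [mem_pairSet, Finset.mem_union]

open scoped Classical in
/-- The unordered pairs of disjoint non-empty sets of equal size. -/
def validPairs (m : ℕ) : Finset (Sym2 (Finset (Fin m))) :=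
  Finset.univ.filter fun p => ∃ I J : Finset (Fin m),
    p = s(I, J) ∧ I.Nonempty ∧ J.Nonempty ∧ I.card = J.card ∧ Disjoint I J

theorem mem_validPairs {p : Sym2 (Finset (Fin m))} : p ∈ validPairs m ↔
    ∃ I J : Finset (Fin m), p = s(I, J) ∧ I.Nonempty ∧ J.Nonempty ∧ I.card = J.card ∧
      Disjoint I J := by
  simp [validPairs]

theorem card_pairSet {p : Sym2 (Finset (Fin m))} (hp : p ∈ validPairs m) :
    ∃ c, (pairSet p).card = 2 * c ∧ 0 < c := by
  obtain ⟨I, J, rfl, hI, -, hIJ, hd⟩ := mem_validPairs.1 hp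
  exact ⟨I.card, by rw [pairSet_mk, Finset.card_union_of_disjoint hd, ← hIJ, two_mul], hI.card_pos⟩

theorem mem_pairings {k : ℕ} {P : Finset (Sym2 (Finset (Fin m)))} : P ∈ pairings m k ↔
    P.card = k ∧ P ⊆ validPairs m ∧ (P : Set (Sym2 (Finset (Fin m)))).PairwiseDisjoint pairSet ∧
      P.biUnion pairSet = Finset.univ := by
  simp only [pairings, Finset.mem_filter, Finset.mem_univ, true_and]
  refine and_congr_right fun _ => and_congr ?_ ?_
  · exact forall₂_congr fun p _ => mem_validPairs.symm
  · constructor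
    · intro h
      constructor
      · intro p hp q hq hpq
        rw [Function.onFun, Finset.disjoint_left]
        intro a ha ha'
        exact hpq ((h a).unique ⟨hp, mem_pairSet.1 ha⟩ ⟨hq, mem_pairSet.1 ha'⟩)
      · ext a
        simp only [Finset.mem_biUnion, Finset.mem_univ, iff_true]
        obtain ⟨p, ⟨hp, hap⟩, -⟩ := h a
        exact ⟨p, hp, mem_pairSet.2 hap⟩
    · rintro ⟨hd, hu⟩ a
      have ha : a ∈ P.biUnion pairSet := by rw [hu]; exact Finset.mem_univ a
      obtain ⟨p, hp, hap⟩ := Finset.mem_biUnion.1 ha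
      refine ⟨p, ⟨hp, mem_pairSet.1 hap⟩, ?_⟩
      rintro q ⟨hq, haq⟩
      by_contra hne
      exact Finset.disjoint_left.1 (hd hq hp hne) (mem_pairSet.2 haq) hap

/-- Each pair covers an even, positive number of elements. Hence `m` is even and at most `m / 2`
pairs are possible, which yields both the vanishing for odd `m` and the range of `k`. -/
theorem exists_eq_of_mem_pairings {k : ℕ} {P : Finset (Sym2 (Finset (Fin m)))}
    (hP : P ∈ pairings m k) : ∃ c, m = 2 * c ∧ k ≤ c := by
  obtain ⟨hk, hv, hd, hu⟩ := mem_pairings.1 hP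
  have h1 := Finset.card_biUnion hd
  rw [hu, Finset.card_univ, Fintype.card_fin] at h1
  choose! c hc hc0 using fun p (hp : p ∈ validPairs m) => card_pairSet hp
  refine ⟨∑ p ∈ P, c p, ?_, ?_⟩
  · refine h1.trans ?_
    rw [Finset.mul_sum]
    exact Finset.sum_congr rfl fun p hp => hc p (hv hp)
  · rw [← hk, Finset.card_eq_sum_ones]
    exact Finset.sum_le_sum fun p hp => hc0 p (hv hp)

/-- Two disjoint non-empty sets are distinct, so each unordered pair comes from exactly two ordered
ones. This is the source of the `2` in `(-2) ^ k`. -/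
theorem sum_sum_eq_sum_validPairs {Z : Type*} [CommRing Z]
    (K : Finset (Fin m) → Finset (Fin m) → Z) (hK : ∀ I J, K I J = K J I)
    (h0 : ∀ I J, ¬ (I.card = J.card ∧ Disjoint I J) → K I J = 0) :
    ∑ I, ∑ J, K I J = K ∅ ∅ + 2 * ∑ p ∈ validPairs m, Sym2.lift ⟨K, hK⟩ p := by
  classical
  let X : Finset (Finset (Fin m) × Finset (Fin m)) := Finset.univ.filter fun x =>
    x.1.Nonempty ∧ x.2.Nonempty ∧ x.1.card = x.2.card ∧ Disjoint x.1 x.2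
  have h1 : ∑ I, ∑ J, K I J = K ∅ ∅ + ∑ x ∈ X, K x.1 x.2 := by
    have hnot : ((∅, ∅) : Finset (Fin m) × Finset (Fin m)) ∉ X := by simp [X]
    rw [← Fintype.sum_prod_type', ← Finset.sum_insert (f := fun x => K x.1 x.2) hnot]
    symm
    refine Finset.sum_subset (Finset.subset_univ _) fun x _ hx => h0 _ _ ?_
    rintro ⟨hc, hd⟩
    refine hx ?_
    rw [Finset.mem_insert]
    by_cases he : x.1 = ∅
    · left
      have : x.2 = ∅ := by rw [← Finset.card_eq_zero, ← hc, he]; rfl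
      exact Prod.ext he this
    · right
      have he2 : x.2 ≠ ∅ := by
        intro h
        rw [h, Finset.card_empty, Finset.card_eq_zero] at hc
        exact he hc
      simp only [X, Finset.mem_filter, Finset.mem_univ, true_and]
      exact ⟨Finset.nonempty_iff_ne_empty.2 he, Finset.nonempty_iff_ne_empty.2 he2, hc, hd⟩
  have hmaps : ∀ x ∈ X, s(x.1, x.2) ∈ validPairs m := by
    intro x hx
    simp only [X, Finset.mem_filter, Finset.mem_univ, true_and] at hx
    exact mem_validPairs.2 ⟨x.1, x.2, rfl, hx⟩
  rw [h1, ← Finset.sum_fiberwise_of_maps_to hmaps, Finset.mul_sum]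
  congr 1
  refine Finset.sum_congr rfl fun p hp => ?_
  obtain ⟨I, J, rfl, hI, hJ, hc, hd⟩ := mem_validPairs.1 hp
  have hne : I ≠ J := by
    rintro rfl
    exact hI.ne_empty (disjoint_self.1 hd)
  have hfib : (X.filter fun x => s(x.1, x.2) = s(I, J)) = {(I, J), (J, I)} := by
    ext ⟨x1, x2⟩
    simp only [X, Finset.mem_filter, Finset.mem_univ, true_and, Sym2.eq_iff, Finset.mem_insert,
      Finset.mem_singleton, Prod.mk.injEq]
    constructor
    · exact fun h => h.2
    · rintro (⟨rfl, rfl⟩ | ⟨rfl, rfl⟩)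
      · exact ⟨⟨hI, hJ, hc, hd⟩, Or.inl ⟨rfl, rfl⟩⟩
      · exact ⟨⟨hJ, hI, hc.symm, hd.symm⟩, Or.inr ⟨rfl, rfl⟩⟩
  rw [hfib, Finset.sum_pair (fun h => hne (Prod.ext_iff.1 h).1)]
  simp only [Sym2.lift_mk]
  rw [hK J I, two_mul]

/-- A common element of two pairs contributes the square of a variable. -/
theorem prod_prod_pairSet {Z : Type*} [CommRing Z] (t : Fin m → Z) (ht : ∀ k, t k * t k = 0)
    (P : Finset (Sym2 (Finset (Fin m)))) (h : ¬ (P : Set (Sym2 (Finset (Fin m)))).PairwiseDisjoint pairSet) :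
    ∏ p ∈ P, ∏ k ∈ pairSet p, t k = 0 := by
  simp only [Set.PairwiseDisjoint, Set.Pairwise] at h
  push Not at h
  obtain ⟨p, hp, q, hq, hpq, hd⟩ := h
  rw [Function.onFun, Finset.not_disjoint_iff] at hd
  obtain ⟨a, hap, haq⟩ := hd
  classical
  rw [← Finset.mul_prod_erase P _ hp, ← Finset.mul_prod_erase (P.erase p) _
    (Finset.mem_erase.2 ⟨hpq.symm, hq⟩), ← Finset.mul_prod_erase (pairSet p) _ hap,
    ← Finset.mul_prod_erase (pairSet q) _ haq]
  linear_combination (∏ x ∈ (pairSet p).erase a, t x) * (∏ x ∈ (pairSet q).erase a, t x) *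
    (∏ x ∈ (P.erase p).erase q, ∏ k ∈ pairSet x, t k) * ht a

end Pairs

/-! ### The edge coefficients of symmetric matrices -/

theorem map_delDet {S T : Type*} [CommRing S] [CommRing T] (f : S →+* T) {n : ℕ}
    (A : Matrix (Fin n) (Fin n) S) (I J : Finset (Fin n)) :
    delDet (A.map f) I J = f (delDet A I J) := by
  unfold delDet
  split_ifs
  · rw [f.map_det]
    rfl
  · rw [map_zero]

theorem delDet_empty {S : Type*} [CommRing S] {n : ℕ} (A : Matrix (Fin n) (Fin n) S) :
    delDet A ∅ ∅ = A.det := by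
  rw [delDet_eq A (f := id) (g := id) strictMono_id strictMono_id (by simp) (by simp)]
  simp

/-- The finite geometric series for a nilpotent perturbation. -/
theorem inverse_add_eq_sum {Z : Type*} [CommRing Z] {D D' x : Z} (hD : D * D' = 1) {N : ℕ}
    (hx : x ^ N = 0) : Ring.inverse (D + x) = ∑ j ∈ Finset.range N, (-x) ^ j * D' ^ (j + 1) := by
  have h1 : (D + x) * ∑ j ∈ Finset.range N, (-x) ^ j * D' ^ (j + 1) = 1 := by
    have key : ∀ N, (D + x) * ∑ j ∈ Finset.range N, (-x) ^ j * D' ^ (j + 1) =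
        1 - (-x) ^ N * D' ^ N := by
      intro N
      induction N with
      | zero => simp
      | succ N ih =>
        rw [Finset.sum_range_succ, mul_add, ih]
        have : D * D' ^ (N + 1) = D' ^ N := by rw [pow_succ', ← mul_assoc, hD, one_mul]
        linear_combination (-x) ^ N * this
    rw [key, neg_pow, hx]
    simp
  have hu : IsUnit (D + x) := IsUnit.of_mul_eq_one _ h1
  exact (hu.mul_left_cancel ((Ring.mul_inverse_cancel _ hu).trans h1.symm))

/-- The coefficient of the product of all variables of square zero in the inverse of the determinant
of the sum of a symmetric matrix and skew-symmetric elementary matrices. -/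
theorem coeff_inverse_det {S Z : Type*} [CommRing S] [CommRing Z]
    {n m : ℕ} (hm : 0 < m) {A : Matrix (Fin n) (Fin n) S} (hA : A.IsSymm) (hdet : IsUnit A.det)
    (ℰ : Fin m → Fin n × Fin n) (f : S →+* Z) (hZ : ∀ n : ℕ, n ≠ 0 → IsUnit (n : Z)) (t : Fin m → Z)
    (ht : ∀ k, t k * t k = 0) (c : Z →+ S) (hc : ∀ s z, c (f s * z) = s * c z)
    (hc0 : ∀ I : Finset (Fin m), I ≠ Finset.univ → c (∏ k ∈ I, t k) = 0) (hc1 : c (∏ k, t k) = 1) :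
    c (Ring.inverse (A.map f + ∑ k, t k • skew Z (ℰ k).1 (ℰ k).2).det) =
      ∑ j ∈ Finset.Icc 1 (m / 2), (-2) ^ j * (j.factorial : S) * Q A hA ℰ j *
        Ring.inverse A.det ^ (j + 1) := by
  classical
  have hAf : (A.map f).IsSymm := by
    rw [Matrix.IsSymm, ← Matrix.transpose_map, hA.eq]
  let K (I J : Finset (Fin m)) : Z := if I.card = J.card then
    (∏ k ∈ I, t k) * (∏ k ∈ J, t k) * ((sigmaSign (tupleOf ℰ I) : Z) *
      (sigmaSign (tupleOf ℰ J) : Z) *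
        delDet (A.map f) (tupleOf ℰ I).toFinset (tupleOf ℰ J).toFinset) else 0
  have hK (I J) : K I J = K J I := by
    simp only [K, eq_comm (a := J.card)]
    rw [delDet_comm hAf]
    congr 1
    ring
  have h0 (I J : Finset (Fin m)) (h : ¬ (I.card = J.card ∧ Disjoint I J)) : K I J = 0 := by
    by_cases hc : I.card = J.card
    · have hd : ¬ Disjoint I J := fun hd => h ⟨hc, hd⟩
      obtain ⟨a, ha, ha'⟩ := Finset.not_disjoint_iff.1 hd
      simp only [K, if_pos hc]
      have : (∏ k ∈ I, t k) * (∏ k ∈ J, t k) = 0 := by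
        rw [← Finset.mul_prod_erase I _ ha, ← Finset.mul_prod_erase J _ ha']
        linear_combination (∏ x ∈ I.erase a, t x) * (∏ x ∈ J.erase a, t x) * ht a
      rw [this, zero_mul]
    · simp only [K, if_neg hc]
  let τ (p : Sym2 (Finset (Fin m))) : Z := f (pairTerm A hA ℰ p) * ∏ k ∈ pairSet p, t k
  have hτ (p) (hp : p ∈ validPairs m) : Sym2.lift ⟨K, hK⟩ p = τ p := by
    obtain ⟨I, J, rfl, hI, hJ, hc, hd⟩ := mem_validPairs.1 hp
    simp only [Sym2.lift_mk, K, if_pos hc, τ, pairTerm, pairSet_mk, Finset.prod_union hd, map_mul,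
      map_intCast, map_delDet]
    ring
  have hdetsum : (A.map f + ∑ k, t k • skew Z (ℰ k).1 (ℰ k).2).det =
      f A.det + 2 * ∑ p ∈ validPairs m, τ p := by
    rw [det_add_sum_skew hZ hAf ℰ t ht]
    refine (sum_sum_eq_sum_validPairs K hK h0).trans ?_
    congr 1
    · have h1 : tupleOf ℰ ∅ = [] := by simp [tupleOf]
      have h2 : sigmaSign ([] : List (Fin n)) = 1 := by
        have h3 : Tuple.sort (([] : List (Fin n)).get) = 1 := Equiv.ext fun i => i.elim0
        rw [sigmaSign_of_nodup List.nodup_nil, h3]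
        simp
      simp only [K, h1, h2, if_true, List.toFinset_nil, delDet_empty, f.map_det]
      simp
    · rw [Finset.sum_congr rfl hτ]
  set U := ∑ p ∈ validPairs m, τ p with hU
  -- the powers of the sum over all pairs
  have hτ2 (p) (hp : p ∈ validPairs m) : τ p * τ p = 0 := by
    obtain ⟨d, hd, hd0⟩ := card_pairSet hp
    obtain ⟨a, ha⟩ : (pairSet p).Nonempty := by
      rw [← Finset.card_pos]; omega
    simp only [τ]
    rw [← Finset.mul_prod_erase _ _ ha]
    linear_combination (f (pairTerm A hA ℰ p)) ^ 2 * (∏ k ∈ (pairSet p).erase a, t k) ^ 2 * ht a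
  have hpow (j : ℕ) : U ^ j = (j.factorial : Z) *
      ∑ P ∈ (validPairs m).powersetCard j, ∏ p ∈ P, τ p := by
    -- The expansion requires every summand to have square zero, which is known only for valid
    -- pairs; the others are replaced by zero.
    have h1 := sum_pow_eq_factorial_mul (fun p => if p ∈ validPairs m then τ p else 0)
      (fun p => by split_ifs with hp; exacts [hτ2 p hp, mul_zero _]) (validPairs m) j
    rw [Finset.sum_congr rfl (fun p hp => if_pos hp)] at h1
    rw [hU, h1]
    congr 1
    refine Finset.sum_congr rfl fun P hP => Finset.prod_congr rfl fun p hp => ?_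
    exact if_pos ((Finset.mem_powersetCard.1 hP).1 hp)
  have hprod (P : Finset (Sym2 (Finset (Fin m)))) : ∏ p ∈ P, τ p =
      f (∏ p ∈ P, pairTerm A hA ℰ p) * ∏ p ∈ P, ∏ k ∈ pairSet p, t k := by
    simp only [τ, Finset.prod_mul_distrib, map_prod]
  -- Each pair uses up at least one of the `m` variables, so `m + 1` pairs cannot be disjoint.
  have hUm : U ^ (m + 1) = 0 := by
    rw [hpow, Finset.sum_eq_zero, mul_zero]
    intro P hP
    obtain ⟨hPv, hPc⟩ := Finset.mem_powersetCard.1 hP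
    rw [hprod, prod_prod_pairSet t ht, mul_zero]
    intro hd
    have h1 := Finset.card_biUnion hd
    have h2 := Finset.card_le_univ (P.biUnion pairSet)
    rw [Fintype.card_fin] at h2
    have h3 : P.card ≤ ∑ p ∈ P, (pairSet p).card := by
      rw [Finset.card_eq_sum_ones]
      refine Finset.sum_le_sum fun p hp => ?_
      obtain ⟨d, hd, hd0⟩ := card_pairSet (hPv hp)
      omega
    omega
  -- A set of pairs contributes to the top coefficient exactly if the pairs are disjoint and cover
  -- everything, that is, if it belongs to `pairings m j`.
  have htop (j : ℕ) : c (U ^ j) = (j.factorial : S) * Q A hA ℰ j := by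
    have h1 : (j.factorial : Z) = f (j.factorial : S) := by simp
    rw [hpow, h1, hc, map_sum]
    congr 1
    rw [Q]
    symm
    refine Finset.sum_subset_zero_on_sdiff (fun P hP => ?_) (fun P hP => ?_) (fun P hP => ?_)
    · obtain ⟨hk, hv, -⟩ := mem_pairings.1 hP
      exact Finset.mem_powersetCard.2 ⟨hv, hk⟩
    · obtain ⟨hP1, hP2⟩ := Finset.mem_sdiff.1 hP
      obtain ⟨hPv, hPc⟩ := Finset.mem_powersetCard.1 hP1
      rw [hprod, hc]
      by_cases hd : (P : Set (Sym2 (Finset (Fin m)))).PairwiseDisjoint pairSet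
      · rw [← Finset.prod_biUnion hd, hc0, mul_zero]
        exact fun hu => hP2 (mem_pairings.2 ⟨hPc, hPv, hd, hu⟩)
      · rw [prod_prod_pairSet t ht _ hd, map_zero, mul_zero]
    · obtain ⟨hPc, hPv, hd, hu⟩ := mem_pairings.1 hP
      rw [hprod, hc, ← Finset.prod_biUnion hd, hu, hc1,
        mul_one]
  have hD : f A.det * f (Ring.inverse A.det) = 1 := by
    rw [← map_mul, Ring.mul_inverse_cancel _ hdet, map_one]
  rw [hdetsum, inverse_add_eq_sum hD (N := m + 1) (by rw [mul_pow, hUm, mul_zero]), map_sum]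
  have hterm (j : ℕ) : c ((-(2 * U)) ^ j * f (Ring.inverse A.det) ^ (j + 1)) =
      (-2) ^ j * (j.factorial : S) * Q A hA ℰ j * Ring.inverse A.det ^ (j + 1) := by
    have h1 : (-(2 * U)) ^ j * f (Ring.inverse A.det) ^ (j + 1) =
        f ((-2) ^ j * Ring.inverse A.det ^ (j + 1)) * U ^ j := by
      have h2 : f 2 = 2 := map_ofNat f 2
      rw [map_mul, map_pow, map_pow, map_neg, h2]
      ring
    rw [h1, hc, htop]
    ring
  rw [Finset.sum_congr rfl fun j _ => hterm j]
  symm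
  refine Finset.sum_subset (fun j hj => ?_) (fun j _ hj => ?_)
  · rw [Finset.mem_Icc] at hj
    rw [Finset.mem_range]
    omega
  -- Outside the range either `j > m / 2`, or `j = 0`, where no pair covers the element `0` of `Fin
  -- m`; here `m > 0` enters.
  · have : Q A hA ℰ j = 0 := by
      rw [Q, Finset.sum_eq_zero]
      intro P hP
      exfalso
      obtain ⟨d, hd, hjd⟩ := exists_eq_of_mem_pairings hP
      rw [Finset.mem_Icc] at hj
      obtain rfl : j = 0 := by omega
      obtain ⟨hP0, -, -, hu⟩ := mem_pairings.1 hP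
      rw [Finset.card_eq_zero] at hP0
      rw [hP0, Finset.biUnion_empty] at hu
      have := Finset.mem_univ (⟨0, hm⟩ : Fin m)
      rw [← hu] at this
      simp at this
    rw [this]
    simp

/-- The edge coefficient of a symmetric matrix. -/
theorem edgeCoeff_eq_sum_Q {S : Type u} [CommRing S] (hS : ∀ n : ℕ, n ≠ 0 → IsUnit (n : S))
    {n m : ℕ} (hm : 0 < m) {A : Matrix (Fin n) (Fin n) S} (hA : A.IsSymm) (hdet : IsUnit A.det)
    (ℰ : Fin m → Fin n × Fin n) : edgeCoeff (List.ofFn ℰ) A =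
      ∑ j ∈ Finset.Icc 1 (m / 2), (-2) ^ j * (j.factorial : S) * Q A hA ℰ j *
        Ring.inverse A.det ^ (j + 1) := by
  rw [edgeCoeff_eq_topCoeff m hS hdet]
  refine coeff_inverse_det hm hA hdet ℰ (algebraMap S (SqZeroAlg S m)) (fun n hn => ?_)
    (sqZeroVar S m) (sqZeroVar_mul_self S m) (topCoeff S m).toAddMonoidHom
    (topCoeff_algebraMap_mul m) (fun I hI => topCoeff_prod_eq_zero S m hI) (topCoeff_prod_univ m hS)
  simpa using (hS n hn).map (algebraMap S (SqZeroAlg S m))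

theorem edgeCoeff_eq_zero_of_odd {S : Type u} [CommRing S]
    (hS : ∀ n : ℕ, n ≠ 0 → IsUnit (n : S)) {n m : ℕ} (hm : Odd m) {A : Matrix (Fin n) (Fin n) S}
    (hA : A.IsSymm) (hdet : IsUnit A.det) (ℰ : Fin m → Fin n × Fin n) :
    edgeCoeff (List.ofFn ℰ) A = 0 := by
  rw [edgeCoeff_eq_sum_Q hS hm.pos hA hdet, Finset.sum_eq_zero]
  intro j _
  have : Q A hA ℰ j = 0 := by
    rw [Q, Finset.sum_eq_zero]
    intro P hP
    obtain ⟨c, hc, -⟩ := exists_eq_of_mem_pairings hP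
    exact absurd hm (by rw [hc, Nat.not_odd_iff_even]; exact even_two_mul c)
  rw [this]
  simp

/-! ### The terms of highest degree in the diagonal letters -/

section Expansion

variable {S : Type u} [CommRing S] {M : Type*} [AddCommGroup M] [Module S M]

/-- The matrix of elements of degree one with given entries. -/
def oneForms {n : ℕ} (u : Fin n × Fin n → M) : Matrix (Fin n) (Fin n) (ExteriorAlgebra S M) :=
  Matrix.of fun i j => ExteriorAlgebra.ι S (u (i, j))

variable (S) in
/-- The span of the products of `2n-1` letters with less than `n` diagonal letters. -/
def lowerSpan {n : ℕ} (u : Fin n × Fin n → M) : Submodule S (ExteriorAlgebra S M) :=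
  Submodule.span S {θ | ∃ ν : Fin (2 * n - 1) → Fin n × Fin n,
    (Finset.univ.filter fun r => (ν r).1 = (ν r).2).card < n ∧
    θ = (List.ofFn fun r => ExteriorAlgebra.ι S (u (ν r))).prod}

theorem sum_tens_letterMat {n : ℕ} {Λ : Type*} [Ring Λ] (φ : S →+* Λ) (θ : Fin n × Fin n → Λ)
    (hθ : ∀ i j, θ (i, j) = θ (j, i)) :
    (∑ q, if q.1 ≤ q.2 then tens φ (letterMat S q) (θ q) else 0) =
      Matrix.of fun i j => θ (i, j) := by
  ext i j
  have key (q : Fin n × Fin n) : (if q.1 ≤ q.2 then tens φ (letterMat S q) (θ q) else 0) i j =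
      if q = (min i j, max i j) then θ (i, j) else 0 := by
    obtain ⟨a, b⟩ := q
    have hent : tens φ (letterMat S (a, b)) (θ (a, b)) i j =
        if a = b then (if a = i ∧ a = j then θ (a, a) else 0) else
          (if a = i ∧ b = j then θ (a, b) else 0) + if b = i ∧ a = j then θ (a, b) else 0 := by
      rw [letterMat]
      by_cases hab : a = b
      · subst hab
        simp [tens_single, Matrix.single_apply]
      · simp [hab, tens_add, tens_single, Matrix.single_apply]
    split_ifs with h1 h2 h2
    · rw [hent]
      simp only [Prod.mk.injEq] at h2
      obtain ⟨rfl, rfl⟩ := h2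
      rcases lt_trichotomy i j with h | rfl | h
      · simp [min_eq_left h.le, max_eq_right h.le, h.ne, h.ne']
      · simp
      · simp [min_eq_right h.le, max_eq_left h.le, h.ne, h.ne', hθ j i]
    · rw [hent]
      simp only [Prod.mk.injEq] at h2
      change a ≤ b at h1
      split_ifs with h3 h4 h4 h5 h5
      · exfalso; apply h2; obtain ⟨rfl, h4⟩ := h4; subst h4; simp [h3.symm]
      · rfl
      · exfalso; apply h2; obtain ⟨rfl, rfl⟩ := h4; simp [h1]
      · exfalso; apply h2; obtain ⟨rfl, rfl⟩ := h4; simp [h1]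
      · exfalso; apply h2; obtain ⟨rfl, rfl⟩ := h5; simp [h1]
      · simp
    · exfalso
      apply h1
      obtain ⟨rfl, rfl⟩ := Prod.mk.injEq _ _ _ _ ▸ h2
      exact min_le_max
    · rfl
  rw [Matrix.sum_apply]
  simp only [key]
  simp

/-- At least `n` distinct diagonal letters are all of them, and the other `n - 1` letters form `ℰ`.
-/
theorem exists_lexEnum_perm {m : ℕ} {f : Fin (2 * (m + 1) - 1) → Fin (m + 1) × Fin (m + 1)}
    (hf : Function.Injective f) (hle : ∀ r, (f r).1 ≤ (f r).2)
    (hd : ¬ (Finset.univ.filter fun r => (f r).1 = (f r).2).card < m + 1) :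
    ∃ (ℰ : OffDiag (m + 1)) (π : Equiv.Perm (Fin (2 * (m + 1) - 1))),
      f = fun r => lexEnum (diagPairs (m + 1) ∪ ℰ.1) (card_diag_union ℰ) (π r) := by
  classical
  have hdiag : (Finset.univ.filter fun r => (f r).1 = (f r).2).image f = diagPairs (m + 1) := by
    refine Finset.eq_of_subset_of_card_le ?_ ?_
    · intro q hq
      obtain ⟨r, hr, rfl⟩ := Finset.mem_image.1 hq
      simpa [diagPairs] using hr
    · rw [Finset.card_image_of_injective _ hf]
      have : (diagPairs (m + 1)).card = m + 1 := by
        rw [Finset.card_eq_sum_ones, sum_diagPairs]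
        simp
      omega
  have hoff : ((Finset.univ.filter fun r => ¬ (f r).1 = (f r).2).image f).card = m + 1 - 1 := by
    rw [Finset.card_image_of_injective _ hf]
    have h1 := Finset.card_filter_add_card_filter_not (s := (Finset.univ : Finset (Fin (2 * (m + 1) - 1))))
      (fun r => (f r).1 = (f r).2)
    have h2 : (Finset.univ.filter fun r => (f r).1 = (f r).2).card = m + 1 := by
      rw [← Finset.card_image_of_injective _ hf, hdiag, Finset.card_eq_sum_ones, sum_diagPairs]
      simp
    rw [Finset.card_univ, Fintype.card_fin] at h1
    omega
  let ℰ : OffDiag (m + 1) := ⟨(Finset.univ.filter fun r => ¬ (f r).1 = (f r).2).image f, by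
    intro q hq
    obtain ⟨r, hr, rfl⟩ := Finset.mem_image.1 hq
    exact lt_of_le_of_ne (hle r) (Finset.mem_filter.1 hr).2, hoff⟩
  have himage : ∀ r, f r ∈ diagPairs (m + 1) ∪ ℰ.1 := by
    intro r
    by_cases h : (f r).1 = (f r).2
    · exact Finset.mem_union_left _ (by simpa [diagPairs] using h)
    · exact Finset.mem_union_right _ (Finset.mem_image.2 ⟨r, by simpa using h, rfl⟩)
  have hex (r) : ∃ s, lexEnum (diagPairs (m + 1) ∪ ℰ.1) (card_diag_union ℰ) s = f r := by
    have h1 : f r ∈ Set.range (lexEnum (diagPairs (m + 1) ∪ ℰ.1) (card_diag_union ℰ)) := by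
      rw [range_lexEnum]
      exact himage r
    exact h1
  choose p hp using hex
  have hpi : Function.Injective p := fun a b hab => hf (by rw [← hp a, ← hp b, hab])
  exact ⟨ℰ, Equiv.ofBijective p (Finite.injective_iff_bijective.1 hpi), funext fun r => (hp r).symm⟩

/-- The expansion of the trace up to terms of lower degree in the diagonal letters. -/
theorem trace_pow_eq_add_lower (hS : ∀ n : ℕ, n ≠ 0 → IsUnit (n : S)) {m : ℕ}
    {A : Matrix (Fin (m + 1)) (Fin (m + 1)) S} (hA : IsUnit A.det)
    (u : Fin (m + 1) × Fin (m + 1) → M) (hu : ∀ i j, u (i, j) = u (j, i)) :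
    ∃ η ∈ lowerSpan S u,
      ((A⁻¹.map (algebraMap S (ExteriorAlgebra S M)) * oneForms u) ^ (2 * (m + 1) - 1)).trace =
        ∑ ℰ : OffDiag (m + 1), (((2 * m + 1 : ℕ) : S) *
          edgeCoeff (List.ofFn (lexEnum ℰ.1 ℰ.2.2)) A * (-1) ^ m) •
            omegaType (oneForms u) (diagPairs (m + 1) ∪ ℰ.1) (card_diag_union ℰ) + η := by
  classical
  let Λ := ExteriorAlgebra S M
  let φ : S →+* Λ := algebraMap S Λ
  have h := oddSetting_exterior (M := M) hS
  -- By symmetry only the letters with `q.1 ≤ q.2` are used, each with its symmetric elementary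
  -- matrix; the zero value keeps the index set equal to all pairs.
  let N (q : Fin (m + 1) × Fin (m + 1)) : Matrix (Fin (m + 1)) (Fin (m + 1)) S :=
    if q.1 ≤ q.2 then A⁻¹ * letterMat S q else 0
  let θ (q : Fin (m + 1) × Fin (m + 1)) : Λ := ExteriorAlgebra.ι S (u q)
  have hX : A⁻¹.map φ * oneForms u = ∑ q, tens φ (N q) (θ q) := by
    rw [oneForms, ← sum_tens_letterMat φ θ fun i j =>
      congrArg (ExteriorAlgebra.ι S) (hu i j), map_eq_tens,
      Finset.mul_sum]
    refine Finset.sum_congr rfl fun q _ => ?_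
    simp only [N]
    split_ifs
    · rw [tens_mul h, one_mul]
    · rw [mul_zero, tens_zero_left]
  let g (f : Fin (2 * (m + 1) - 1) → Fin (m + 1) × Fin (m + 1)) : Λ :=
    φ (List.ofFn fun i => N (f i)).prod.trace * (List.ofFn fun i => θ (f i)).prod
  let F (x : OffDiag (m + 1) × Equiv.Perm (Fin (2 * (m + 1) - 1))) :
      Fin (2 * (m + 1) - 1) → Fin (m + 1) × Fin (m + 1) :=
    fun r => lexEnum (diagPairs (m + 1) ∪ x.1.1) (card_diag_union x.1) (x.2 r)
  have hF : Function.Injective F := by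
    rintro ⟨ℰ, π⟩ ⟨ℰ', π'⟩ hx
    have hr (ℰ : OffDiag (m + 1)) (π) : Set.range (F (ℰ, π)) = (diagPairs (m + 1) ∪ ℰ.1 : Finset _) := by
      rw [← range_lexEnum _ (card_diag_union ℰ)]
      exact π.surjective.range_comp (lexEnum (diagPairs (m + 1) ∪ ℰ.1) (card_diag_union ℰ))
    have h1 : diagPairs (m + 1) ∪ ℰ.1 = diagPairs (m + 1) ∪ ℰ'.1 := by
      rw [← Finset.coe_inj, ← hr ℰ π, ← hr ℰ' π', hx]
    have h2 (ℰ : OffDiag (m + 1)) : ℰ.1 = (diagPairs (m + 1) ∪ ℰ.1) \ diagPairs (m + 1) := by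
      rw [Finset.union_sdiff_cancel_left (disjoint_diagPairs ℰ)]
    have h3 : ℰ = ℰ' := Subtype.ext (by rw [h2 ℰ, h2 ℰ', h1])
    subst h3
    refine Prod.ext rfl (Equiv.ext fun r => ?_)
    exact lexEnum_injective _ _ (congrFun hx r)
  have hFle (x) (r) : (F x r).1 ≤ (F x r).2 := by
    have := lexEnum_mem (diagPairs (m + 1) ∪ x.1.1) (card_diag_union x.1) (x.2 r)
    rcases Finset.mem_union.1 this with h' | h'
    · exact (Finset.mem_filter.1 h').2.le
    · exact (x.1.2.1 _ h').le
  have htr : ((A⁻¹.map φ * oneForms u) ^ (2 * (m + 1) - 1)).trace = ∑ f, g f := by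
    rw [hX, h.trace_sum_tens_pow]
  -- The words enumerating a type `diag ∪ ℰ` are exactly the image of `F`. Any other word is of
  -- lower degree, repeats a letter, or uses a pair below the diagonal, and in the last two cases it
  -- vanishes.
  refine ⟨∑ f ∈ (Finset.univ.image F)ᶜ, g f, Submodule.sum_mem _ fun f hf => ?_, ?_⟩
  · by_cases hd : (Finset.univ.filter fun r => (f r).1 = (f r).2).card < m + 1
    · have : g f = (List.ofFn fun i => N (f i)).prod.trace • (List.ofFn fun i => θ (f i)).prod := by
        rw [Algebra.smul_def]
      rw [this]
      exact Submodule.smul_mem _ _ (Submodule.subset_span ⟨f, hd, rfl⟩)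
    · have : g f = 0 := by
        by_cases hi : Function.Injective f
        · by_cases hle : ∀ r, (f r).1 ≤ (f r).2
          · obtain ⟨ℰ, π, hfe⟩ := exists_lexEnum_perm hi hle hd
            rw [Finset.mem_compl] at hf
            exact absurd (Finset.mem_image.2 ⟨(ℰ, π), Finset.mem_univ _, hfe.symm⟩) hf
          · push Not at hle
            obtain ⟨r, hr⟩ := hle
            have h0 : (List.ofFn fun i => N (f i)).prod = 0 := by
              rw [List.prod_eq_zero]
              exact List.mem_ofFn.2 ⟨r, if_neg (not_le.2 hr)⟩
            simp only [g, h0, Matrix.trace_zero, map_zero, zero_mul]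
        · have h0 : (List.ofFn fun i => θ (f i)).prod = 0 := by
            have h1 := ExteriorAlgebra.ιMulti_eq_zero_of_not_inj (R := S) (v := u ∘ f)
              fun hi' => hi hi'.of_comp
            rwa [ExteriorAlgebra.ιMulti_apply] at h1
          simp only [g, h0, mul_zero]
      rw [this]
      exact Submodule.zero_mem _
  · rw [htr, ← Finset.sum_add_sum_compl (Finset.univ.image F)]
    congr 1
    rw [Finset.sum_image fun _ _ _ _ hab => hF hab, Fintype.sum_prod_type]
    refine Finset.sum_congr rfl fun ℰ _ => ?_
    have h1 := sum_perm_ιMulti (M := M) (fun r => A⁻¹ * letterMat S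
      (lexEnum (diagPairs (m + 1) ∪ ℰ.1) (card_diag_union ℰ) r))
      (fun r => u (lexEnum (diagPairs (m + 1) ∪ ℰ.1) (card_diag_union ℰ) r))
    rw [stdTrace_letters hS ℰ hA] at h1
    have h2 (π : Equiv.Perm (Fin (2 * (m + 1) - 1))) : g (F (ℰ, π)) = algebraMap S Λ
        (List.ofFn fun i => A⁻¹ * letterMat S
          (lexEnum (diagPairs (m + 1) ∪ ℰ.1) (card_diag_union ℰ) (π i))).prod.trace *
        (List.ofFn fun i => ExteriorAlgebra.ι S
          (u (lexEnum (diagPairs (m + 1) ∪ ℰ.1) (card_diag_union ℰ) (π i)))).prod := by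
      have h3 (r) : N (F (ℰ, π) r) = A⁻¹ * letterMat S (F (ℰ, π) r) := if_pos (hFle _ r)
      simp only [g, h3]
      rfl
    rw [Finset.sum_congr rfl fun π _ => h2 π, h1, Algebra.smul_def, ← mul_assoc (_ * _), map_mul,
      mul_assoc]
    congr 1

theorem trace_pow_mem_lowerSpan (hS : ∀ n : ℕ, n ≠ 0 → IsUnit (n : S)) {m : ℕ}
    (heven : Even (m + 1)) {A : Matrix (Fin (m + 1)) (Fin (m + 1)) S} (hA : A.IsSymm)
    (hdet : IsUnit A.det) (u : Fin (m + 1) × Fin (m + 1) → M) (hu : ∀ i j, u (i, j) = u (j, i)) :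
    ((A⁻¹.map (algebraMap S (ExteriorAlgebra S M)) * oneForms u) ^ (2 * (m + 1) - 1)).trace ∈
      lowerSpan S u := by
  obtain ⟨η, hη, h⟩ := trace_pow_eq_add_lower hS hdet u hu
  have hm : Odd (m + 1 - 1) := by
    rcases Nat.even_or_odd m with h' | h'
    · exact absurd heven (Nat.not_even_iff_odd.2 h'.add_one)
    · exact h'
  rw [h, Finset.sum_eq_zero, zero_add]
  · exact hη
  · intro ℰ _
    rw [edgeCoeff_eq_zero_of_odd hS hm hA hdet (lexEnum ℰ.1 ℰ.2.2)]
    simp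

end Expansion

/-! ### The expansion for symmetric matrices. -/

section PartOne

theorem isUnit_natCast_of_algebra (k : Type*) [Field k] [CharZero k] {S : Type*} [CommRing S]
    [Algebra k S] (n : ℕ) (hn : n ≠ 0) : IsUnit (n : S) := by
  simpa using (IsUnit.mk0 (n : k) (Nat.cast_ne_zero.2 hn)).map (algebraMap k S)

variable (k : Type*) [Field k] [CharZero k] {S : Type u} [CommRing S] [Algebra k S]

theorem lowerDiagTerms_eq {n : ℕ} (A : Matrix (Fin n) (Fin n) S) : lowerDiagTerms k A =
    lowerSpan S fun q : Fin n × Fin n => KaehlerDifferential.D k S (A q.1 q.2) := rfl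

theorem invForm_eq_leadingTerms_add {m : ℕ} (hm : 0 < m) {A : Matrix (Fin (m + 1)) (Fin (m + 1)) S}
    (hA : A.IsSymm) (hdet : IsUnit A.det) (hodd : Odd (m + 1)) : ∃ η ∈ lowerDiagTerms k A,
      invForm k A (2 * (m + 1) - 1) = leadingTerms k A hA A.det + η := by
  obtain ⟨η, hη, h⟩ := trace_pow_eq_add_lower (isUnit_natCast_of_algebra k) hdet
    (fun q => KaehlerDifferential.D k S (A q.1 q.2))
    (fun i j => congrArg _ (congrFun (congrFun hA.eq j) i))
  refine ⟨η, hη, h.trans ?_⟩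
  congr 1
  rw [leadingTerms, Finset.smul_sum]
  refine Finset.sum_congr rfl fun ℰ _ => ?_
  have hme : Even m := by
    rcases Nat.even_or_odd m with h' | h'
    · exact h'
    · exact absurd hodd (Nat.not_odd_iff_even.2 h'.add_one)
  rw [edgeCoeff_eq_sum_Q (isUnit_natCast_of_algebra k) hm hA hdet (lexEnum ℰ.1 ℰ.2.2),
    hme.neg_one_pow, mul_one, mul_smul, Finset.sum_smul]
  congr 1
  push_cast
  ring

theorem invForm_mem_lowerDiagTerms {m : ℕ} {A : Matrix (Fin (m + 1)) (Fin (m + 1)) S}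
    (hA : A.IsSymm) (hdet : IsUnit A.det) (heven : Even (m + 1)) :
    invForm k A (2 * (m + 1) - 1) ∈ lowerDiagTerms k A :=
  trace_pow_mem_lowerSpan (isUnit_natCast_of_algebra k) heven hA hdet
    (fun q => KaehlerDifferential.D k S (A q.1 q.2))
    (fun i j => congrArg _ (congrFun (congrFun hA.eq j) i))

end PartOne

/-! ### Adding a scalar odd matrix -/

namespace OddSetting

variable {S Λ : Type*} [CommRing S] [Ring Λ] {φ : S →+* Λ} {V : AddSubgroup Λ}
variable {m : Type*} [Fintype m] [DecidableEq m]

theorem trace_even_pow (h : OddSetting φ V) {X : Matrix m m Λ} (hX : ∀ i j, X i j ∈ V) {r : ℕ}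
    (hr : Even r) (hr0 : r ≠ 0) : (X ^ r).trace = 0 := by
  obtain ⟨j, rfl⟩ : ∃ j, r = j + 2 := ⟨r - 2, by
    obtain ⟨s, rfl⟩ := hr
    omega⟩
  have hj : Even j := by simpa [Nat.even_add] using hr
  have h2 : X ^ (j + 2) = X ^ j * (X * X) := by rw [pow_add, pow_two]
  have h3 : X ^ (j + 2) = X * (X ^ j * X) := by
    rw [show j + 2 = 1 + (j + 1) by ring, pow_add, pow_one, pow_succ]
  refine h.eq_zero_of_two ?_
  nth_rewrite 1 [h3]
  rw [h2]
  simp only [Matrix.trace, Matrix.diag_apply, Matrix.mul_apply, Finset.mul_sum]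
  rw [← Finset.sum_neg_distrib]
  simp only [← Finset.sum_neg_distrib]
  refine Finset.sum_comm.trans (Finset.sum_congr rfl fun i _ => ?_)
  refine Finset.sum_comm.trans (Finset.sum_congr rfl fun l _ => ?_)
  refine Finset.sum_congr rfl fun k _ => ?_
  rw [← mul_assoc, ← (h.even_pow_central hX hj _ _ _).eq, mul_assoc,
    h.anticomm (hX _ _) (hX _ _), mul_neg]

/-- The scalar matrix `θ` anticommutes with `X` and has square zero, so `(X + θ) ^ 2 = X ^ 2`. What
is left over is `tr (X ^ (2r)) θ`, and traces of positive even powers vanish. -/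
theorem trace_add_diagonal_pow (h : OddSetting φ V) {X : Matrix m m Λ} (hX : ∀ i j, X i j ∈ V)
    {θ : Λ} (hθ : θ ∈ V) {r : ℕ} (hr : r ≠ 0) :
    ((X + Matrix.diagonal fun _ => θ) ^ (2 * r + 1)).trace = (X ^ (2 * r + 1)).trace := by
  have h1 : X * (Matrix.diagonal fun _ => θ) + (Matrix.diagonal fun _ => θ) * X = 0 := by
    ext i j
    rw [Matrix.add_apply, Matrix.mul_diagonal, Matrix.diagonal_mul, h.anticomm (hX _ _) hθ]
    simp
  have h2 : (X + Matrix.diagonal fun _ => θ) ^ 2 = X ^ 2 := by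
    have h3 : (Matrix.diagonal fun _ : m => θ) * (Matrix.diagonal fun _ => θ) = 0 := by
      rw [Matrix.diagonal_mul_diagonal, h.sq θ hθ, Matrix.diagonal_zero]
    have h4 (D : Matrix m m Λ) : (X + D) ^ 2 = X ^ 2 + (X * D + D * X) + D * D := by
      rw [pow_two, pow_two, mul_add, add_mul, add_mul]
      abel
    rw [h4, h1, h3, add_zero, add_zero]
  rw [pow_succ, pow_mul, h2, ← pow_mul, mul_add, Matrix.trace_add, ← pow_succ]
  simp only [Matrix.trace, Matrix.diag_apply, Matrix.mul_diagonal]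
  rw [← Finset.sum_mul]
  have := h.trace_even_pow hX (even_two_mul r) (by omega)
  simp only [Matrix.trace, Matrix.diag_apply] at this
  rw [this, zero_mul, add_zero]

end OddSetting

/-! ### Vanishing of products of many letters in a small span -/

section Vanishing

variable {S : Type u} [CommRing S] {M : Type*} [AddCommGroup M] [Module S M]

theorem AlternatingMap.eq_zero_of_mem_span {N ι κ : Type*} [AddCommGroup N] [Module S N]
    [Fintype ι] [DecidableEq ι] [Fintype κ] [DecidableEq κ] (f : M [⋀^ι]→ₗ[S] N) (v : κ → M)
    (x : ι → M) (s : Finset ι) (hs : Fintype.card κ < s.card)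
    (hx : ∀ i ∈ s, x i ∈ Submodule.span S (Set.range v)) : f x = 0 := by
  have hx' (i : ι) : ∃ a : κ → S, i ∈ s → ∑ j, a j • v j = x i := by
    by_cases hi : i ∈ s
    · have := hx i hi
      rw [← Fintype.range_linearCombination] at this
      obtain ⟨a, ha⟩ := this
      exact ⟨a, fun _ => ha⟩
    · exact ⟨0, fun h => absurd h hi⟩
  choose a ha using hx'
  -- The value `none` stands for an argument that is left as it is, `some j` for the `j`-th vector
  -- of the spanning family; with fewer vectors than positions in `s`, one of them is used twice.
  let c (i : ι) (o : Option κ) : S := o.elim 1 (a i)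
  let w (i : ι) (o : Option κ) : M := o.elim (x i) v
  let T (i : ι) : Finset (Option κ) := if i ∈ s then Finset.univ.image some else {none}
  have hsum : x = fun i => ∑ o ∈ T i, c i o • w i o := by
    funext i
    simp only [T]
    split_ifs with hi
    · rw [Finset.sum_image fun _ _ _ _ h => Option.some_injective _ h]
      exact (ha i hi).symm
    · simp [c, w]
  have hmul := MultilinearMap.map_sum_finset f.toMultilinearMap (fun i o => c i o • w i o) T
  rw [← hsum] at hmul
  refine hmul.trans (Finset.sum_eq_zero fun r hr => ?_)
  rw [f.toMultilinearMap.map_smul_univ (fun i => c i (r i)) fun i => w i (r i)]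
  have hsome : ∀ i ∈ s, r i ∈ Finset.univ.image (some : κ → Option κ) := fun i hi => by
    have := Fintype.mem_piFinset.1 hr i
    rwa [show T i = Finset.univ.image some from if_pos hi] at this
  obtain ⟨p, hp, q, hq, hpq, hrpq⟩ := Finset.exists_ne_map_eq_of_card_lt_of_maps_to
    (t := Finset.univ.image (some : κ → Option κ))
    (by rwa [Finset.card_image_of_injective _ (Option.some_injective _), Finset.card_univ])
    (f := r) hsome
  have : f (fun i => w i (r i)) = 0 := by
    refine f.map_eq_zero_of_eq _ (i := p) (j := q) ?_ hpq
    obtain ⟨j, -, hj⟩ := Finset.mem_image.1 (hsome p hp)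
    simp only [← hrpq, ← hj]
    rfl
  change _ • f _ = 0
  rw [this, smul_zero]

/-- Fewer than `n` diagonal letters among `2n - 1` leave at least `n` off-diagonal ones, too many
for a span of fewer than `n` elements. -/
theorem lowerSpan_eq_bot {n : ℕ} (hn : 0 < n) {κ : Type*} [Fintype κ] (v : κ → M)
    (hκ : Fintype.card κ < n) (u : Fin n × Fin n → M)
    (hu : ∀ i j, i ≠ j → u (i, j) ∈ Submodule.span S (Set.range v)) : lowerSpan S u = ⊥ := by
  classical
  rw [lowerSpan, Submodule.span_eq_bot]
  rintro _ ⟨ν, hν, rfl⟩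
  have := AlternatingMap.eq_zero_of_mem_span (ExteriorAlgebra.ιMulti S (2 * n - 1)) v
    (fun r => u (ν r)) (Finset.univ.filter fun r => ¬ (ν r).1 = (ν r).2) ?_ ?_
  · rwa [ExteriorAlgebra.ιMulti_apply] at this
  · have h1 := Finset.card_filter_add_card_filter_not
      (s := (Finset.univ : Finset (Fin (2 * n - 1)))) fun r => (ν r).1 = (ν r).2
    rw [Finset.card_univ, Fintype.card_fin] at h1
    omega
  · exact fun r hr => hu _ _ (Finset.mem_filter.1 hr).2

end Vanishing

/-! ### Change of basis and scaling -/

section Invariance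

open scoped Matrix

variable (k : Type*) [Field k] [CharZero k] {S : Type u} [CommRing S] [Algebra k S]

theorem dMat_mul_left {n : Type*} [Fintype n] (P : Matrix n n k) (A : Matrix n n S) :
    dMat k (P.map (algebraMap k S) * A) =
      (P.map (algebraMap k S)).map (algebraMap S (Forms k S)) * dMat k A := by
  ext i j
  simp only [dMat, d, Matrix.map_apply, Matrix.mul_apply, map_sum]
  refine Finset.sum_congr rfl fun l _ => ?_
  rw [Derivation.leibniz, Derivation.map_algebraMap, smul_zero, add_zero, map_smul,
    Algebra.smul_def]

theorem dMat_mul_right {n : Type*} [Fintype n] (P : Matrix n n k) (A : Matrix n n S) :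
    dMat k (A * P.map (algebraMap k S)) =
      dMat k A * (P.map (algebraMap k S)).map (algebraMap S (Forms k S)) := by
  ext i j
  simp only [dMat, d, Matrix.map_apply, Matrix.mul_apply, map_sum]
  refine Finset.sum_congr rfl fun l _ => ?_
  rw [Derivation.leibniz, Derivation.map_algebraMap, smul_zero, zero_add, map_smul,
    Algebra.smul_def, Algebra.commutes]

theorem isUnit_det_congruence {n : Type*} [Fintype n] [DecidableEq n] {P : Matrix n n k}
    (hP : IsUnit P.det) {A : Matrix n n S} (hA : IsUnit A.det) :
    IsUnit (P.map (algebraMap k S) * A * (P.map (algebraMap k S))ᵀ).det := by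
  have h1 : IsUnit (P.map (algebraMap k S)).det := by
    have := hP.map (algebraMap k S)
    rwa [RingHom.map_det] at this
  rw [Matrix.det_mul, Matrix.det_mul, Matrix.det_transpose]
  exact (h1.mul hA).mul h1

/-- The matrix `P` is constant, so its differential vanishes and `A⁻¹ dA` is merely conjugated. -/
theorem invForm_congruence {n : Type*} [Fintype n] [DecidableEq n] {P : Matrix n n k}
    (hP : IsUnit P.det) (A : Matrix n n S) (r : ℕ) :
    invForm k (P.map (algebraMap k S) * A * (P.map (algebraMap k S))ᵀ) r = invForm k A r := by
  set φ := algebraMap S (Forms k S)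
  set Q := P.map (algebraMap k S) with hQ
  have h1 : IsUnit Q.det := by
    have := hP.map (algebraMap k S)
    rwa [RingHom.map_det] at this
  have h1' : IsUnit Qᵀ.det := by rwa [Matrix.det_transpose]
  have h := oddSetting_exterior (M := Ω[S⁄k]) (isUnit_natCast_of_algebra k (S := S))
  have h2 : (Q * A * Qᵀ)⁻¹.map φ * dMat k (Q * A * Qᵀ) =
      tens φ Qᵀ⁻¹ 1 * (A⁻¹.map φ * dMat k A * tens φ Qᵀ 1) := by
    rw [hQ, ← Matrix.transpose_map, dMat_mul_right, dMat_mul_left, Matrix.transpose_map, ← hQ,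
      Matrix.mul_inv_rev, Matrix.mul_inv_rev, ← map_eq_tens, ← map_eq_tens, Matrix.map_mul,
      Matrix.map_mul]
    have h3 : Q⁻¹.map φ * Q.map φ = 1 := by
      rw [← Matrix.map_mul, Matrix.nonsing_inv_mul _ h1, Matrix.map_one _ φ.map_zero φ.map_one]
    simp only [Matrix.mul_assoc]
    rw [← Matrix.mul_assoc (Q⁻¹.map φ) (Q.map φ), h3, Matrix.one_mul]
  rw [invForm, h2, trace_pow_swap h, Matrix.mul_assoc, tens_mul h,
    Matrix.mul_nonsing_inv _ h1', one_mul, ← map_eq_tens, Matrix.map_one _ φ.map_zero φ.map_one,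
    Matrix.mul_one]
  rfl

theorem d_mem_exteriorOdd (s : S) : d k s ∈ exteriorOdd S (Ω[S⁄k]) := ι_mem_exteriorOdd _

theorem inv_mul_dMat_mem {n : ℕ} (A : Matrix (Fin n) (Fin n) S) (i j : Fin n) :
    (A⁻¹.map (algebraMap S (Forms k S)) * dMat k A) i j ∈ exteriorOdd S (Ω[S⁄k]) := by
  have h := oddSetting_exterior (M := Ω[S⁄k]) (isUnit_natCast_of_algebra k (S := S))
  rw [Matrix.mul_apply]
  exact AddSubgroup.sum_mem _ fun l _ => h.smul_mem _ _ (ι_mem_exteriorOdd _)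

/-- Scaling adds the scalar matrix `s⁻¹ ds` to `A⁻¹ dA`, to which odd power traces are blind. -/
theorem invForm_smul {n : ℕ} (hn : 1 < n) {s : S} (hs : IsUnit s) {A : Matrix (Fin n) (Fin n) S}
    (hA : IsUnit A.det) : invForm k (s • A) (2 * n - 1) = invForm k A (2 * n - 1) := by
  set φ := algebraMap S (Forms k S)
  have h := oddSetting_exterior (M := Ω[S⁄k]) (isUnit_natCast_of_algebra k (S := S))
  obtain ⟨s, rfl⟩ := hs
  have hinv : ((s : S) • A)⁻¹ = (↑s⁻¹ : S) • A⁻¹ := by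
    refine Matrix.inv_eq_right_inv ?_
    rw [Matrix.smul_mul, Matrix.mul_smul, smul_smul, Matrix.mul_nonsing_inv _ hA]
    simp
  have hX : ((s : S) • A)⁻¹.map φ * dMat k ((s : S) • A) = A⁻¹.map φ * dMat k A +
      Matrix.diagonal fun _ => φ ↑s⁻¹ * d k (s : S) := by
    have h1 : dMat k ((s : S) • A) = φ s • dMat k A + tens φ A (d k (s : S)) := by
      ext i j
      simp only [dMat, d, Matrix.map_apply, Matrix.smul_apply, smul_eq_mul, Derivation.leibniz,
        map_add, map_smul, Matrix.add_apply, tens_apply]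
      rw [Algebra.smul_def, Algebra.smul_def]
    have h2 : ((↑s⁻¹ : S) • A⁻¹).map φ = tens φ A⁻¹ (φ ↑s⁻¹) := by
      ext i j
      simp only [Matrix.map_apply, Matrix.smul_apply, smul_eq_mul, map_mul, tens_apply]
      exact (h.central _ _).eq
    rw [hinv, h1, h2, mul_add, tens_mul h, Matrix.nonsing_inv_mul _ hA]
    congr 1
    · ext i j
      simp only [Matrix.mul_apply, tens_apply, Matrix.smul_apply, smul_eq_mul, Matrix.map_apply]
      refine Finset.sum_congr rfl fun l _ => ?_
      rw [mul_assoc, ← mul_assoc (φ _) (φ _) (dMat k A l j), ← map_mul, Units.inv_mul, map_one,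
        one_mul]
    · ext i j
      by_cases hij : i = j <;> simp [tens_apply, hij, Matrix.one_apply]
  obtain ⟨r, rfl⟩ : ∃ r, n = r + 1 := ⟨n - 1, by omega⟩
  rw [invForm, hX, show 2 * (r + 1) - 1 = 2 * r + 1 by omega,
    h.trace_add_diagonal_pow (inv_mul_dMat_mem k A) (h.smul_mem _ _ (d_mem_exteriorOdd k _))
      (by omega)]
  rfl

/-- The form `tr ((A⁻¹ (s dA - A ds)) ^ (2n-1))` is `s ^ (2n-1)` times the invariant form. -/
theorem trace_pow_twisted {n : ℕ} (hn : 1 < n) (s : S) {A : Matrix (Fin n) (Fin n) S}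
    (hA : IsUnit A.det) :
    ((A⁻¹.map (algebraMap S (Forms k S)) * oneForms fun q : Fin n × Fin n =>
      s • KaehlerDifferential.D k S (A q.1 q.2) - A q.1 q.2 • KaehlerDifferential.D k S s) ^
        (2 * n - 1)).trace = s ^ (2 * n - 1) • invForm k A (2 * n - 1) := by
  set φ := algebraMap S (Forms k S)
  have h := oddSetting_exterior (M := Ω[S⁄k]) (isUnit_natCast_of_algebra k (S := S))
  have hX : (A⁻¹.map φ * oneForms fun q : Fin n × Fin n =>
      s • KaehlerDifferential.D k S (A q.1 q.2) - A q.1 q.2 • KaehlerDifferential.D k S s) =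
      s • (A⁻¹.map φ * dMat k A) + Matrix.diagonal fun _ => -d k s := by
    have h1 : (oneForms fun q : Fin n × Fin n =>
        s • KaehlerDifferential.D k S (A q.1 q.2) - A q.1 q.2 • KaehlerDifferential.D k S s) =
        s • dMat k A + tens φ A (-d k s) := by
      ext i j
      simp only [oneForms, Matrix.of_apply, map_sub, map_smul, Matrix.add_apply, tens_apply,
        Matrix.smul_apply, mul_neg, sub_eq_add_neg, map_add, map_neg]
      rw [Algebra.smul_def (A i j)]
      rfl
    rw [h1, mul_add, map_eq_tens, tens_mul h, Matrix.nonsing_inv_mul _ hA, Matrix.mul_smul]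
    congr 1
    ext i j
    by_cases hij : i = j <;> simp [tens_apply, hij, Matrix.one_apply]
  have hmem (i j) : (s • (A⁻¹.map φ * dMat k A)) i j ∈ exteriorOdd S (Ω[S⁄k]) := by
    rw [Matrix.smul_apply, Algebra.smul_def]
    exact h.smul_mem _ _ (inv_mul_dMat_mem k A i j)
  obtain ⟨r, rfl⟩ : ∃ r, n = r + 1 := ⟨n - 1, by omega⟩
  rw [hX, show 2 * (r + 1) - 1 = 2 * r + 1 by omega,
    h.trace_add_diagonal_pow hmem (AddSubgroup.neg_mem _ (d_mem_exteriorOdd k _)) (by omega),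
    smul_pow, Matrix.trace_smul]
  rfl

end Invariance

/-! ### Laplacians of matrices -/

section LaplacianMatrix

open scoped Matrix

variable {k : Type*} [Field k] {S : Type u} [CommRing S] [Algebra k S]
variable {E : Type*} [Fintype E] [DecidableEq E] {n : ℕ}

/-- The matrix `C diag(x) Cᵀ`. -/
def lapMat (C : Matrix (Fin n) E k) (x : E → S) : Matrix (Fin n) (Fin n) S :=
  C.map (algebraMap k S) * Matrix.diagonal x * (C.map (algebraMap k S))ᵀ

theorem lapMat_apply (C : Matrix (Fin n) E k) (x : E → S) (i j : Fin n) :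
    lapMat C x i j = ∑ e, algebraMap k S (C i e * C j e) * x e := by
  rw [lapMat, Matrix.mul_apply]
  refine Finset.sum_congr rfl fun e _ => ?_
  rw [Matrix.mul_diagonal, Matrix.transpose_apply, Matrix.map_apply, Matrix.map_apply, map_mul]
  ring

theorem lapMat_comm (C : Matrix (Fin n) E k) (x : E → S) (i j : Fin n) :
    lapMat C x i j = lapMat C x j i := by
  rw [lapMat_apply, lapMat_apply]
  exact Finset.sum_congr rfl fun e _ => by rw [mul_comm (C i e)]

theorem lapMat_mul (P : Matrix (Fin n) (Fin n) k) (C : Matrix (Fin n) E k) (x : E → S) :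
    lapMat (P * C) x =
      P.map (algebraMap k S) * lapMat C x * (P.map (algebraMap k S))ᵀ := by
  simp only [lapMat, Matrix.map_mul, Matrix.transpose_mul, Matrix.mul_assoc]

theorem D_lapMat (C : Matrix (Fin n) E k) (x : E → S) (i j : Fin n) :
    KaehlerDifferential.D k S (lapMat C x i j) =
      ∑ e, algebraMap k S (C i e * C j e) • KaehlerDifferential.D k S (x e) := by
  rw [lapMat_apply, map_sum]
  refine Finset.sum_congr rfl fun e _ => ?_
  rw [Derivation.leibniz, Derivation.map_algebraMap, smul_zero, add_zero]

theorem apply_of_submatrix_eq_one {C : Matrix (Fin n) E k} {J : Fin n → E}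
    (hJ : C.submatrix id J = 1) (i j : Fin n) : C i (J j) = if i = j then 1 else 0 := by
  have := congrFun (congrFun hJ i) j
  rwa [Matrix.one_apply] at this

theorem injective_of_submatrix_eq_one {C : Matrix (Fin n) E k} {J : Fin n → E}
    (hJ : C.submatrix id J = 1) : Function.Injective J := fun i j hij => by
  by_contra h
  have h1 := apply_of_submatrix_eq_one hJ i i
  have h2 := apply_of_submatrix_eq_one hJ i j
  rw [if_neg h, ← hij, h1, if_pos rfl] at h2
  exact one_ne_zero h2

theorem mul_eq_zero_of_submatrix_eq_one {C : Matrix (Fin n) E k} {J : Fin n → E}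
    (hJ : C.submatrix id J = 1) {i j : Fin n} (hij : i ≠ j) (l : Fin n) :
    C i (J l) * C j (J l) = 0 := by
  rw [apply_of_submatrix_eq_one hJ, apply_of_submatrix_eq_one hJ]
  by_cases h : i = l
  · rw [if_neg fun h' : j = l => hij (h.trans h'.symm), mul_zero]
  · rw [if_neg h, zero_mul]

variable [CharZero k]

/-- If the columns `J` of `C` form the identity matrix, the invariant form of the Laplacian is
annihilated by a power of each variable outside `J`. -/
theorem smul_pow_invForm_of_one (hn : 1 < n) (heven : Even n) (hE : Fintype.card E = 2 * n)
    (C : Matrix (Fin n) E k) (x : E → S) (hdet : IsUnit (lapMat C x).det) (J : Fin n → E)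
    (hJ : C.submatrix id J = 1) {e : E} (he : e ∉ Set.range J) :
    x e ^ (2 * n - 1) • invForm k (lapMat C x) (2 * n - 1) = 0 := by
  classical
  let D := KaehlerDifferential.D k S
  have hinj := injective_of_submatrix_eq_one hJ
  -- A replacement for the chart `x e = 1` when `x e` is not a unit: `x e • dx_f - x f • dx_e` is `x
  -- e ^ 2` times the differential of `x f / x e`, with denominators cleared, and vanishes for `f =
  -- e`.
  let u (q : Fin n × Fin n) : Ω[S⁄k] := x e • D (lapMat C x q.1 q.2) - lapMat C x q.1 q.2 • D (x e)
  have hu (i j : Fin n) : u (i, j) = ∑ f, algebraMap k S (C i f * C j f) •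
      (x e • D (x f) - x f • D (x e)) := by
    simp only [u, D, D_lapMat]
    rw [lapMat_apply, Finset.smul_sum, Finset.sum_smul, ← Finset.sum_sub_distrib]
    refine Finset.sum_congr rfl fun f _ => ?_
    rw [smul_sub, smul_smul, smul_smul, smul_smul, mul_comm (x e)]
  let K : Finset E := (insert e (Finset.univ.image J))ᶜ
  -- Neither `e` nor the `n` columns in `J` contribute off the diagonal, so `2n - n - 1` letters
  -- remain.
  have hK : K.card < n := by
    have h1 : (insert e (Finset.univ.image J)).card = n + 1 := by
      rw [Finset.card_insert_of_notMem (by simpa using he), Finset.card_image_of_injective _ hinj,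
        Finset.card_univ, Fintype.card_fin]
    have h2 := Finset.card_compl (insert e (Finset.univ.image J))
    rw [h1, hE] at h2
    change K.card = _ at h2
    omega
  have hbot : lowerSpan S u = ⊥ := by
    refine lowerSpan_eq_bot (by omega) (fun f : K => x e • D (x f) - x f • D (x e))
      (by simpa using hK) u fun i j hij => ?_
    rw [hu]
    refine Submodule.sum_mem _ fun f _ => ?_
    by_cases hf : f ∈ K
    · exact Submodule.smul_mem _ _ (Submodule.subset_span ⟨⟨f, hf⟩, rfl⟩)
    · rw [Finset.mem_compl, not_not, Finset.mem_insert] at hf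
      rcases hf with rfl | hf
      · simp
      · obtain ⟨l, -, rfl⟩ := Finset.mem_image.1 hf
        rw [mul_eq_zero_of_submatrix_eq_one hJ hij, map_zero, zero_smul]
        exact Submodule.zero_mem _
  have htw := trace_pow_twisted k hn (x e) hdet
  obtain ⟨m, rfl⟩ : ∃ m, n = m + 1 := ⟨n - 1, by omega⟩
  rw [← htw]
  have hmem := trace_pow_mem_lowerSpan (isUnit_natCast_of_algebra k) heven
    (Matrix.IsSymm.ext fun i j => lapMat_comm C x j i) hdet u fun i j => by
      simp only [u, lapMat_comm C x i j]
  rwa [hbot, Submodule.mem_bot] at hmem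

/-- Multiplication by the inverse of the submatrix makes the columns `J` the identity without
changing the form. -/
theorem smul_pow_invForm_of_isUnit (hn : 1 < n) (heven : Even n) (hE : Fintype.card E = 2 * n)
    (C : Matrix (Fin n) E k) (x : E → S) (hdet : IsUnit (lapMat C x).det) (J : Fin n → E)
    (hJ : IsUnit (C.submatrix id J).det) {e : E} (he : e ∉ Set.range J) :
    x e ^ (2 * n - 1) • invForm k (lapMat C x) (2 * n - 1) = 0 := by
  have hP : IsUnit ((C.submatrix id J)⁻¹).det := by
    rw [Matrix.det_nonsing_inv]
    exact hJ.ringInverse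
  rw [← invForm_congruence k hP, ← lapMat_mul]
  refine smul_pow_invForm_of_one hn heven hE _ x ?_ J ?_ he
  · rw [lapMat_mul]
    exact isUnit_det_congruence k hP hdet
  · have : ((C.submatrix id J)⁻¹ * C).submatrix id J =
        (C.submatrix id J)⁻¹ * C.submatrix id J := rfl
    rw [this, Matrix.nonsing_inv_mul _ hJ]

omit [CharZero k] in
/-- A matrix with invertible Laplacian has an invertible square submatrix. -/
theorem exists_isUnit_submatrix [Nontrivial S] (C : Matrix (Fin n) E k) (x : E → S)
    (hdet : IsUnit (lapMat C x).det) : ∃ J : Fin n → E, IsUnit (C.submatrix id J).det := by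
  -- A relation between the rows of `C` would be one between the rows of the invertible Laplacian.
  -- Full row rank then provides `n` independent columns.
  have hrow : LinearIndependent k C.row := by
    rw [← Matrix.vecMul_injective_iff]
    intro v w hvw
    have h0 : (v - w) ᵥ* C = 0 := by rw [Matrix.sub_vecMul]; exact sub_eq_zero.2 hvw
    have h1 : (algebraMap k S ∘ (v - w)) ᵥ* lapMat C x = 0 := by
      have h2 : (algebraMap k S ∘ (v - w)) ᵥ* C.map (algebraMap k S) = 0 := by
        funext i
        rw [← RingHom.map_vecMul, h0, Pi.zero_apply, Pi.zero_apply, map_zero]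
      rw [lapMat, Matrix.mul_assoc, ← Matrix.vecMul_vecMul, h2, Matrix.zero_vecMul]
    have h2 : (algebraMap k S ∘ (v - w)) = 0 := by
      have := congrArg (fun z => z ᵥ* (lapMat C x)⁻¹) h1
      simpa [Matrix.vecMul_vecMul, Matrix.mul_nonsing_inv _ hdet] using this
    funext i
    have h3 := congrFun h2 i
    exact sub_eq_zero.1 ((map_eq_zero (algebraMap k S)).1 h3)
  have hrank : C.rank = n := by
    rw [hrow.rank_matrix, Fintype.card_fin]
  rw [Matrix.rank_eq_finrank_span_cols] at hrank
  have hex := Submodule.exists_fun_fin_finrank_span_eq k (Set.range C.col)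
  rw [hrank] at hex
  obtain ⟨f, hf, -, hli⟩ := hex
  choose J hJ using hf
  refine ⟨J, (Matrix.isUnit_iff_isUnit_det _).1 (Matrix.linearIndependent_cols_iff_isUnit.1 ?_)⟩
  have : (C.submatrix id J).col = f := by
    funext i
    exact hJ i
  rwa [this]

/-- The invariant form of degree `2n-1` of a Laplacian in `2n` variables vanishes for even `n`. -/
theorem invForm_lapMat_eq_zero (hn : 1 < n) (heven : Even n) (hE : Fintype.card E = 2 * n)
    (C : Matrix (Fin n) E k) (x : E → S) (hdet : IsUnit (lapMat C x).det) :
    invForm k (lapMat C x) (2 * n - 1) = 0 := by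
  classical
  cases subsingleton_or_nontrivial S
  · exact (Module.subsingleton S (Forms k S)).elim _ _
  obtain ⟨J, hJ⟩ := exists_isUnit_submatrix C x hdet
  have hP : IsUnit ((C.submatrix id J)⁻¹).det := by
    rw [Matrix.det_nonsing_inv]
    exact hJ.ringInverse
  have hdet' := isUnit_det_congruence k hP hdet
  rw [← invForm_congruence k hP, ← lapMat_mul]
  rw [← lapMat_mul] at hdet'
  have hJ1 : ((C.submatrix id J)⁻¹ * C).submatrix id J = 1 := by
    have : ((C.submatrix id J)⁻¹ * C).submatrix id J =
        (C.submatrix id J)⁻¹ * C.submatrix id J := rfl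
    rw [this, Matrix.nonsing_inv_mul _ hJ]
  generalize (C.submatrix id J)⁻¹ * C = B at hdet' hJ1 ⊢
  -- In the degenerate case the Laplacian is diagonal, so its off-diagonal differentials are zero
  -- and no term of lower degree remains.
  by_cases h0 : ∀ i, ∀ e ∉ Set.range J, B i e = 0
  · have hoff (i j : Fin n) (hij : i ≠ j) : lapMat B x i j = 0 := by
      rw [lapMat_apply]
      refine Finset.sum_eq_zero fun e _ => ?_
      by_cases he : e ∈ Set.range J
      · obtain ⟨l, rfl⟩ := he
        rw [mul_eq_zero_of_submatrix_eq_one hJ1 hij, map_zero, zero_mul]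
      · rw [h0 i e he, zero_mul, map_zero, zero_mul]
    obtain ⟨m, rfl⟩ : ∃ m, n = m + 1 := ⟨n - 1, by omega⟩
    have hmem := invForm_mem_lowerDiagTerms k
      (Matrix.IsSymm.ext fun i j => lapMat_comm B x j i) hdet' heven
    rw [lowerDiagTerms_eq, lowerSpan_eq_bot (by omega) (Fin.elim0 : Fin 0 → Ω[S⁄k]) (by simp)] at hmem
    · exact (Submodule.mem_bot S).1 hmem
    · intro i j hij
      dsimp only
      rw [hoff i j hij, map_zero]
      exact Submodule.zero_mem _
  · push Not at h0
    obtain ⟨i, e, he, hie⟩ := h0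
    set ω := invForm k (lapMat B x) (2 * n - 1)
    -- The annihilator of the form. Its radical contains every variable missed by some invertible
    -- choice of columns; the aim is to show that it is the whole ring.
    let I₀ : Ideal S := LinearMap.ker (LinearMap.toSpanSingleton S (Forms k S) ω)
    let I : Ideal S := I₀.radical
    have hI (J' : Fin n → E) (hJ' : IsUnit (B.submatrix id J').det) (f : E)
        (hf : f ∉ Set.range J') : x f ∈ I :=
      ⟨2 * n - 1, smul_pow_invForm_of_isUnit hn heven hE B x hdet' J' hJ' hf⟩
    have hout (f : E) (hf : f ∉ Set.range J) : x f ∈ I :=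
      hI J (by rw [hJ1, Matrix.det_one]; exact isUnit_one) f hf
    have hinj := injective_of_submatrix_eq_one hJ1
    -- Basis exchange: since `B i e ≠ 0`, replacing the column `J i` by `e` keeps the minor
    -- invertible, and the new choice misses `J i`.
    have hi : x (J i) ∈ I := by
      refine hI (Function.update J i e) ?_ _ ?_
      · have h1 : B.submatrix id (Function.update J i e) =
            (1 : Matrix (Fin n) (Fin n) k).updateCol i fun a => B a e := by
          ext a b
          rw [← hJ1]
          by_cases hb : b = i
          · subst hb
            simp
          · simp [hb]
        rw [h1, ← Matrix.cramer_apply, Matrix.cramer_one]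
        exact IsUnit.mk0 _ hie
      · rintro ⟨l, hl⟩
        by_cases hli : l = i
        · subst hli
          rw [Function.update_self] at hl
          exact he ⟨l, hl.symm⟩
        · rw [Function.update_of_ne hli] at hl
          exact hli (hinj hl)
    have hrow (j : Fin n) : lapMat B x i j ∈ I := by
      rw [lapMat_apply]
      refine Ideal.sum_mem _ fun f _ => ?_
      by_cases hf : f ∈ Set.range J
      · obtain ⟨l, rfl⟩ := hf
        by_cases h : i = l
        · subst h
          exact Ideal.mul_mem_left _ _ hi
        · rw [apply_of_submatrix_eq_one hJ1, if_neg h, zero_mul, map_zero, zero_mul]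
          exact Ideal.zero_mem _
      · exact Ideal.mul_mem_left _ _ (hout f hf)
    -- All entries of row `i` lie in the ideal, hence so does the determinant, which is a unit.
    have hdetI : (lapMat B x).det ∈ I := by
      rw [Matrix.det_eq_sum_mul_adjugate_row _ i]
      exact Ideal.sum_mem _ fun j _ => Ideal.mul_mem_right _ _ (hrow j)
    have htop := Ideal.eq_top_of_isUnit_mem _ hdetI hdet'
    rw [show I = I₀.radical from rfl, Ideal.radical_eq_top, Ideal.eq_top_iff_one, LinearMap.mem_ker,
      LinearMap.toSpanSingleton_apply, one_smul] at htop
    exact htop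

end LaplacianMatrix

/-! ### Graph Laplacians -/

section GraphLaplacian

open scoped Matrix

variable (k : Type*) [Field k] {S : Type*} [CommRing S] [Algebra k S]
variable {V E : Type*} {G : Graph V E} [Fintype G.edgeSet] {o : Orientation G} {n : ℕ}

/-- The matrix of coefficients of a basis of the first homology. -/
def chainMat (c : Module.Basis (Fin n) ℤ (H1 o)) : Matrix (Fin n) G.edgeSet k :=
  Matrix.of fun i e => (((c i : G.edgeSet → ℤ) e : ℤ) : k)

theorem laplacian_eq_lapMat [DecidableEq G.edgeSet] (c : Module.Basis (Fin n) ℤ (H1 o))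
    (x : G.edgeSet → S) : laplacian c x = lapMat (chainMat k c) x := by
  ext i j
  rw [lapMat_apply, laplacian, Matrix.of_apply]
  refine Finset.sum_congr rfl fun e _ => ?_
  rw [chainMat, Matrix.of_apply, Matrix.of_apply, map_mul, map_intCast, map_intCast]

/-- The change of basis is unimodular over the integers. The form `det² = 1` covers both signs, and
a Laplacian only sees the square. -/
theorem exists_chainMat_eq_mul (b c : Module.Basis (Fin n) ℤ (H1 o)) :
    ∃ P : Matrix (Fin n) (Fin n) k, P.det * P.det = 1 ∧ chainMat k c = P * chainMat k b := by
  refine ⟨(b.toMatrix c)ᵀ.map (Int.castRingHom k), ?_, ?_⟩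
  · have h1 : (b.toMatrix c).det * (c.toMatrix b).det = 1 := by
      rw [← Matrix.det_mul, Module.Basis.toMatrix_mul_toMatrix_flip, Matrix.det_one]
    have h2 : (b.toMatrix c).det * (b.toMatrix c).det = 1 := by
      rcases Int.isUnit_iff.1 (IsUnit.of_mul_eq_one _ h1) with h | h <;> rw [h] <;> norm_num
    have h3 := congrArg (Int.castRingHom k) h2
    rw [map_mul, map_one] at h3
    have h4 := RingHom.map_det (Int.castRingHom k) (b.toMatrix c)ᵀ
    rw [Matrix.det_transpose] at h4
    rw [← RingHom.mapMatrix_apply, ← h4, h3]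
  · ext i e
    have h1 := congrArg (fun z : H1 o => (z : G.edgeSet → ℤ) e) (b.sum_toMatrix_smul_self c i)
    simp only [Submodule.coe_sum, Finset.sum_apply, Submodule.coe_smul, Pi.smul_apply,
      smul_eq_mul] at h1
    rw [Matrix.mul_apply]
    simp only [chainMat, Matrix.of_apply, Matrix.map_apply, Matrix.transpose_apply]
    rw [← h1]
    simp

include k in
theorem graphPoly_eq (b c : Module.Basis (Fin n) ℤ (H1 o)) (x : G.edgeSet → S) :
    graphPoly b x = graphPoly c x := by
  classical
  obtain ⟨P, hP, h⟩ := exists_chainMat_eq_mul k c b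
  have h2 := RingHom.map_det (algebraMap k S) P
  rw [RingHom.mapMatrix_apply] at h2
  rw [graphPoly, graphPoly, laplacian_eq_lapMat k, laplacian_eq_lapMat k, h, lapMat_mul,
    Matrix.det_mul, Matrix.det_mul, Matrix.det_transpose, ← h2, mul_right_comm, ← map_mul, hP,
    map_one, one_mul]

theorem laplacian_smul (c : Module.Basis (Fin n) ℤ (H1 o)) (s : S) (x : G.edgeSet → S) :
    laplacian c (fun e => s * x e) = s • laplacian c x := by
  ext i j
  simp only [laplacian, Matrix.of_apply, Matrix.smul_apply, smul_eq_mul, Finset.mul_sum]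
  exact Finset.sum_congr rfl fun e _ => by ring

/-- The members of a tree basis meet the complement of the tree in different edges. -/
theorem IsTreeBasis.exists_injective {T : Set G.edgeSet} (hT : IsSpanningTree o T)
    {c : Module.Basis (Fin n) ℤ (H1 o)} (hc : IsTreeBasis T c) : ∃ J : Fin n → G.edgeSet,
      Function.Injective J ∧ (∀ i, J i ∉ T) ∧
        ∀ i e, e ∉ T → (c i : G.edgeSet → ℤ) e ≠ 0 → e = J i := by
  choose J hJ hJ' using hc
  refine ⟨J, fun i j hij => ?_, fun i => (hJ i).1, fun i e h1 h2 => hJ' i e ⟨h1, h2⟩⟩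
  by_contra hne
  -- If two members met the complement of the tree in the same edge, this combination would be a
  -- cycle inside the tree, hence zero, against the independence of the basis.
  let z : H1 o := (c j : G.edgeSet → ℤ) (J j) • c i - (c i : G.edgeSet → ℤ) (J i) • c j
  have hz : (z : G.edgeSet → ℤ) = 0 := by
    refine hT.2 z z.2 fun e he => ?_
    simp only [z, Submodule.coe_sub, Submodule.coe_smul, Pi.sub_apply, Pi.smul_apply, smul_eq_mul]
    by_cases h : e = J i
    · rw [h, ← hij, mul_comm, sub_self]
    · have h1 : (c i : G.edgeSet → ℤ) e = 0 := by
        by_contra h'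
        exact h (hJ' i e ⟨he, h'⟩)
      have h2 : (c j : G.edgeSet → ℤ) e = 0 := by
        by_contra h'
        exact h ((hJ' j e ⟨he, h'⟩).trans hij.symm)
      rw [h1, h2, mul_zero, mul_zero, sub_zero]
  have hz' : z = 0 := Subtype.ext hz
  have h3 := congrArg (fun w => c.repr w i) hz'
  simp only [z, map_sub, map_smul, Module.Basis.repr_self, Finsupp.coe_sub, Finsupp.coe_smul,
    Pi.sub_apply, Pi.smul_apply, Finsupp.single_eq_same, map_zero, Finsupp.coe_zero,
    Pi.zero_apply, smul_eq_mul, mul_one, Finsupp.single_eq_of_ne hne, mul_zero, sub_zero] at h3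
  exact (hJ j).2 h3

variable [CharZero k]

theorem invForm_laplacian_eq (b c : Module.Basis (Fin n) ℤ (H1 o)) (x : G.edgeSet → S) (r : ℕ) :
    invForm k (laplacian b x) r = invForm k (laplacian c x) r := by
  classical
  obtain ⟨P, hP, h⟩ := exists_chainMat_eq_mul k c b
  rw [laplacian_eq_lapMat k, laplacian_eq_lapMat k, h, lapMat_mul,
    invForm_congruence k (IsUnit.of_mul_eq_one _ hP)]

/-- Each edge outside the tree belongs to one member of the basis, so it occurs only on the
diagonal, and `d y_{e₀} = 0`. Off the diagonal only the differentials of the other `n - 1` tree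
edges appear. -/
theorem lowerDiagTerms_laplacian (hn : 1 < n) (hE : Fintype.card G.edgeSet = 2 * n)
    {T : Set G.edgeSet} (hT : IsSpanningTree o T) {c : Module.Basis (Fin n) ℤ (H1 o)}
    (hc : IsTreeBasis T c) {e₀ : G.edgeSet} (he₀ : e₀ ∈ T) {y : G.edgeSet → S} (hy : y e₀ = 1) :
    lowerDiagTerms k (laplacian c y) = ⊥ := by
  classical
  obtain ⟨J, hinj, hJT, hJ⟩ := hc.exists_injective hT
  let K : Finset G.edgeSet := (insert e₀ (Finset.univ.image J))ᶜ
  have hK : K.card < n := by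
    have h1 : (insert e₀ (Finset.univ.image J)).card = n + 1 := by
      rw [Finset.card_insert_of_notMem, Finset.card_image_of_injective _ hinj, Finset.card_univ,
        Fintype.card_fin]
      intro h
      obtain ⟨i, -, hi⟩ := Finset.mem_image.1 h
      exact hJT i (hi ▸ he₀)
    have h2 := Finset.card_compl (insert e₀ (Finset.univ.image J))
    rw [h1, hE] at h2
    change K.card = _ at h2
    omega
  rw [lowerDiagTerms_eq]
  refine lowerSpan_eq_bot (by omega) (fun e : K => KaehlerDifferential.D k S (y e))
    (by simpa using hK) _ fun i j hij => ?_
  dsimp only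
  rw [laplacian_eq_lapMat k, D_lapMat]
  refine Submodule.sum_mem _ fun e _ => ?_
  by_cases he : e ∈ K
  · exact Submodule.smul_mem _ _ (Submodule.subset_span ⟨⟨e, he⟩, rfl⟩)
  · rw [Finset.mem_compl, not_not, Finset.mem_insert] at he
    rcases he with rfl | he
    · rw [hy, Derivation.map_one_eq_zero, smul_zero]
      exact Submodule.zero_mem _
    · obtain ⟨l, -, rfl⟩ := Finset.mem_image.1 he
      have : chainMat k c i (J l) * chainMat k c j (J l) = 0 := by
        by_contra h
        have h1 : (c i : G.edgeSet → ℤ) (J l) ≠ 0 := fun h' =>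
          h (by simp [chainMat, h'])
        have h2 : (c j : G.edgeSet → ℤ) (J l) ≠ 0 := fun h' =>
          h (by simp [chainMat, h'])
        exact hij ((hinj (hJ i _ (hJT l) h1)).symm.trans (hinj (hJ j _ (hJT l) h2)))
      rw [this, map_zero, zero_smul]
      exact Submodule.zero_mem _

theorem invForm_laplacian_of_odd (hn : 1 < n) (hE : Fintype.card G.edgeSet = 2 * n)
    (b : Module.Basis (Fin n) ℤ (H1 o)) {x : G.edgeSet → S} (hx : IsUnit (graphPoly b x))
    (hodd : Odd n) {T : Set G.edgeSet} (hT : IsSpanningTree o T) {e₀ : G.edgeSet} (he₀ : e₀ ∈ T)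
    (hxe : IsUnit (x e₀)) {c : Module.Basis (Fin n) ℤ (H1 o)} (hc : IsTreeBasis T c) :
    let y := fun e => Ring.inverse (x e₀) * x e
    invForm k (laplacian b x) (2 * n - 1) =
      leadingTerms k (laplacian c y) (laplacian_isSymm c y) (graphPoly b y) := by
  intro y
  have hy : laplacian c y = Ring.inverse (x e₀) • laplacian c x := laplacian_smul c _ x
  have hs : IsUnit (Ring.inverse (x e₀)) := hxe.ringInverse
  have hdet : IsUnit (laplacian c x).det := by
    rw [graphPoly_eq k b c] at hx
    exact hx
  have hdet' : IsUnit (laplacian c y).det := by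
    rw [hy, Matrix.det_smul]
    exact (hs.pow _).mul hdet
  -- Invariance under change of basis and scaling moves the form to the tree basis in the affine
  -- chart, where all terms of lower degree vanish.
  rw [invForm_laplacian_eq k b c, ← invForm_smul k hn hs hdet, ← hy, graphPoly_eq k b c]
  obtain ⟨m, rfl⟩ : ∃ m, n = m + 1 := ⟨n - 1, by omega⟩
  obtain ⟨η, hη, h⟩ := invForm_eq_leadingTerms_add k (by omega) (laplacian_isSymm c y) hdet' hodd
  rw [lowerDiagTerms_laplacian k hn hE hT hc he₀ (Ring.inverse_mul_cancel _ hxe),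
    Submodule.mem_bot] at hη
  rw [h, hη, add_zero]
  rfl

theorem invForm_laplacian_of_even (hn : 1 < n) (hE : Fintype.card G.edgeSet = 2 * n)
    (b : Module.Basis (Fin n) ℤ (H1 o)) {x : G.edgeSet → S} (hx : IsUnit (graphPoly b x))
    (heven : Even n) : invForm k (laplacian b x) (2 * n - 1) = 0 := by
  classical
  rw [graphPoly, laplacian_eq_lapMat k] at hx
  rw [laplacian_eq_lapMat k]
  exact invForm_lapMat_eq_zero hn heven hE _ x hx

end GraphLaplacian

end CanonicalForm

end

theorem mainTheorem10 {k : Type*} [Field k] [CharZero k] {S : Type*} [CommRing S]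
    [Algebra k S] (n : ℕ) (hn : 1 < n) :
    -- symmetric invertible matrices
    (∀ (A : Matrix (Fin n) (Fin n) S) (hA : A.IsSymm), IsUnit A.det →
      (Odd n → ∃ η ∈ CanonicalForm.lowerDiagTerms k A,
        CanonicalForm.invForm k A (2 * n - 1) =
          CanonicalForm.leadingTerms k A hA A.det + η) ∧
      (Even n → CanonicalForm.invForm k A (2 * n - 1) ∈ CanonicalForm.lowerDiagTerms k A)) ∧
    -- connected graphs with `n` independent cycles and `2n` edges
    (∀ {V : Type u} {E : Type v} (G : Graph V E) [Fintype G.edgeSet]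
        (o : CanonicalForm.Orientation G),
      G.vertexSet.Finite → CanonicalForm.IsConnected G →
      CanonicalForm.loopNumber o = n → Fintype.card G.edgeSet = 2 * n →
      ∀ (b : Module.Basis (Fin n) ℤ (CanonicalForm.H1 o)) (x : G.edgeSet → S),
        IsUnit (CanonicalForm.graphPoly b x) →
        (Odd n → ∀ T : Set G.edgeSet, CanonicalForm.IsSpanningTree o T →
          ∀ e₀ ∈ T, IsUnit (x e₀) →
          ∀ c : Module.Basis (Fin n) ℤ (CanonicalForm.H1 o), CanonicalForm.IsTreeBasis T c →
          -- the affine coordinates of `x` in the chart in which the variable of `e₀` is `1`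
          ∀ y : G.edgeSet → S, (y = fun e => Ring.inverse (x e₀) * x e) →
            CanonicalForm.invForm k (CanonicalForm.laplacian b x) (2 * n - 1) =
              CanonicalForm.leadingTerms k (CanonicalForm.laplacian c y)
                (CanonicalForm.laplacian_isSymm c y) (CanonicalForm.graphPoly b y)) ∧
        (Even n → CanonicalForm.invForm k (CanonicalForm.laplacian b x) (2 * n - 1) = 0)) := by
  constructor
  · obtain ⟨m, rfl⟩ : ∃ m, n = m + 1 := ⟨n - 1, by omega⟩
    intro A hA hdet
    exact ⟨CanonicalForm.invForm_eq_leadingTerms_add k (by omega) hA hdet,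
      CanonicalForm.invForm_mem_lowerDiagTerms k hA hdet⟩
  · intro V E G _ o _ _ _ hE b x hx
    refine ⟨?_, CanonicalForm.invForm_laplacian_of_even k hn hE b hx⟩
    rintro hodd T hT e₀ he₀ hxe c hc y rfl
    exact CanonicalForm.invForm_laplacian_of_odd k hn hE b hx hodd hT he₀ hxe hc
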